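/- Let $V=\mathbb{C}^m$, and let $X\subset\mathbb{P}V$ be an irreducible Zariski closed subset of dimension $n$ that is not contained in any hyperplane. Let $G(s,V)$ denote the Grassmannian of $s$-dimensional linear subspaces of $V$, with its Zariski topology. For $E\in G(s,V)$ let the $X$-rank $R_X(E)$ be the smallest $k$ such that $E\subset\langle x_1,\dots,x_k\rangle$ for some $x_1,\dots,x_k\in X$, and let $\sigma_{r,s}(X)\subset G(s,V)$ be the Zariski closure of $\{E\in G(s,V): R_X(E)\le r\}$. Then the following hold. 1. For every $r\le\dim V$, $$\dim\sigma_{r,r}(X)=\min\{rn,\ \dim G(r,V)\}.$$ 2. For $s\le r\le\dim V$ let $$B_{r,s}=\{(F,E)\in G(r,V)\times G(s,V): F\in\sigma_{r,r}(X),\ E\subset F\}$$ (the bundle of Grassmannians $G(s,F)$ over $\sigma_{r,r}(X)$), and consider the projection $B_{r,s}\to G(s,V)$, $(F,E)\mapsto E$. Call $\min\{\dim B_{r,s},\ \dim G(s,V)\}$ the expected dimension of $\sigma_{r,s}(X)$. Then the expected dimension of $\sigma_{r,s}(X)$ is $$\min\{rn+s(r-s),\ \dim G(s,V)\}.$$ The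 dimension of $\sigma_{r,s}(X)$ is at most its expected dimension, and the two are equal if the projection is generically finite to one, that is, if its fibres over the points of some nonempty Zariski open subset of $\sigma_{r,s}(X)$ are finite. -/

import Mathlib

/-! # Zariski topologies on projective space and Grassmannians; the varieties `σ_{r,s}(X)`

Throughout `V = ℂ^m` is `Fin m → ℂ`, and the dimension of a (locally closed) set is the Krull
dimension of the set with the topology induced by the Zariski topology. -/

namespace SubspaceRank

/-- Affine space over `ℂ` with coordinates indexed by `ι`, a copy of `ι → ℂ` that carries the
Zariski topology instead of the Euclidean one. -/
def AffineSp (ι : Type) : Type := ι → ℂ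

/-- The Zariski topology: the closed sets are the common zero loci of sets of polynomials. It is
pulled back from the spectrum of the polynomial ring along `x ↦ {p | p x = 0}`. -/
noncomputable instance (ι : Type) : TopologicalSpace (AffineSp ι) :=
  TopologicalSpace.induced
    (fun x : AffineSp ι => (MvPolynomial.pointToPoint x : PrimeSpectrum (MvPolynomial ι ℂ)))
    inferInstance

/-- The nonzero vectors of `ℂ^m`, an open subset of affine space. -/
def NonzeroVec (m : ℕ) : Type := {v : Fin m → ℂ // v ≠ 0}

/-- The coordinates of a nonzero vector. -/
def NonzeroVec.coords {m : ℕ} (v : NonzeroVec m) : AffineSp (Fin m) := v.1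

noncomputable instance (m : ℕ) : TopologicalSpace (NonzeroVec m) :=
  TopologicalSpace.induced NonzeroVec.coords inferInstance

/-- The projective space `ℙV` of lines through the origin of `V = ℂ^m`. -/
def PSpace (m : ℕ) : Type := Projectivization ℂ (Fin m → ℂ)

/-- The one-dimensional subspace of `V` that a point of `ℙV` is. -/
noncomputable def PSpace.line {m : ℕ} (p : PSpace m) : Submodule ℂ (Fin m → ℂ) :=
  Projectivization.submodule p

/-- The point of `ℙV` spanned by a nonzero vector. -/
noncomputable def PSpace.ofVec {m : ℕ} (v : NonzeroVec m) : PSpace m := Projectivization.mk ℂ v.1 v.2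

/-- The Zariski topology of `ℙV`, the quotient topology of `V ∖ {0}`: a set is closed iff its cone
is cut out in `V ∖ {0}` by polynomials (equivalently, by homogeneous ones). -/
noncomputable instance (m : ℕ) : TopologicalSpace (PSpace m) :=
  TopologicalSpace.coinduced PSpace.ofVec inferInstance

/-- The set `X ⊆ ℙV` is not contained in any hyperplane. -/
def Nondegenerate {m : ℕ} (X : Set (PSpace m)) : Prop :=
  ∀ H : Submodule ℂ (Fin m → ℂ), IsCoatom H → ∃ p ∈ X, ¬ p.line ≤ H

/-- The `r`-frames of `V = ℂ^m`, that is, the `r × m` matrices with linearly independent rows,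
an open subset of affine space. -/
def Frame (r m : ℕ) : Type := {v : Fin r → Fin m → ℂ // LinearIndependent ℂ v}

/-- The matrix entries of a frame. -/
def Frame.entries {r m : ℕ} (v : Frame r m) : AffineSp (Fin r × Fin m) :=
  fun ij => v.1 ij.1 ij.2

noncomputable instance (r m : ℕ) : TopologicalSpace (Frame r m) :=
  TopologicalSpace.induced Frame.entries inferInstance

/-- The Grassmannian `G(r, V)` of `r`-dimensional linear subspaces of `V = ℂ^m`. -/
def Gr (r m : ℕ) : Type := {E : Submodule ℂ (Fin m → ℂ) // Module.finrank ℂ E = r}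

/-- The linear subspace of `V` that a point of the Grassmannian is. -/
def Gr.plane {r m : ℕ} (E : Gr r m) : Submodule ℂ (Fin m → ℂ) := E.1

/-- The subspace spanned by a frame. -/
noncomputable def Frame.span {r m : ℕ} (v : Frame r m) : Gr r m :=
  ⟨Submodule.span ℂ (Set.range v.1), by simpa using finrank_span_eq_card v.2⟩

/-- The Zariski topology of `G(r, V)`, the quotient of the space of frames by `GL_r`: a set of
subspaces is closed iff the set of frames that span its members is cut out, among all frames, by
polynomials in the matrix entries. This is the topology induced by the Plücker embedding. -/
noncomputable instance (r m : ℕ) : TopologicalSpace (Gr r m) :=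
  TopologicalSpace.coinduced Frame.span inferInstance

/-- The variety `G(r, V) × G(s, V)`. -/
structure GrPair (r s m : ℕ) : Type where
  /-- the `r`-dimensional subspace -/
  big : Gr r m
  /-- the `s`-dimensional subspace -/
  small : Gr s m

/-- A pair of an `r`-frame and an `s`-frame. -/
structure FramePair (r s m : ℕ) : Type where
  /-- the `r`-frame -/
  big : Frame r m
  /-- the `s`-frame -/
  small : Frame s m

/-- All the matrix entries of a pair of frames. -/
def FramePair.entries {r s m : ℕ} (v : FramePair r s m) :
    AffineSp (Fin r × Fin m ⊕ Fin s × Fin m) :=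
  Sum.elim v.big.entries v.small.entries

noncomputable instance (r s m : ℕ) : TopologicalSpace (FramePair r s m) :=
  TopologicalSpace.induced FramePair.entries inferInstance

/-- The pair of subspaces spanned by a pair of frames. -/
noncomputable def FramePair.span {r s m : ℕ} (v : FramePair r s m) : GrPair r s m :=
  ⟨v.big.span, v.small.span⟩

/-- The Zariski topology of the product variety `G(r, V) × G(s, V)` (which is finer than the
product of the Zariski topologies): a set of pairs is closed iff the set of pairs of frames that
span its members is cut out by polynomials in all the matrix entries of both frames. -/
noncomputable instance (r s m : ℕ) : TopologicalSpace (GrPair r s m) :=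
  TopologicalSpace.coinduced FramePair.span inferInstance

/-- The `X`-rank `R_X(E)`: the smallest `k` such that `E` lies in the span of some `k` points of
`X` (and `⊤` if there is no such `k`). -/
noncomputable def xRank {s m : ℕ} (X : Set (PSpace m)) (E : Gr s m) : ℕ∞ :=
  sInf {a : ℕ∞ | ∃ k : ℕ, a = k ∧
    ∃ x : Fin k → PSpace m, (∀ i, x i ∈ X) ∧ E.plane ≤ ⨆ i, (x i).line}

/-- `σ⁰_{r,s}(X) ⊆ G(s, V)`: the `s`-dimensional subspaces of `X`-rank at most `r`. -/
def sigmaZero (r s : ℕ) {m : ℕ} (X : Set (PSpace m)) : Set (Gr s m) :=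
  {E | xRank X E ≤ r}

/-- `σ_{r,s}(X) ⊆ G(s, V)`: the Zariski closure of `σ⁰_{r,s}(X)`. -/
def sigma (r s : ℕ) {m : ℕ} (X : Set (PSpace m)) : Set (Gr s m) :=
  closure (sigmaZero r s X)

/-- The restriction to `σ_{r,r}(X)` of the bundle over `G(r, V)` whose fibre at `F` is the
Grassmannian `G(s, F)`: the pairs `(F, E)` with `F ∈ σ_{r,r}(X)` and `E ⊆ F`. The projection
`(F, E) ↦ E` collapses it to `σ_{r,s}(X)`. -/
def bundle (r s : ℕ) {m : ℕ} (X : Set (PSpace m)) : Set (GrPair r s m) :=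
  {p | p.big ∈ sigma r r X ∧ p.small.plane ≤ p.big.plane}

/-- The expected dimension of `σ_{r,s}(X)`, as the image of the collapsing map
`bundle r s X → G(s, V)`, `(F, E) ↦ E`: the dimension of the source of the map or of its target,
whichever is smaller. -/
noncomputable def expectedDim (r s : ℕ) {m : ℕ} (X : Set (PSpace m)) : WithBot ℕ∞ :=
  min (topologicalKrullDim (bundle r s X)) (topologicalKrullDim (Gr s m))

/-- The collapsing map `bundle r s X → σ_{r,s}(X)`, `(F, E) ↦ E`, is generically finite to one: its
fibres over some nonempty relatively open subset of `σ_{r,s}(X)` are finite. -/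
def GenericallyFinite (r s : ℕ) {m : ℕ} (X : Set (PSpace m)) : Prop :=
  ∃ U : Set (Gr s m), IsOpen U ∧ (U ∩ sigma r s X).Nonempty ∧
    ∀ E ∈ U ∩ sigma r s X, {p ∈ bundle r s X | p.small = E}.Finite

end SubspaceRank

open SubspaceRank

/-! ### Krull dimension as transcendence degree. -/

open MvPolynomial TopologicalSpace Topology
open AlgebraicIndependent (matroid)

/-! Every dimension is computed as the transcendence degree of the coordinates of a generic point.
Let `Y` be an affine part of `X` on which some coordinate `a` equals 1. The irreducible affine
variety `locus r s X a`, that is `Y ^ r` times the `s × r` matrices, parametrises dense subsets of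
`σ_{r,s}(X)` and of the bundle: a pair `(x, T)` gives the row spaces of `x` and of `T * x`.
Grassmannians are handled through a `QuotAtlas`, which normalises a matrix to have an identity block
in chosen columns. By `QuotAtlas.topologicalKrullDim_closure`, the dimension of the closure of a
parametrised set is the transcendence degree of the normalised coordinates of the generic point.

For `σ_{r,r}(X)`, let `x` be the generic `r`-tuple and `N` its normal form. The transcendence degree
of `N` is at most `r * n`, because `N` is rational in `x`, and at most `r * (m - r)`, because of the
identity block. The lower bound `le_eRk_nrm` is a tangent space computation. A derivation `D` of the
function field that kills `N` sends each row `x i` to a combination of the rows of `x`, and also to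
a tangent vector of `Y` at `x i`. The combinations tangent at `x i` form a space of dimension at
most `r - (m - n)`, truncated at zero. By semicontinuity it is enough to find one special tuple, and
nondegeneracy provides it: take a point `y` of `Y` with a small tangent space, place it in row `i`,
and choose the other rows in `Y` as independent as possible modulo that tangent space. Since `D` is
determined by its values on `x`, counting derivations gives `r * n ≤ trdeg N + r * (r - (m - n))`,
which with the upper bounds fixes the dimension.

For the bundle, the coordinates of `E` relative to the normalised frame of `F` add `s * (r - s)`
independent parameters (`eRk_nrm_pairPt`). When the minimum for `σ_{r,r}(X)` is `r * (m - r)`, the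
bundle is at least as large as `G(s, V)`, so replacing that minimum by `r * n` does not change the
expected dimension.

The coordinates of `E` are among those of the pair, so `σ_{r,s}(X)` is no larger than the bundle. If
the inequality were strict, some coordinate of `F` would be transcendental over those of `E`. By
Chevalley's theorem it would then take infinitely many values over a general `E`
(`exists_forall_infinite`), which contradicts generic finiteness. -/

theorem ringKrullDim_eq_of_isIntegral_of_injective {R S : Type*} [CommRing R] [CommRing S]
    [IsDomain S] [Algebra R S] [Algebra.IsIntegral R S] (hinj : Function.Injective (algebraMap R S)) :
    ringKrullDim S = ringKrullDim R := by
  apply le_antisymm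
  -- Incomparability: distinct nested primes contract to distinct primes.
  · refine Order.krullDim_le_of_strictMono (PrimeSpectrum.comap (algebraMap R S)) ?_
    intro P Q hPQ
    exact Ideal.IsIntegral.comap_lt_comap (R := R) hPQ
  -- Lying over lifts the bottom prime of a chain, using injectivity; going up then lifts the rest
  -- without changing the length.
  · refine iSup_le fun l => ?_
    obtain ⟨P, hP, hPover⟩ := Ideal.exists_ideal_over_prime_of_isIntegral_of_isDomain
      (S := S) (RelSeries.head l).asIdeal
      (by rw [(RingHom.injective_iff_ker_eq_bot _).1 hinj]; exact bot_le)
    have : P.LiesOver (RelSeries.head l).asIdeal := ⟨hPover.symm⟩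
    obtain ⟨L, hL, -⟩ := Ideal.exists_ltSeries_of_hasGoingUp (S := S) l P
    rw [← hL]
    exact le_iSup (fun p : LTSeries (PrimeSpectrum S) => (p.length : WithBot ℕ∞)) L

/-- Noether normalisation makes the algebra integral over a polynomial ring in `d` variables. The
images `y` of these variables are algebraically independent and have the same algebraic closure in
`K` as `ρ`, so both numbers equal `d`. -/
theorem ringKrullDim_adjoin_range {k K ι : Type*} [Field k] [Field K] [Algebra k K] [Finite ι]
    (ρ : ι → K) :
    ringKrullDim (Algebra.adjoin k (Set.range ρ)) = ((matroid k K).eRk (Set.range ρ) : WithBot ℕ∞) := by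
  have : Algebra.FiniteType k (Algebra.adjoin k (Set.range ρ)) :=

    (Subalgebra.fg_iff_finiteType _).1 (Subalgebra.fg_def.2 ⟨_, Set.finite_range ρ, rfl⟩)
  obtain ⟨d, g, ginj, gint⟩ := exists_integral_inj_algHom_of_fg k (Algebra.adjoin k (Set.range ρ))
  let _ := g.toRingHom.toAlgebra
  have : Algebra.IsIntegral (MvPolynomial (Fin d) k) (Algebra.adjoin k (Set.range ρ)) := ⟨gint⟩
  rw [ringKrullDim_eq_of_isIntegral_of_injective (R := MvPolynomial (Fin d) k) ginj,
    MvPolynomial.ringKrullDim_of_isNoetherianRing, ringKrullDim_eq_zero_of_field]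
  let y : Fin d → K := fun i => (g (X i) : K)
  have hy : AlgebraicIndependent k y := by
    have h : aeval y = (Algebra.adjoin k (Set.range ρ)).val.comp g := by ext; simp [y]
    rw [AlgebraicIndependent, h]
    exact Subtype.val_injective.comp ginj
  have hyind : (matroid k K).Indep (Set.range y) :=
    AlgebraicIndependent.matroid_indep_iff.2 hy.to_subtype_range
  have h1 : (matroid k K).eRk (Set.range y) = d := by
    rw [hyind.eRk_eq_encard, ← Set.image_univ, hy.injective.encard_image]; simp
  have hsub : Set.range y ⊆ (matroid k K).closure (Set.range ρ) := by
    rw [AlgebraicIndependent.matroid_closure_eq]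
    rintro _ ⟨i, rfl⟩
    exact isAlgebraic_algebraMap (A := K) (g (X i))
  have hsub' : Set.range ρ ⊆ (matroid k K).closure (Set.range y) := by
    rw [AlgebraicIndependent.matroid_closure_eq]
    rintro _ ⟨i, rfl⟩
    have hi : IsIntegral (MvPolynomial (Fin d) k)
      (⟨ρ i, Algebra.subset_adjoin ⟨i, rfl⟩⟩ : Algebra.adjoin k (Set.range ρ)) := gint _
    obtain ⟨p, hp, hp0⟩ := hi
    have hmem : ∀ a : MvPolynomial (Fin d) k, (g a : K) ∈ Algebra.adjoin k (Set.range y) := by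
      intro a
      have h : aeval y = (Algebra.adjoin k (Set.range ρ)).val.comp g := by ext; simp [y]
      rw [Algebra.adjoin_range_eq_range_aeval]
      exact ⟨a, congrArg (fun f => f a) h⟩
    -- Pushing the integral equation of `ρ i` along this map gives coefficients in the subalgebra
    -- generated by `y`.
    let f : MvPolynomial (Fin d) k →+* Algebra.adjoin k (Set.range y) :=
      RingHom.codRestrict ((algebraMap (Algebra.adjoin k (Set.range ρ)) K).comp g.toRingHom)
        (Algebra.adjoin k (Set.range y)) hmem
    have : IsIntegral (Algebra.adjoin k (Set.range y)) (ρ i) := by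
      refine ⟨p.map f, hp.map f, ?_⟩
      rw [Polynomial.eval₂_map]
      have := congrArg (algebraMap (Algebra.adjoin k (Set.range ρ)) K) hp0
      rw [Polynomial.hom_eval₂] at this
      simp only [map_zero] at this
      exact this
    exact this.isAlgebraic
  rw [zero_add]
  have : (matroid k K).eRk (Set.range ρ) = d := by
    rw [← h1]
    refine le_antisymm ?_ ?_
    · exact ((matroid k K).eRk_mono hsub').trans_eq (Matroid.eRk_closure_eq _ _)
    · exact ((matroid k K).eRk_mono hsub).trans_eq (Matroid.eRk_closure_eq _ _)
  rw [this]
  simp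

namespace SubspaceRank

/-! ### Zariski topology of affine space and generic points. -/

section Zariski

variable {ι : Type}

theorem mem_pointToPoint_iff (x : AffineSp ι) (f : MvPolynomial ι ℂ) :
    f ∈ (pointToPoint (k := ℂ) (K := ℂ) x).asIdeal ↔ aeval (R := ℂ) (S₁ := ℂ) x f = 0 :=
  mem_vanishingIdeal_singleton_iff x f

theorem isClosed_affineSp_iff {T : Set (AffineSp ι)} :
    IsClosed T ↔ ∀ x : AffineSp ι,
      (∀ f : MvPolynomial ι ℂ, (∀ y ∈ T, aeval (R := ℂ) (S₁ := ℂ) y f = 0) →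
        aeval (R := ℂ) (S₁ := ℂ) x f = 0) → x ∈ T := by
  constructor
  · intro hT x hx
    obtain ⟨Z, hZ, rfl⟩ := isClosed_induced_iff.1 hT
    obtain ⟨s, rfl⟩ := (PrimeSpectrum.isClosed_iff_zeroLocus _).1 hZ
    intro f hf
    exact (mem_pointToPoint_iff x f).2 (hx f fun y hy => (mem_pointToPoint_iff y f).1 (hy hf))
  · intro h
    refine isClosed_induced_iff.2
      ⟨PrimeSpectrum.zeroLocus {f | ∀ y ∈ T, aeval (R := ℂ) (S₁ := ℂ) y f = 0},
        PrimeSpectrum.isClosed_zeroLocus _, ?_⟩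
    ext x
    exact ⟨fun hx => h x fun f hf => (mem_pointToPoint_iff x f).1 (hx hf),
      fun hx f hf => (mem_pointToPoint_iff x f).2 (hf x hx)⟩

theorem isClosed_setOf_aeval_eq_zero (f : MvPolynomial ι ℂ) :
    IsClosed {x : AffineSp ι | aeval (R := ℂ) (S₁ := ℂ) x f = 0} :=
  isClosed_affineSp_iff.2 fun _ hx => hx f fun _ hy => hy

theorem isOpen_setOf_aeval_ne_zero (f : MvPolynomial ι ℂ) :
    IsOpen {x : AffineSp ι | aeval (R := ℂ) (S₁ := ℂ) x f ≠ 0} :=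
  (isClosed_setOf_aeval_eq_zero f).isOpen_compl

theorem mem_closure_affineSp_iff {T : Set (AffineSp ι)} {x : AffineSp ι} :
    x ∈ closure T ↔ ∀ f : MvPolynomial ι ℂ, (∀ y ∈ T, aeval (R := ℂ) (S₁ := ℂ) y f = 0) →
        aeval (R := ℂ) (S₁ := ℂ) x f = 0 := by
  constructor
  · intro hx f hf
    exact closure_minimal hf (isClosed_setOf_aeval_eq_zero f) hx
  · intro hx
    exact isClosed_affineSp_iff.1 isClosed_closure x
      fun f hf => hx f fun y hy => hf y (subset_closure hy)

/-- The point `ξ` with coordinates in an extension field is generic for the set `Y`: it satisfies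
the same polynomial equations over `ℂ` as all points of `Y`. -/
def IsGeneric {K : Type*} [Field K] [Algebra ℂ K] (Y : Set (AffineSp ι)) (ξ : ι → K) : Prop :=
  ∀ f : MvPolynomial ι ℂ, aeval ξ f = 0 ↔ ∀ y ∈ Y, aeval (R := ℂ) (S₁ := ℂ) y f = 0

theorem isPrime_vanishingIdeal {Y : Set (AffineSp ι)} (hY : IsIrreducible Y) :
    (vanishingIdeal ℂ (Y : Set (ι → ℂ))).IsPrime := by
  have hmem : ∀ f, f ∈ vanishingIdeal ℂ (Y : Set (ι → ℂ)) ↔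
    ∀ y ∈ Y, aeval (R := ℂ) (S₁ := ℂ) y f = 0 := fun f => Iff.rfl
  refine ⟨?_, ?_⟩
  · rw [Ideal.ne_top_iff_one, hmem]
    obtain ⟨y, hy⟩ := hY.nonempty
    intro h
    simpa using h y hy
  · intro f g hfg
    by_contra! h
    simp only [hmem, not_forall] at h
    obtain ⟨⟨y, hy, hfy⟩, z, hz, hgz⟩ := h
    obtain ⟨w, hw, hfw, hgw⟩ := hY.isPreirreducible _ _ (isOpen_setOf_aeval_ne_zero f)
      (isOpen_setOf_aeval_ne_zero g) ⟨y, hy, hfy⟩ ⟨z, hz, hgz⟩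
    have := (hmem _).1 hfg w hw
    rw [map_mul] at this
    exact (mul_ne_zero hfw hgw) this

/-- Take the coordinate functions in the fraction field of the coordinate ring. That they generate
the field matters later: a derivation that kills them is zero. -/
theorem exists_isGeneric {Y : Set (AffineSp ι)} (hY : IsIrreducible Y) :
    ∃ (K : Type) (_ : Field K) (_ : Algebra ℂ K) (ξ : ι → K), IsGeneric Y ξ ∧
      IntermediateField.adjoin ℂ (Set.range ξ) = ⊤ := by
  let I : Ideal (MvPolynomial ι ℂ) := vanishingIdeal ℂ (Y : Set (ι → ℂ))
  have hmem : ∀ f, f ∈ I ↔ ∀ y ∈ Y, aeval (R := ℂ) (S₁ := ℂ) y f = 0 := fun f => Iff.rfl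
  have hI : I.IsPrime := isPrime_vanishingIdeal hY
  let A := MvPolynomial ι ℂ ⧸ I
  let K := FractionRing A
  let ξ : ι → K := fun i => algebraMap A K (Ideal.Quotient.mk I (X i))
  have hξ : ∀ f, aeval ξ f = algebraMap A K (Ideal.Quotient.mk I f) := by
    have : aeval ξ = (IsScalarTower.toAlgHom ℂ A K).comp (Ideal.Quotient.mkₐ ℂ I) := by
      ext i; rw [aeval_X]; rfl
    intro f
    rw [this]; rfl
  refine ⟨K, inferInstance, inferInstance, ξ, ?_, ?_⟩
  · intro f
    rw [hξ, FaithfulSMul.algebraMap_eq_zero_iff, Ideal.Quotient.eq_zero_iff_mem, hmem]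
  · rw [eq_top_iff]
    rintro z -
    obtain ⟨a, b, -, rfl⟩ := IsFractionRing.div_surjective (A := A) z
    obtain ⟨p, rfl⟩ := Ideal.Quotient.mk_surjective a
    obtain ⟨q, rfl⟩ := Ideal.Quotient.mk_surjective b
    have hm : ∀ p, algebraMap A K (Ideal.Quotient.mk I p) ∈
        IntermediateField.adjoin ℂ (Set.range ξ) := by
      intro p
      rw [← hξ]
      have : aeval ξ p ∈ Algebra.adjoin ℂ (Set.range ξ) := by
        rw [Algebra.adjoin_range_eq_range_aeval]; exact ⟨p, rfl⟩
      exact IntermediateField.algebra_adjoin_le_adjoin _ _ this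
    exact div_mem (hm p) (hm q)

theorem IsGeneric.closure {K : Type*} [Field K] [Algebra ℂ K] {Y : Set (AffineSp ι)} {ξ : ι → K}
    (h : IsGeneric Y ξ) : IsGeneric (closure Y) ξ := by
  intro f
  rw [h f]
  exact ⟨fun hf y hy => mem_closure_affineSp_iff.1 hy f hf, fun hf y hy => hf y (subset_closure hy)⟩

/-- The zero locus of an ideal, as a subset of the space with the Zariski topology. -/
def zeroSet (P : Ideal (MvPolynomial ι ℂ)) : Set (AffineSp ι) := zeroLocus ℂ P

/-- By the Nullstellensatz, membership in `P` is tested on points. Nonempty open sets then contain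
nonvanishing loci of some `f, g ∉ P`, and primality gives a point where `f * g` does not vanish. -/
theorem isIrreducible_zeroSet [Finite ι] (P : Ideal (MvPolynomial ι ℂ)) [hP : P.IsPrime] :
    IsIrreducible (zeroSet P) := by
  have hV : ∀ f, f ∈ P ↔
      ∀ y ∈ (zeroSet P), aeval (R := ℂ) (S₁ := ℂ) y f = 0 := by
    intro f
    conv_lhs => rw [← IsPrime.vanishingIdeal_zeroLocus (K := ℂ) P]
    rfl
  refine ⟨?_, ?_⟩
  · by_contra h
    rw [Set.not_nonempty_iff_eq_empty] at h
    have h1 : (1 : MvPolynomial ι ℂ) ∈ P := by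
      rw [hV, h]
      intro y hy
      exact absurd hy (Set.notMem_empty y)
    exact hP.ne_top ((Ideal.eq_top_iff_one _).2 h1)
  · rintro U V hU hV' ⟨x, hx, hxU⟩ ⟨y, hy, hyV⟩
    have key : ∀ {U : Set (AffineSp ι)} {x : AffineSp ι}, IsOpen U → x ∈ U →
        ∃ f : MvPolynomial ι ℂ, aeval (R := ℂ) (S₁ := ℂ) x f ≠ 0 ∧
          ∀ y, aeval (R := ℂ) (S₁ := ℂ) y f ≠ 0 → y ∈ U := by
      intro U x hU hx
      have h := mt (isClosed_affineSp_iff.1 hU.isClosed_compl x) (fun h => h hx)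
      push Not at h
      obtain ⟨f, hf, hfx⟩ := h
      refine ⟨f, hfx, fun y hy => ?_⟩
      by_contra hyU
      exact hy (hf y hyU)
    obtain ⟨f, hfx, hfU⟩ := key hU hxU
    obtain ⟨g, hgy, hgV⟩ := key hV' hyV
    have hfg : f * g ∉ P := by
      intro h
      rcases hP.mem_or_mem h with h | h
      · exact hfx ((hV f).1 h x hx)
      · exact hgy ((hV g).1 h y hy)
    rw [hV] at hfg
    push Not at hfg
    obtain ⟨z, hz, hfgz⟩ := hfg
    rw [map_mul] at hfgz
    exact ⟨z, hz, hfU z (left_ne_zero_of_mul hfgz), hgV z (right_ne_zero_of_mul hfgz)⟩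

/-- The irreducible closed subsets of a closed subset of affine space correspond to the prime
ideals that contain its ideal. -/
noncomputable def irreducibleClosedsOrderIso [Finite ι] {Y : Set (AffineSp ι)} (hY : IsClosed Y) :
    IrreducibleCloseds Y ≃o
      (PrimeSpectrum.zeroLocus
        (SetLike.coe (vanishingIdeal ℂ (Y : Set (ι → ℂ)))))ᵒᵈ where
  toFun Z := OrderDual.toDual ⟨⟨vanishingIdeal ℂ (Subtype.val '' (Z : Set Y) : Set (AffineSp ι)),
    isPrime_vanishingIdeal (Z.isIrreducible.image _ continuous_subtype_val.continuousOn)⟩,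
    vanishingIdeal_anti_mono (Set.image_subset_iff.2 fun y _ => y.2)⟩
  invFun P :=
    { carrier := Subtype.val ⁻¹' zeroSet (OrderDual.ofDual P).1.asIdeal
      isIrreducible' := by
        have hP : zeroSet (OrderDual.ofDual P).1.asIdeal ⊆ Y := by
          intro x hx
          exact isClosed_affineSp_iff.1 hY x fun f hf => hx f ((OrderDual.ofDual P).2 hf)
        have h := isIrreducible_zeroSet (OrderDual.ofDual P).1.asIdeal
        refine ⟨?_, ?_⟩
        · obtain ⟨x, hx⟩ := h.nonempty
          exact ⟨⟨x, hP hx⟩, hx⟩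
        · rintro _ _ ⟨U, hU, rfl⟩ ⟨V, hV, rfl⟩ ⟨x, hx, hxU⟩ ⟨y, hy, hyV⟩
          obtain ⟨z, hz, hzU, hzV⟩ := h.isPreirreducible U V hU hV ⟨x, hx, hxU⟩ ⟨y, hy, hyV⟩
          exact ⟨⟨z, hP hz⟩, hz, hzU, hzV⟩
      isClosed' := by
        refine IsClosed.preimage continuous_subtype_val (isClosed_affineSp_iff.2 fun x hx f hf => ?_)
        exact hx f fun y hy => hy f hf }
  left_inv Z := by
    obtain ⟨T, hT, hTZ⟩ := IsInducing.subtypeVal.isClosed_iff.1 Z.isClosed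
    ext x
    constructor
    · intro hx
      have hc : x.1 ∈ closure (Subtype.val '' (Z : Set Y)) :=
        mem_closure_affineSp_iff.2 fun f hf => hx f hf
      have : x.1 ∈ T := closure_minimal (by rw [← hTZ]; exact Set.image_preimage_subset _ _) hT hc
      rw [← hTZ]
      exact this
    · intro hx f hf
      exact hf _ ⟨x, hx, rfl⟩
  right_inv P := by
    have hP : zeroSet (OrderDual.ofDual P).1.asIdeal ⊆ Y := by
      intro x hx
      exact isClosed_affineSp_iff.1 hY x fun f hf => hx f ((OrderDual.ofDual P).2 hf)
    apply OrderDual.ofDual.injective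
    apply Subtype.ext
    apply PrimeSpectrum.ext
    have himg : (Subtype.val '' (Subtype.val ⁻¹' zeroSet (OrderDual.ofDual P).1.asIdeal : Set Y) :
        Set (AffineSp ι)) = zeroSet (OrderDual.ofDual P).1.asIdeal :=
      Set.image_preimage_eq_of_subset (by simpa using hP)
    refine (congrArg (fun T : Set (AffineSp ι) => vanishingIdeal ℂ (T : Set (ι → ℂ))) himg).trans ?_
    exact IsPrime.vanishingIdeal_zeroLocus (K := ℂ) (OrderDual.ofDual P).1.asIdeal
  map_rel_iff' {Z Z'} := by
    constructor
    · intro h x hx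
      obtain ⟨T, hT, hTZ⟩ := IsInducing.subtypeVal.isClosed_iff.1 Z'.isClosed
      have hc : x.1 ∈ closure (Subtype.val '' (Z' : Set Y)) :=
        mem_closure_affineSp_iff.2 fun f hf => (h hf : f ∈ vanishingIdeal ℂ _) _ ⟨x, hx, rfl⟩
      have : x.1 ∈ T := closure_minimal (by rw [← hTZ]; exact Set.image_preimage_subset _ _) hT hc
      rw [← SetLike.mem_coe, ← hTZ]
      exact this
    · intro h
      exact vanishingIdeal_anti_mono (Set.image_mono h)

/-- The dimension of an affine variety is the transcendence degree of the coordinates of a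
generic point. -/
theorem IsGeneric.topologicalKrullDim_eq {K : Type*} [Field K] [Algebra ℂ K] [Finite ι]
    {Y : Set (AffineSp ι)} (hY : IsClosed Y) {ξ : ι → K} (h : IsGeneric Y ξ) :
    topologicalKrullDim Y = ((matroid ℂ K).eRk (Set.range ξ) : WithBot ℕ∞) := by
  rw [← ringKrullDim_adjoin_range, Algebra.adjoin_range_eq_range_aeval]
  have hker : vanishingIdeal ℂ (Y : Set (ι → ℂ)) =
      RingHom.ker (aeval ξ : MvPolynomial ι ℂ →ₐ[ℂ] K) := by
    ext f
    rw [RingHom.mem_ker]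
    exact (h f).symm
  rw [← ringKrullDim_eq_of_ringEquiv
    (Ideal.quotientKerAlgEquivOfSurjective
      (AlgHom.rangeRestrict_surjective (aeval ξ : MvPolynomial ι ℂ →ₐ[ℂ] K))).toRingEquiv,
    topologicalKrullDim, Order.krullDim_eq_of_orderIso (irreducibleClosedsOrderIso hY),
    Order.krullDim_orderDual, ringKrullDim,
    Order.krullDim_eq_of_orderIso (Ideal.primeSpectrumQuotientOrderIsoZeroLocus _)]
  have : RingHom.ker (aeval ξ : MvPolynomial ι ℂ →ₐ[ℂ] K).rangeRestrict =
    RingHom.ker (aeval ξ : MvPolynomial ι ℂ →ₐ[ℂ] K) := by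
    ext f
    rw [RingHom.mem_ker, RingHom.mem_ker]
    exact Subtype.ext_iff
  rw [this, hker]

/-- Choose a point in the smallest member of a chain of irreducible closed sets, and an open set of
the cover containing it. That open set meets the whole chain, and open embeddings preserve the
coheight of the smallest member. -/
theorem topologicalKrullDim_le_of_open_cover {S J : Type*} [TopologicalSpace S] {Z : Set S}
    (U : J → Set S) (hU : ∀ j, IsOpen (U j)) (hcov : Z ⊆ ⋃ j, U j) (d : WithBot ℕ∞)
    (h : ∀ j, topologicalKrullDim (Z ∩ U j : Set S) ≤ d) : topologicalKrullDim Z ≤ d := by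
  refine iSup_le fun l => ?_
  obtain ⟨x, hx⟩ := (RelSeries.head l).isIrreducible.nonempty
  obtain ⟨j, hj⟩ := Set.mem_iUnion.1 (hcov x.2)
  let f : (Z ∩ U j : Set S) → Z := Set.inclusion Set.inter_subset_left
  have hf : IsOpenEmbedding f := by
    refine ⟨IsEmbedding.inclusion _, ?_⟩
    rw [Set.range_inclusion]
    have : {x : Z | x.1 ∈ Z ∩ U j} = Subtype.val ⁻¹' (U j) := by ext x; simp
    rw [this]
    exact (hU j).preimage continuous_subtype_val
  obtain ⟨Z', hZ'⟩ := (IrreducibleCloseds.orderIsoOfIsOpenEmbedding f hf).surjective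
    ⟨RelSeries.head l, ⟨⟨x.1, x.2, hj⟩, hx⟩⟩
  have hZ'' : IrreducibleCloseds.map f hf.continuous Z' = RelSeries.head l :=
    congrArg Subtype.val hZ'
  have h1 : ((l.length : ℕ∞) : WithBot ℕ∞) ≤ ((Order.coheight (RelSeries.head l) : ℕ∞) : WithBot ℕ∞) :=
    WithBot.coe_le_coe.2 (Order.length_le_coheight le_rfl)
  rw [← hZ'', hf.coheight_map] at h1
  exact (h1.trans (Order.coheight_le_krullDim _)).trans (h j)

end Zariski

end SubspaceRank

/-! ### Rational maps and quotients with normal forms. -/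

namespace SubspaceRank

theorem adjoin_subset_matroid_closure {k K : Type*} [Field k] [Field K] [Algebra k K] (s : Set K) :
    (IntermediateField.adjoin k s : Set K) ⊆ (matroid k K).closure s := by
  intro x hx
  rw [AlgebraicIndependent.matroid_closure_eq]
  change IsAlgebraic (Algebra.adjoin k s) x
  induction hx using IntermediateField.adjoin_induction with
  | mem x hx =>
    exact isAlgebraic_algebraMap (A := K) (⟨x, Algebra.subset_adjoin hx⟩ : Algebra.adjoin k s)
  | algebraMap x => exact isAlgebraic_algebraMap (A := K) (algebraMap k (Algebra.adjoin k s) x)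
  | add x y _ _ hx hy => exact hx.add hy
  | inv x _ hx => exact hx.inv
  | mul x y _ _ hx hy => exact hx.mul hy

/-- Elements of a generated field are algebraic over the generators. Upper bounds below are obtained
by exhibiting coordinates as rational functions of fewer or better understood ones. -/
theorem eRk_le_of_subset_adjoin {k K : Type*} [Field k] [Field K] [Algebra k K] {s t : Set K}
    (h : s ⊆ IntermediateField.adjoin k t) : (matroid k K).eRk s ≤ (matroid k K).eRk t :=
  ((matroid k K).eRk_mono (h.trans (adjoin_subset_matroid_closure t))).trans_eq
    (Matroid.eRk_closure_eq _ _)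

theorem aeval_bind₁_point {ι κ : Type} (y : AffineSp κ) (P : ι → MvPolynomial κ ℂ)
    (p : MvPolynomial ι ℂ) : aeval (R := ℂ) (S₁ := ℂ) y (bind₁ P p) =
      aeval (R := ℂ) (S₁ := ℂ) (fun a => aeval (R := ℂ) (S₁ := ℂ) y (P a)) p :=
  aeval_bind₁ (fun a => y a) P p

theorem aeval_mem_adjoin {ι : Type*} {k K : Type*} [Field k] [Field K] [Algebra k K] (x : ι → K)
    (p : MvPolynomial ι k) : aeval x p ∈ IntermediateField.adjoin k (Set.range x) := by
  have : aeval x p ∈ Algebra.adjoin k (Set.range x) := by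
    rw [Algebra.adjoin_range_eq_range_aeval]; exact ⟨p, rfl⟩
  exact IntermediateField.algebra_adjoin_le_adjoin _ _ this

theorem IsGeneric.of_subset {ι : Type} {K : Type*} [Field K] [Algebra ℂ K]
    {Y D : Set (AffineSp ι)} {ξ : ι → K} (h : IsGeneric Y ξ) (hD : D ⊆ Y) (hY : Y ⊆ _root_.closure D) :
    IsGeneric D ξ := by
  intro f
  rw [h f]
  exact ⟨fun hf y hy => hf y (hD hy), fun hf y hy => mem_closure_affineSp_iff.1 (hY hy) f hf⟩

theorem IsGeneric.inter_open {ι : Type} {K : Type*} [Field K] [Algebra ℂ K]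
    {Y U : Set (AffineSp ι)} {ξ : ι → K} (h : IsGeneric Y ξ) (hY : IsIrreducible Y)
    (hU : IsOpen U) (hne : (Y ∩ U).Nonempty) : IsGeneric (Y ∩ U) ξ :=
  h.of_subset Set.inter_subset_left
    (subset_closure_inter_of_isPreirreducible_of_isOpen hY.isPreirreducible hU hne)

theorem continuous_affineSp_iff {M : Type*} [TopologicalSpace M] {ι : Type} {f : M → AffineSp ι} :
    Continuous f ↔
      ∀ p : MvPolynomial ι ℂ, IsClosed {m | aeval (R := ℂ) (S₁ := ℂ) (f m) p = 0} := by
  constructor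
  · intro h p
    exact (isClosed_setOf_aeval_eq_zero p).preimage h
  · intro h
    refine continuous_iff_isClosed.2 fun T hT => ?_
    have : f ⁻¹' T = ⋂ p ∈ {p : MvPolynomial ι ℂ | ∀ y ∈ T, aeval (R := ℂ) (S₁ := ℂ) y p = 0},
        {m | aeval (R := ℂ) (S₁ := ℂ) (f m) p = 0} := by
      ext m
      simp only [Set.mem_preimage, Set.mem_ofPred_eq, Set.mem_iInter]
      exact ⟨fun hm p hp => hp _ hm, fun hm => isClosed_affineSp_iff.1 hT _ hm⟩
    rw [this]
    exact isClosed_biInter fun p _ => h p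

theorem continuous_affineSp_of_polynomial {M : Type*} [TopologicalSpace M] {ι κ : Type}
    {e : M → AffineSp κ} (he : Continuous e) {f : M → AffineSp ι} (P : ι → MvPolynomial κ ℂ)
    (hP : ∀ m a, f m a = aeval (R := ℂ) (S₁ := ℂ) (e m) (P a)) : Continuous f := by
  rw [continuous_affineSp_iff]
  intro p
  have : {m | aeval (R := ℂ) (S₁ := ℂ) (f m) p = 0} =
      {m | aeval (R := ℂ) (S₁ := ℂ) (e m) (bind₁ P p) = 0} := by
    ext m
    have hm : f m = fun a => aeval (R := ℂ) (S₁ := ℂ) (e m) (P a) := funext (hP m)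
    rw [Set.mem_ofPred_eq, Set.mem_ofPred_eq, hm, aeval_bind₁_point]
  rw [this]
  exact (isClosed_setOf_aeval_eq_zero _).preimage he

/-- Clearing denominators in a polynomial expression in fractions with a common denominator. -/
theorem exists_clear_denominators {ι κ : Type} (P : ι → MvPolynomial κ ℂ) (g : MvPolynomial κ ℂ)
    (f : MvPolynomial ι ℂ) : ∃ (e : ℕ) (F : MvPolynomial κ ℂ), ∀ (L : Type) [Field L] [Algebra ℂ L]
      (z : κ → L), aeval z g ≠ 0 →
        aeval (fun a => aeval z (P a) / aeval z g) f * aeval z g ^ e = aeval z F := by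
  induction f using MvPolynomial.induction_on with
  | C c => exact ⟨0, C c, fun L _ _ z hz => by simp⟩
  | add p q hp hq =>
    obtain ⟨e, F, hF⟩ := hp
    obtain ⟨e', F', hF'⟩ := hq
    refine ⟨e + e', F * g ^ e' + F' * g ^ e, fun L _ _ z hz => ?_⟩
    rw [map_add, map_add, map_mul, map_mul, ← hF L z hz, ← hF' L z hz, map_pow, map_pow]
    ring
  | mul_X p a hp =>
    obtain ⟨e, F, hF⟩ := hp
    refine ⟨e + 1, F * P a, fun L _ _ z hz => ?_⟩
    rw [map_mul, map_mul, ← hF L z hz, aeval_X]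
    field_simp
    ring

/-- The image of a point `x` under the rational map with components `P a / g`. -/
noncomputable def ratMap {ι κ : Type} {K : Type*} [Field K] [Algebra ℂ K]
    (P : ι → MvPolynomial κ ℂ) (g : MvPolynomial κ ℂ) (x : κ → K) : ι → K :=
  fun a => aeval x (P a) / aeval x g

/-- The same map, on the points of affine space. -/
noncomputable def ratMapSp {ι κ : Type} (P : ι → MvPolynomial κ ℂ) (g : MvPolynomial κ ℂ)
    (x : AffineSp κ) : AffineSp ι := ratMap (K := ℂ) P g x

/-- Clearing denominators gives one numerator valid over every extension field, so an equation for
the image becomes the same equation on the source at `ξ` and at every complex point. -/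
theorem IsGeneric.ratMap {ι κ : Type} {K : Type} [Field K] [Algebra ℂ K]
    {Y : Set (AffineSp κ)} {ξ : κ → K} (h : IsGeneric Y ξ) (P : ι → MvPolynomial κ ℂ)
    (g : MvPolynomial κ ℂ) (hξ : aeval ξ g ≠ 0)
    (hY : ∀ y ∈ Y, aeval (R := ℂ) (S₁ := ℂ) y g ≠ 0) :
    IsGeneric (ratMapSp P g '' Y) (ratMap P g ξ) := by
  intro f
  obtain ⟨e, F, hF⟩ := exists_clear_denominators P g f
  have h1 : aeval (SubspaceRank.ratMap P g ξ) f = 0 ↔ aeval ξ F = 0 := by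
    rw [← hF K ξ hξ]
    simp only [mul_eq_zero, pow_eq_zero_iff', hξ, false_and, or_false]
    rfl
  rw [h1, h F, Set.forall_mem_image]
  refine forall₂_congr fun y hy => ?_
  rw [← hF ℂ y (hY y hy)]
  simp only [mul_eq_zero, pow_eq_zero_iff', hY y hy, false_and, or_false]
  rfl

theorem continuous_ratMapSp {M : Type*} [TopologicalSpace M] {ι κ : Type}
    {e : M → AffineSp κ} (he : Continuous e) (P : ι → MvPolynomial κ ℂ) (g : MvPolynomial κ ℂ)
    (hg : ∀ m, aeval (R := ℂ) (S₁ := ℂ) (e m) g ≠ 0) :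
    Continuous fun m => ratMapSp P g (e m) := by
  rw [continuous_affineSp_iff]
  intro p
  obtain ⟨n, F, hF⟩ := exists_clear_denominators P g p
  have : {m | aeval (R := ℂ) (S₁ := ℂ) (ratMapSp P g (e m)) p = 0} =
      {m | aeval (R := ℂ) (S₁ := ℂ) (e m) F = 0} := by
    ext m
    rw [Set.mem_ofPred_eq, Set.mem_ofPred_eq, ← hF ℂ (e m) (hg m)]
    simp only [mul_eq_zero, pow_eq_zero_iff', hg m, false_and, or_false]
    rfl
  rw [this]
  exact (isClosed_setOf_aeval_eq_zero _).preimage he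

/-- A space `S` that is a quotient `q : W → S` of a set of points `W` of affine space, together with
normal forms: on the locus where the polynomial `g j` does not vanish, the rational map with
components `P j a / g j` picks a representative of each class. -/
structure QuotAtlas (W S ι J : Type) [TopologicalSpace W] [TopologicalSpace S] where
  /-- the coordinates of a point of `W` -/
  ent : W → AffineSp ι
  isInducing_ent : IsInducing ent
  /-- the quotient map -/
  q : W → S
  isQuotientMap_q : IsQuotientMap q
  /-- the denominators -/
  g : J → MvPolynomial ι ℂ
  /-- the numerators -/
  P : J → ι → MvPolynomial ι ℂ
  exists_ent : ∀ (j : J) (x : AffineSp ι), aeval (R := ℂ) (S₁ := ℂ) x (g j) ≠ 0 → ∃ w, ent w = x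
  cover : ∀ w, ∃ j, aeval (R := ℂ) (S₁ := ℂ) (ent w) (g j) ≠ 0
  -- This identity and the next are required over all extension fields because they are applied to
  -- generic points as well as to complex ones.
  g_ratMap : ∀ (j : J) (K : Type) [Field K] [Algebra ℂ K] (x : ι → K), aeval x (g j) ≠ 0 →
    aeval (ratMap (P j) (g j) x) (g j) = 1
  compat : ∀ (i j : J) (K : Type) [Field K] [Algebra ℂ K] (x : ι → K), aeval x (g i) ≠ 0 →
    aeval x (g j) ≠ 0 → aeval (ratMap (P i) (g i) x) (g j) ≠ 0 ∧
      ratMap (P j) (g j) (ratMap (P i) (g i) x) = ratMap (P j) (g j) x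
  eq_of_q : ∀ w w', q w = q w' → ∀ j, aeval (R := ℂ) (S₁ := ℂ) (ent w) (g j) ≠ 0 →
    aeval (R := ℂ) (S₁ := ℂ) (ent w') (g j) ≠ 0 ∧
      ratMapSp (P j) (g j) (ent w') = ratMapSp (P j) (g j) (ent w)
  q_ratMap : ∀ w w' j, aeval (R := ℂ) (S₁ := ℂ) (ent w) (g j) ≠ 0 →
    ent w' = ratMapSp (P j) (g j) (ent w) → q w' = q w

namespace QuotAtlas

variable {W S ι J : Type} [TopologicalSpace W] [TopologicalSpace S] (A : QuotAtlas W S ι J)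

/-- The normal form of the point with coordinates `x`. -/
noncomputable def nrm {K : Type} [Field K] [Algebra ℂ K] (j : J) (x : ι → K) : ι → K :=
  ratMap (A.P j) (A.g j) x

/-- The normal form of the point with coordinates `x`, in affine space. -/
noncomputable def nrmSp (j : J) (x : AffineSp ι) : AffineSp ι := ratMapSp (A.P j) (A.g j) x

/-- The domain of a chart. -/
def dom (j : J) : Set S := A.q '' {w | aeval (R := ℂ) (S₁ := ℂ) (A.ent w) (A.g j) ≠ 0}

theorem q_mem_dom_iff (j : J) (w : W) :
    A.q w ∈ A.dom j ↔ aeval (R := ℂ) (S₁ := ℂ) (A.ent w) (A.g j) ≠ 0 := by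
  constructor
  · rintro ⟨w', hw', h⟩
    exact (A.eq_of_q w' w h j hw').1
  · intro h
    exact ⟨w, h, rfl⟩

theorem isOpen_dom (j : J) : IsOpen (A.dom j) := by
  rw [← A.isQuotientMap_q.isOpen_preimage]
  have : A.q ⁻¹' A.dom j = A.ent ⁻¹' {x | aeval (R := ℂ) (S₁ := ℂ) x (A.g j) ≠ 0} := by
    ext w
    exact A.q_mem_dom_iff j w
  rw [this]
  exact (isOpen_setOf_aeval_ne_zero _).preimage A.isInducing_ent.continuous

theorem iUnion_dom : ⋃ j, A.dom j = Set.univ := by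
  rw [Set.eq_univ_iff_forall]
  intro z
  obtain ⟨w, rfl⟩ := A.isQuotientMap_q.surjective z
  obtain ⟨j, hj⟩ := A.cover w
  exact Set.mem_iUnion.2 ⟨j, (A.q_mem_dom_iff j w).2 hj⟩

theorem exists_section (j : J) (z : A.dom j) : ∃ w, A.q w = z ∧
    ∀ w', A.q w' = z → A.ent w = A.nrmSp j (A.ent w') := by
  obtain ⟨_, w, hw, rfl⟩ := z
  have h1 : aeval (R := ℂ) (S₁ := ℂ) (A.nrmSp j (A.ent w)) (A.g j) = 1 := A.g_ratMap j ℂ _ hw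
  obtain ⟨w', hw'⟩ := A.exists_ent j (A.nrmSp j (A.ent w)) (by rw [h1]; exact one_ne_zero)
  refine ⟨w', A.q_ratMap w w' j hw hw', fun v hv => ?_⟩
  rw [hw']
  exact ((A.eq_of_q w v hv.symm j hw).2).symm

/-- The normalised representatives of the points in the domain of a chart. -/
noncomputable def sect (j : J) (z : A.dom j) : W := (A.exists_section j z).choose

theorem q_sect (j : J) (z : A.dom j) : A.q (A.sect j z) = z := (A.exists_section j z).choose_spec.1

theorem ent_sect (j : J) (z : A.dom j) {w : W} (hw : A.q w = z) :
    A.ent (A.sect j z) = A.nrmSp j (A.ent w) := (A.exists_section j z).choose_spec.2 w hw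

/-- Over the open chart domain `q` is still a quotient map, so continuity can be tested on
representatives, where the section is a rational map. -/
theorem continuous_sect (j : J) : Continuous (A.sect j) := by
  rw [A.isInducing_ent.continuous_iff]
  have hq := A.isQuotientMap_q.restrictPreimage_isOpen (A.isOpen_dom j)
  rw [hq.continuous_iff]
  have : (A.ent ∘ A.sect j) ∘ (A.dom j).restrictPreimage A.q =
      fun w : A.q ⁻¹' A.dom j => A.nrmSp j (A.ent w.1) := by
    funext w
    exact A.ent_sect j _ rfl
  rw [this]
  exact continuous_ratMapSp (A.isInducing_ent.continuous.comp continuous_subtype_val) _ _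
    fun w => (A.q_mem_dom_iff j w.1).1 w.2

/-- The image consists of the points that are their own normal form, a closed set on which `q`
inverts the section continuously. Each chart is thereby a closed subset of affine space. -/
theorem isClosedEmbedding_ent_sect (j : J) : IsClosedEmbedding (A.ent ∘ A.sect j) := by
  refine .of_continuous_injective_isClosedMap
    (A.isInducing_ent.continuous.comp (A.continuous_sect j)) ?_ ?_
  · intro z z' h
    apply Subtype.ext
    obtain ⟨w, hw⟩ := A.isQuotientMap_q.surjective z
    have hd : aeval (R := ℂ) (S₁ := ℂ) (A.ent w) (A.g j) ≠ 0 := by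
      rw [← A.q_mem_dom_iff, hw]; exact z.2
    have h1 := A.ent_sect j z hw
    rw [← hw, ← A.q_sect j z']
    exact (A.q_ratMap w _ j hd (h.symm.trans h1)).symm
  · intro C hC
    -- With denominator 1, being fixed by normalisation is a polynomial condition.
    let L : Set (AffineSp ι) := {x | aeval (R := ℂ) (S₁ := ℂ) x (A.g j) = 1 ∧
      ∀ a, aeval (R := ℂ) (S₁ := ℂ) x (A.P j a) = x a}
    have hL : IsClosed L := by
      have : L = {x : AffineSp ι | aeval (R := ℂ) (S₁ := ℂ) x (A.g j - 1) = 0} ∩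
          ⋂ a, {x : AffineSp ι | aeval (R := ℂ) (S₁ := ℂ) x (A.P j a - X a) = 0} := by
        ext x
        simp only [L, Set.mem_inter_iff, Set.mem_ofPred_eq, Set.mem_iInter, map_sub, map_one,
          sub_eq_zero]
        refine and_congr_right fun _ => forall_congr' fun a => ?_
        have : aeval (R := ℂ) (S₁ := ℂ) x (X a) = x a := aeval_X (R := ℂ) (S₁ := ℂ) x a
        rw [this]
      rw [this]
      exact (isClosed_setOf_aeval_eq_zero _).inter
        (isClosed_iInter fun a => isClosed_setOf_aeval_eq_zero _)
    have hex : ∀ x : L, ∃ w, A.ent w = x.1 := fun x =>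
      A.exists_ent j x.1 (by rw [x.2.1]; exact one_ne_zero)
    choose t ht using hex
    have htc : Continuous t := by
      rw [A.isInducing_ent.continuous_iff]
      have : A.ent ∘ t = Subtype.val := funext ht
      rw [this]
      exact continuous_subtype_val
    have htd : ∀ x, A.q (t x) ∈ A.dom j := by
      intro x
      rw [A.q_mem_dom_iff, ht, x.2.1]
      exact one_ne_zero
    let r : L → A.dom j := fun x => ⟨A.q (t x), htd x⟩
    have hr : Continuous r := (A.isQuotientMap_q.continuous.comp htc).subtype_mk _
    have hsec : ∀ x : L, A.ent (A.sect j (r x)) = x.1 := by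
      intro x
      rw [A.ent_sect j (r x) (w := t x) rfl, ht]
      funext a
      have h1 := x.2.1
      have h2 := x.2.2 a
      change aeval (R := ℂ) (S₁ := ℂ) x.1 _ / aeval (R := ℂ) (S₁ := ℂ) x.1 _ = _
      rw [h1, h2, div_one]
    have himg : (A.ent ∘ A.sect j) '' C = Subtype.val '' (r ⁻¹' C) := by
      ext x
      constructor
      · rintro ⟨z, hz, rfl⟩
        obtain ⟨w, hw⟩ := A.isQuotientMap_q.surjective z
        have hd : aeval (R := ℂ) (S₁ := ℂ) (A.ent w) (A.g j) ≠ 0 := by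
          rw [← A.q_mem_dom_iff, hw]; exact z.2
        have hx := A.ent_sect j z hw
        have hxL : A.ent (A.sect j z) ∈ L := by
          have h1 := A.g_ratMap j ℂ (A.ent w) hd
          have h2 := (A.compat j j ℂ (A.ent w) hd hd).2
          rw [hx]
          refine ⟨h1, fun a => ?_⟩
          have h3 := congrFun h2 a
          unfold ratMap at h3
          unfold ratMap at h1
          rw [h1, div_one] at h3
          exact h3
        refine ⟨⟨_, hxL⟩, ?_, rfl⟩
        have : r ⟨_, hxL⟩ = z := by
          apply Subtype.ext
          change A.q (t ⟨_, hxL⟩) = z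
          rw [← hw]
          exact A.q_ratMap w _ j hd ((ht _).trans hx)
        rw [Set.mem_preimage, this]
        exact hz
      · rintro ⟨x, hx, rfl⟩
        exact ⟨r x, hx, hsec x⟩
    rw [himg]
    exact hL.isClosedEmbedding_subtypeVal.isClosedMap _ (hC.preimage hr)

theorem nrm_mem_adjoin {K : Type} [Field K] [Algebra ℂ K] {i j : J} {x : ι → K}
    (hi : aeval x (A.g i) ≠ 0) (hj : aeval x (A.g j) ≠ 0) (a : ι) :
    A.nrm j x a ∈ IntermediateField.adjoin ℂ (Set.range (A.nrm i x)) := by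
  unfold nrm
  rw [← (A.compat i j K x hi hj).2]
  exact div_mem (aeval_mem_adjoin _ _) (aeval_mem_adjoin _ _)

/-- Normal forms in different charts are rational functions of each other, by `compat`. With `i` and
`j` exchanged, this shows that the transcendence degree does not depend on the chart. -/
theorem eRk_nrm_le {K : Type} [Field K] [Algebra ℂ K] {i j : J} {x : ι → K}
    (hi : aeval x (A.g i) ≠ 0) (hj : aeval x (A.g j) ≠ 0) :
    (matroid ℂ K).eRk (Set.range (A.nrm j x)) ≤ (matroid ℂ K).eRk (Set.range (A.nrm i x)) :=
  eRk_le_of_subset_adjoin (Set.range_subset_iff.2 (A.nrm_mem_adjoin hi hj))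

/-- The normal form of the generic point of a parametrised set is generic. -/
theorem isGeneric_nrm {η : Type} {Y : Set (AffineSp η)}
    {K : Type} [Field K] [Algebra ℂ K] {ξ : η → K} (hY : IsIrreducible Y) (hξ : IsGeneric Y ξ)
    (φ : ι → MvPolynomial η ℂ) {j : J} (hj : aeval (fun a => aeval ξ (φ a)) (A.g j) ≠ 0) :
    IsGeneric {u | ∃ y ∈ Y, aeval (R := ℂ) (S₁ := ℂ)
        (fun a => aeval (R := ℂ) (S₁ := ℂ) y (φ a)) (A.g j) ≠ 0 ∧
        u = A.nrmSp j fun a => aeval (R := ℂ) (S₁ := ℂ) y (φ a)}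
      (A.nrm j fun a => aeval ξ (φ a)) := by
  have hx : ∀ p, aeval (fun a => aeval ξ (φ a)) p = aeval ξ (bind₁ φ p) := fun p => by
    rw [aeval_bind₁]
  have hgy : ∀ (y : AffineSp η) (p : MvPolynomial ι ℂ),
      aeval (R := ℂ) (S₁ := ℂ) (fun a => aeval (R := ℂ) (S₁ := ℂ) y (φ a)) p =
        aeval (R := ℂ) (S₁ := ℂ) y (bind₁ φ p) := fun y p => (aeval_bind₁_point y φ p).symm
  let D : Set (AffineSp η) := Y ∩ {y | aeval (R := ℂ) (S₁ := ℂ) y (bind₁ φ (A.g j)) ≠ 0}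
  have hDne : D.Nonempty := by
    by_contra h
    rw [hx, Ne, hξ] at hj
    push Not at hj
    obtain ⟨y, hy, h'⟩ := hj
    exact h ⟨y, hy, h'⟩
  have hD : IsGeneric D ξ := hξ.inter_open hY (isOpen_setOf_aeval_ne_zero _) hDne
  have hgen := hD.ratMap (fun a => bind₁ φ (A.P j a)) (bind₁ φ (A.g j)) (by rwa [← hx])
    fun y hy => hy.2
  have hrm : ratMap (fun a => bind₁ φ (A.P j a)) (bind₁ φ (A.g j)) ξ =
      A.nrm j fun a => aeval ξ (φ a) := by
    funext a
    change _ / _ = _ / _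
    rw [hx, hx]
  have hr : ∀ y : AffineSp η, A.nrmSp j (fun a => aeval (R := ℂ) (S₁ := ℂ) y (φ a)) =
      ratMapSp (fun a => bind₁ φ (A.P j a)) (bind₁ φ (A.g j)) y := by
    intro y
    funext a
    change aeval (R := ℂ) (S₁ := ℂ) _ _ / aeval (R := ℂ) (S₁ := ℂ) _ _ =
      aeval (R := ℂ) (S₁ := ℂ) _ _ / aeval (R := ℂ) (S₁ := ℂ) _ _
    rw [hgy, hgy]
  rw [hrm] at hgen
  refine (congrArg (fun T => IsGeneric T _) (Set.ext fun u => ?_)).mp hgen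
  constructor
  · rintro ⟨y, ⟨hy, hyg⟩, rfl⟩
    refine ⟨y, hy, ?_, (hr y).symm⟩
    rw [hgy]
    exact hyg
  · rintro ⟨y, hy, hyg, rfl⟩
    rw [hgy] at hyg
    exact ⟨y, ⟨hy, hyg⟩, (hr y).symm⟩

/-- The dimension of the closure of a parametrised set in `S` is the transcendence degree of the
normalised coordinates of the generic point. -/
theorem topologicalKrullDim_closure [Finite ι] {η : Type} {Y : Set (AffineSp η)}
    {K : Type} [Field K] [Algebra ℂ K] {ξ : η → K} (hY : IsIrreducible Y) (hξ : IsGeneric Y ξ)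
    (φ : ι → MvPolynomial η ℂ) {Z : Set S}
    (hZ : ∀ z, z ∈ Z ↔ ∃ y ∈ Y, ∃ w, A.q w = z ∧
      A.ent w = fun a => aeval (R := ℂ) (S₁ := ℂ) y (φ a))
    (i : J) (hi : aeval (fun a => aeval ξ (φ a)) (A.g i) ≠ 0) :
    topologicalKrullDim (closure Z : Set S) =
      ((matroid ℂ K).eRk (Set.range (A.nrm i fun a => aeval ξ (φ a))) : WithBot ℕ∞) := by
  set x : ι → K := fun a => aeval ξ (φ a) with hx
  have hrk : ∀ j, aeval x (A.g j) ≠ 0 → (matroid ℂ K).eRk (Set.range (A.nrm j x)) =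
      (matroid ℂ K).eRk (Set.range (A.nrm i x)) := fun j hj =>
    le_antisymm (A.eRk_nrm_le hi hj) (A.eRk_nrm_le hj hi)
  -- In such a chart the section carries `Z` onto the set `D` of normal forms. Closures commute both
  -- with restriction to an open set and with a closed embedding, so an affine variety with a known
  -- generic point remains.
  have key : ∀ j, aeval x (A.g j) ≠ 0 → topologicalKrullDim (closure Z ∩ A.dom j : Set S) =
      ((matroid ℂ K).eRk (Set.range (A.nrm j x)) : WithBot ℕ∞) := by
    intro j hj
    let c := A.ent ∘ A.sect j
    have hc := A.isClosedEmbedding_ent_sect j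
    have hgen := A.isGeneric_nrm hY hξ φ hj
    set D := {u | ∃ y ∈ Y, aeval (R := ℂ) (S₁ := ℂ)
        (fun a => aeval (R := ℂ) (S₁ := ℂ) y (φ a)) (A.g j) ≠ 0 ∧
        u = A.nrmSp j fun a => aeval (R := ℂ) (S₁ := ℂ) y (φ a)}
    have himg : c '' (Subtype.val ⁻¹' Z) = D := by
      ext u
      constructor
      · rintro ⟨z, hz, rfl⟩
        obtain ⟨y, hy, w, hw, hwy⟩ := (hZ z).1 hz
        refine ⟨y, hy, ?_, ?_⟩
        · rw [← hwy, ← A.q_mem_dom_iff j w, hw]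
          exact z.2
        · rw [← hwy]
          exact A.ent_sect j z hw
      · rintro ⟨y, hy, hyg, rfl⟩
        obtain ⟨w, hw⟩ := A.exists_ent j (fun a => aeval (R := ℂ) (S₁ := ℂ) y (φ a)) hyg
        have hwd : A.q w ∈ A.dom j := by
          rw [A.q_mem_dom_iff, hw]; exact hyg
        refine ⟨⟨A.q w, hwd⟩, (hZ _).2 ⟨y, hy, w, rfl, hw⟩, ?_⟩
        rw [← hw]
        exact A.ent_sect j ⟨A.q w, hwd⟩ rfl
    have hcl : c '' (Subtype.val ⁻¹' closure Z) = closure D := by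
      rw [← himg, (A.isOpen_dom j).isOpenMap_subtype_val.preimage_closure_eq_closure_preimage
          continuous_subtype_val]
      exact (hc.closure_image_eq _).symm
    have hdim := hgen.closure.topologicalKrullDim_eq isClosed_closure
    rw [← hcl] at hdim
    rw [← hdim]
    have e1 : topologicalKrullDim (Subtype.val ⁻¹' closure Z : Set (A.dom j)) =
        topologicalKrullDim (c '' (Subtype.val ⁻¹' closure Z) : Set (AffineSp ι)) :=
      IsHomeomorph.topologicalKrullDim_eq _ (hc.isEmbedding.homeomorphImage _).isHomeomorph
    have e2 : topologicalKrullDim (Subtype.val ⁻¹' closure Z : Set (A.dom j)) =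
        topologicalKrullDim (Subtype.val '' (Subtype.val ⁻¹' closure Z : Set (A.dom j)) : Set S) :=
      IsHomeomorph.topologicalKrullDim_eq _
        (IsEmbedding.subtypeVal.homeomorphImage _).isHomeomorph
    rw [← e1, e2, Subtype.image_preimage_coe, Set.inter_comm]
  apply le_antisymm
  · refine topologicalKrullDim_le_of_open_cover A.dom A.isOpen_dom
      (by rw [A.iUnion_dom]; exact Set.subset_univ _) _ fun j => ?_
    by_cases hj : aeval x (A.g j) = 0
    -- A denominator that vanishes at the generic point vanishes at every parametrised point. The
    -- open chart then misses `Z`, hence its closure.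
    · have : closure Z ∩ A.dom j = ∅ := by
        by_contra h
        obtain ⟨z, hz, hzj⟩ := Set.nonempty_iff_ne_empty.2 h
        obtain ⟨z', hzj', hz'⟩ := mem_closure_iff.1 hz _ (A.isOpen_dom j) hzj
        obtain ⟨y, hy, w, rfl, hwy⟩ := (hZ z').1 hz'
        rw [A.q_mem_dom_iff, hwy] at hzj'
        have hb := aeval_bind₁_point y φ (A.g j)
        rw [hx, ← aeval_bind₁] at hj
        exact hzj' (hb.symm.trans ((hξ _).1 hj y hy))
      rw [this]
      have : topologicalKrullDim (∅ : Set S) = ⊥ := by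
        have : IsEmpty (IrreducibleCloseds (∅ : Set S)) :=
          ⟨fun T => by obtain ⟨x, -⟩ := T.isIrreducible.nonempty; exact x.2⟩
        exact Order.krullDim_eq_bot
      rw [this]
      exact bot_le
    · rw [key j hj, hrk j hj]
  · rw [← key i hi]
    exact (IsEmbedding.inclusion Set.inter_subset_left).isInducing.topologicalKrullDim_le

end QuotAtlas

end SubspaceRank

/-! ### Atlases of Grassmannians, their products and projective space. -/

namespace SubspaceRank

/-- The matrix with entries `x`. -/
def toMat {K : Type*} {r m : ℕ} (x : Fin r × Fin m → K) : Matrix (Fin r) (Fin m) K :=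
  Matrix.of fun a b => x (a, b)

/-- The normal form of a matrix with respect to a choice `I` of columns. -/
noncomputable def matNrm {K : Type*} [Field K] {r m : ℕ} (I : Fin r → Fin m)
    (M : Matrix (Fin r) (Fin m) K) : Matrix (Fin r) (Fin m) K :=
  (M.submatrix id I)⁻¹ * M

theorem mul_submatrix_id {K : Type*} [CommRing K] {s r m k : ℕ} (I : Fin k → Fin m)
    (B : Matrix (Fin s) (Fin r) K) (M : Matrix (Fin r) (Fin m) K) :
    (B * M).submatrix id I = B * M.submatrix id I := by
  ext a b
  simp [Matrix.mul_apply]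

theorem matNrm_submatrix {K : Type*} [Field K] {r m : ℕ} {I : Fin r → Fin m}
    {M : Matrix (Fin r) (Fin m) K} (hI : (M.submatrix id I).det ≠ 0) :
    (matNrm I M).submatrix id I = 1 := by
  rw [matNrm, mul_submatrix_id]
  exact Matrix.nonsing_inv_mul _ (isUnit_iff_ne_zero.2 hI)

theorem mul_matNrm {K : Type*} [Field K] {r m : ℕ} {I : Fin r → Fin m}
    {M : Matrix (Fin r) (Fin m) K} (hI : (M.submatrix id I).det ≠ 0) :
    M.submatrix id I * matNrm I M = M := by
  rw [matNrm, ← Matrix.mul_assoc, Matrix.mul_nonsing_inv _ (isUnit_iff_ne_zero.2 hI),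
    Matrix.one_mul]

/-- The factor `B` cancels against the inverse of the chosen block, so the normal form depends only
on the row space. -/
theorem matNrm_mul {K : Type*} [Field K] {r m : ℕ} (I : Fin r → Fin m)
    (M : Matrix (Fin r) (Fin m) K) (B : Matrix (Fin r) (Fin r) K) (hB : B.det ≠ 0) :
    matNrm I (B * M) = matNrm I M := by
  rw [matNrm, matNrm, mul_submatrix_id, Matrix.mul_inv_rev, Matrix.mul_assoc, ← Matrix.mul_assoc B⁻¹,
    Matrix.nonsing_inv_mul _ (isUnit_iff_ne_zero.2 hB), Matrix.one_mul]

/-- The generic `r × m` matrix. -/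
noncomputable def genMat (r m : ℕ) : Matrix (Fin r) (Fin m) (MvPolynomial (Fin r × Fin m) ℂ) :=
  Matrix.of fun a b => X (a, b)

theorem map_genMat {K : Type*} [CommRing K] [Algebra ℂ K] {r m : ℕ} (x : Fin r × Fin m → K) :
    (genMat r m).map (aeval x) = toMat x := by
  ext a b
  simp [genMat, toMat]

/-- The minor of the generic matrix with columns `I`. -/
noncomputable def minor {r m : ℕ} (I : Fin r → Fin m) : MvPolynomial (Fin r × Fin m) ℂ :=
  ((genMat r m).submatrix id I).det

/-- The numerators of the entries of the normal form of the generic matrix. -/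
noncomputable def minorNum {r m : ℕ} (I : Fin r → Fin m) (a : Fin r × Fin m) :
    MvPolynomial (Fin r × Fin m) ℂ :=
  (((genMat r m).submatrix id I).adjugate * genMat r m) a.1 a.2

theorem aeval_minor {K : Type*} [CommRing K] [Algebra ℂ K] {r m : ℕ} (I : Fin r → Fin m)
    (x : Fin r × Fin m → K) : aeval x (minor I) = ((toMat x).submatrix id I).det := by
  rw [minor, AlgHom.map_det, ← map_genMat x]
  rfl

theorem aeval_minorNum {K : Type*} [CommRing K] [Algebra ℂ K] {r m : ℕ} (I : Fin r → Fin m)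
    (x : Fin r × Fin m → K) (a : Fin r × Fin m) :
    aeval x (minorNum I a) = (((toMat x).submatrix id I).adjugate * toMat x) a.1 a.2 := by
  set f : MvPolynomial (Fin r × Fin m) ℂ →+* K := (aeval x).toRingHom with hf
  have hgen : (genMat r m).map f = toMat x := map_genMat x
  have h : (((genMat r m).submatrix id I).adjugate * genMat r m).map f =
      ((toMat x).submatrix id I).adjugate * toMat x := by
    rw [Matrix.map_mul, ← RingHom.mapMatrix_apply f (Matrix.adjugate _), RingHom.map_adjugate,
      RingHom.mapMatrix_apply, ← Matrix.submatrix_map, hgen]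
  exact congrFun₂ h a.1 a.2

theorem toMat_ratMap {K : Type*} [Field K] [Algebra ℂ K] {r m : ℕ} (I : Fin r → Fin m)
    (x : Fin r × Fin m → K) : toMat (ratMap (minorNum I) (minor I) x) = matNrm I (toMat x) := by
  ext a b
  rw [toMat, Matrix.of_apply, ratMap, aeval_minor, aeval_minorNum, matNrm, Matrix.inv_def,
    Matrix.smul_mul, Matrix.smul_apply, smul_eq_mul, Ring.inverse_eq_inv', div_eq_inv_mul]

theorem toMat_injective {K : Type*} {r m : ℕ} {x y : Fin r × Fin m → K}
    (h : toMat x = toMat y) : x = y :=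
  funext fun a => congrFun₂ h a.1 a.2

theorem minor_ratMap {K : Type*} [Field K] [Algebra ℂ K] {r m : ℕ} {I : Fin r → Fin m}
    {x : Fin r × Fin m → K} (h : aeval x (minor I) ≠ 0) :
    aeval (ratMap (minorNum I) (minor I) x) (minor I) = 1 := by
  rw [aeval_minor] at h
  rw [aeval_minor, toMat_ratMap, matNrm_submatrix h, Matrix.det_one]

theorem minor_compat {K : Type*} [Field K] [Algebra ℂ K] {r m : ℕ} {I J : Fin r → Fin m}
    {x : Fin r × Fin m → K} (hI : aeval x (minor I) ≠ 0) (hJ : aeval x (minor J) ≠ 0) :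
    aeval (ratMap (minorNum I) (minor I) x) (minor J) ≠ 0 ∧
      ratMap (minorNum J) (minor J) (ratMap (minorNum I) (minor I) x) =
        ratMap (minorNum J) (minor J) x := by
  rw [aeval_minor] at hI hJ
  have hdet : ((toMat x).submatrix id I)⁻¹.det ≠ 0 := by
    rw [Matrix.det_nonsing_inv]
    simpa using hI
  constructor
  · rw [aeval_minor, toMat_ratMap, matNrm, mul_submatrix_id, Matrix.det_mul]
    exact mul_ne_zero hdet hJ
  · apply toMat_injective
    rw [toMat_ratMap, toMat_ratMap, toMat_ratMap]
    exact matNrm_mul J _ _ hdet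

/-- Row rank equals column rank, so `r` independent columns can be selected. -/
theorem exists_minor_ne_zero {K : Type*} [Field K] {r m : ℕ} (M : Matrix (Fin r) (Fin m) K)
    (h : LinearIndependent K M.row) : ∃ I : Fin r → Fin m, (M.submatrix id I).det ≠ 0 := by
  have hr : M.rank = r := by simpa using h.rank_matrix
  rw [Matrix.rank_eq_finrank_span_cols] at hr
  obtain ⟨f, hf, -, hli⟩ := Submodule.exists_fun_fin_finrank_span_eq K (Set.range M.col)
  choose I hI using hf
  refine ⟨fun a => I (finCongr hr.symm a), ?_⟩
  have : LinearIndependent K (M.submatrix id fun a => I (finCongr hr.symm a)).col := by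
    have h1 : (M.submatrix id fun a => I (finCongr hr.symm a)).col = f ∘ finCongr hr.symm := by
      funext a
      rw [Function.comp_apply, ← hI]
      rfl
    rw [h1]
    exact hli.comp _ (finCongr hr.symm).injective
  rw [Matrix.linearIndependent_cols_iff_isUnit, Matrix.isUnit_iff_isUnit_det] at this
  exact this.ne_zero

theorem linearIndependent_of_minor_ne_zero {K : Type*} [Field K] {r m : ℕ}
    (M : Matrix (Fin r) (Fin m) K) {I : Fin r → Fin m} (h : (M.submatrix id I).det ≠ 0) :
    LinearIndependent K M.row := by
  have h1 := Matrix.linearIndependent_rows_of_det_ne_zero h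
  exact LinearIndependent.of_comp (LinearMap.funLeft K K I) h1

theorem mem_span_iff_exists_mul {K : Type*} [Field K] {s r m : ℕ} (v : Fin s → Fin m → K)
    (w : Fin r → Fin m → K) : Submodule.span K (Set.range v) ≤ Submodule.span K (Set.range w) ↔
      ∃ B : Matrix (Fin s) (Fin r) K, Matrix.of v = B * Matrix.of w := by
  constructor
  · intro h
    have : ∀ a, ∃ c : Fin r → K, ∑ i, c i • w i = v a := fun a =>
      (Submodule.mem_span_range_iff_exists_fun K).1 (h (Submodule.subset_span ⟨a, rfl⟩))
    choose c hc using this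
    refine ⟨Matrix.of c, ?_⟩
    ext a b
    rw [Matrix.of_apply, ← hc a, Matrix.mul_apply]
    simp
  · rintro ⟨B, hB⟩
    rw [Submodule.span_le]
    rintro _ ⟨a, rfl⟩
    refine (Submodule.mem_span_range_iff_exists_fun K).2 ⟨B a, ?_⟩
    funext b
    have := congrFun₂ hB a b
    rw [Matrix.of_apply, Matrix.mul_apply] at this
    rw [this]
    simp

theorem Frame.span_eq_iff {r m : ℕ} (w w' : Frame r m) :
    w.span = w'.span ↔ Submodule.span ℂ (Set.range w.1) ≤ Submodule.span ℂ (Set.range w'.1) := by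
  constructor
  · intro h
    exact (congrArg Subtype.val h).le
  · intro h
    apply Subtype.ext
    refine Submodule.eq_of_le_of_finrank_eq h ?_
    exact (finrank_span_eq_card w.2).trans (finrank_span_eq_card w'.2).symm

theorem Frame.span_surjective {r m : ℕ} :
    Function.Surjective (Frame.span : Frame r m → Gr r m) := by
  rintro ⟨E, hE⟩
  let b := (Module.finBasisOfFinrankEq ℂ E hE)
  refine ⟨⟨fun i => (b i : Fin m → ℂ), ?_⟩, ?_⟩
  · exact b.linearIndependent.map' E.subtype (Submodule.ker_subtype _)
  · apply Subtype.ext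
    change Submodule.span ℂ (Set.range fun i => (b i : Fin m → ℂ)) = E
    have : Set.range (fun i => (b i : Fin m → ℂ)) = E.subtype '' Set.range b := by
      rw [← Set.range_comp]; rfl
    rw [this, Submodule.span_image, b.span_eq, Submodule.map_top, Submodule.range_subtype]

theorem toMat_entries {r m : ℕ} (w : Frame r m) : toMat (K := ℂ) w.entries = Matrix.of w.1 := rfl

theorem Frame.exists_entries {r m : ℕ} (I : Fin r → Fin m) (x : AffineSp (Fin r × Fin m))
    (h : aeval (R := ℂ) (S₁ := ℂ) x (minor I) ≠ 0) : ∃ w : Frame r m, w.entries = x := by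
  have h' := aeval_minor (K := ℂ) I x
  rw [h'] at h
  exact ⟨⟨fun a b => x (a, b), linearIndependent_of_minor_ne_zero _ h⟩, rfl⟩

theorem Frame.exists_minor {r m : ℕ} (w : Frame r m) :
    ∃ I : Fin r → Fin m, aeval (R := ℂ) (S₁ := ℂ) w.entries (minor I) ≠ 0 := by
  obtain ⟨I, hI⟩ := exists_minor_ne_zero (Matrix.of w.1) w.2
  exact ⟨I, by rw [aeval_minor (K := ℂ) I w.entries]; exact hI⟩

theorem Frame.eq_of_span_eq {r m : ℕ} (w w' : Frame r m) (h : w.span = w'.span)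
    (I : Fin r → Fin m) (hI : aeval (R := ℂ) (S₁ := ℂ) w.entries (minor I) ≠ 0) :
    aeval (R := ℂ) (S₁ := ℂ) w'.entries (minor I) ≠ 0 ∧
      ratMapSp (minorNum I) (minor I) w'.entries = ratMapSp (minorNum I) (minor I) w.entries := by
  obtain ⟨B, hB⟩ := (mem_span_iff_exists_mul _ _).1 ((Frame.span_eq_iff w w').1 h)
  -- The minor of `w` is the determinant of `B` times the minor of `w'`, so both factors are
  -- nonzero; in particular the change of frame is invertible.
  rw [aeval_minor (K := ℂ) I w.entries, toMat_entries, hB, mul_submatrix_id, Matrix.det_mul] at hI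
  constructor
  · rw [aeval_minor (K := ℂ) I w'.entries]
    exact right_ne_zero_of_mul hI
  · apply toMat_injective (K := ℂ)
    refine (toMat_ratMap (K := ℂ) I w'.entries).trans (Eq.trans ?_ (toMat_ratMap (K := ℂ) I w.entries).symm)
    rw [toMat_entries, toMat_entries, hB, matNrm_mul _ _ _ (left_ne_zero_of_mul hI)]

theorem Frame.span_eq_of_entries {r m : ℕ} (w w' : Frame r m) (I : Fin r → Fin m)
    (h : w'.entries = ratMapSp (minorNum I) (minor I) w.entries) : w'.span = w.span := by
  rw [Frame.span_eq_iff, mem_span_iff_exists_mul]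
  refine ⟨((Matrix.of w.1).submatrix id I)⁻¹, ?_⟩
  rw [← toMat_entries w', h]
  exact toMat_ratMap (K := ℂ) I w.entries

/-- The standard atlas of the Grassmannian. -/
noncomputable def grAtlas (r m : ℕ) :
    QuotAtlas (Frame r m) (Gr r m) (Fin r × Fin m) (Fin r → Fin m) where
  ent := Frame.entries
  isInducing_ent := ⟨rfl⟩
  q := Frame.span
  isQuotientMap_q := ⟨⟨rfl⟩, Frame.span_surjective⟩
  g := minor
  P := minorNum
  exists_ent := Frame.exists_entries
  cover := Frame.exists_minor
  g_ratMap _ _ _ _ _ h := minor_ratMap h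
  compat _ _ _ _ _ _ hI hJ := minor_compat hI hJ
  eq_of_q := Frame.eq_of_span_eq
  q_ratMap w w' I _ h := Frame.span_eq_of_entries w w' I h

/-- The denominators of the normal form of the generic pair of matrices. -/
noncomputable def pairMinor {r s m : ℕ} (I : (Fin r → Fin m) × (Fin s → Fin m)) :
    MvPolynomial (Fin r × Fin m ⊕ Fin s × Fin m) ℂ :=
  rename Sum.inl (minor I.1) * rename Sum.inr (minor I.2)

/-- The numerators of the normal form of the generic pair of matrices. -/
noncomputable def pairMinorNum {r s m : ℕ} (I : (Fin r → Fin m) × (Fin s → Fin m)) :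
    Fin r × Fin m ⊕ Fin s × Fin m → MvPolynomial (Fin r × Fin m ⊕ Fin s × Fin m) ℂ :=
  Sum.elim (fun a => rename Sum.inl (minorNum I.1 a) * rename Sum.inr (minor I.2))
    (fun a => rename Sum.inl (minor I.1) * rename Sum.inr (minorNum I.2 a))

theorem aeval_pairMinor {K : Type*} [Field K] [Algebra ℂ K] {r s m : ℕ}
    (I : (Fin r → Fin m) × (Fin s → Fin m)) (x : Fin r × Fin m ⊕ Fin s × Fin m → K) :
    aeval x (pairMinor I) = aeval (x ∘ Sum.inl) (minor I.1) * aeval (x ∘ Sum.inr) (minor I.2) := by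
  rw [pairMinor, map_mul, aeval_rename, aeval_rename]

/-- An atlas uses a single denominator per chart, so both minors are multiplied together. The
superfluous factor cancels in each component. -/
theorem ratMap_pairMinor {K : Type*} [Field K] [Algebra ℂ K] {r s m : ℕ}
    (I : (Fin r → Fin m) × (Fin s → Fin m)) {x : Fin r × Fin m ⊕ Fin s × Fin m → K}
    (h : aeval x (pairMinor I) ≠ 0) : ratMap (pairMinorNum I) (pairMinor I) x =
      Sum.elim (ratMap (minorNum I.1) (minor I.1) (x ∘ Sum.inl))
        (ratMap (minorNum I.2) (minor I.2) (x ∘ Sum.inr)) := by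
  rw [aeval_pairMinor] at h
  have h1 := left_ne_zero_of_mul h
  have h2 := right_ne_zero_of_mul h
  funext a
  rcases a with a | a
  · simp only [ratMap, aeval_pairMinor, pairMinorNum, Sum.elim_inl, map_mul, aeval_rename]
    field_simp
  · simp only [ratMap, aeval_pairMinor, pairMinorNum, Sum.elim_inr, map_mul, aeval_rename]
    field_simp

theorem GrPair.ext_iff' {r s m : ℕ} {p p' : GrPair r s m} :
    p = p' ↔ p.big = p'.big ∧ p.small = p'.small := by
  cases p; cases p'; simp

/-- The standard atlas of a product of two Grassmannians. -/
noncomputable def grPairAtlas (r s m : ℕ) :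
    QuotAtlas (FramePair r s m) (GrPair r s m) (Fin r × Fin m ⊕ Fin s × Fin m)
      ((Fin r → Fin m) × (Fin s → Fin m)) where
  ent := FramePair.entries
  isInducing_ent := ⟨rfl⟩
  q := FramePair.span
  isQuotientMap_q := ⟨⟨rfl⟩, fun p => by
    obtain ⟨w, hw⟩ := Frame.span_surjective p.big
    obtain ⟨v, hv⟩ := Frame.span_surjective p.small
    exact ⟨⟨w, v⟩, GrPair.ext_iff'.2 ⟨hw, hv⟩⟩⟩
  g := pairMinor
  P := pairMinorNum
  exists_ent I x h := by
    have h' := aeval_pairMinor (K := ℂ) I x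
    rw [h'] at h
    obtain ⟨w, hw⟩ := Frame.exists_entries I.1 _ (left_ne_zero_of_mul h)
    obtain ⟨v, hv⟩ := Frame.exists_entries I.2 _ (right_ne_zero_of_mul h)
    refine ⟨⟨w, v⟩, ?_⟩
    rw [FramePair.entries, hw, hv]
    exact Sum.elim_comp_inl_inr x
  cover w := by
    obtain ⟨I, hI⟩ := w.big.exists_minor
    obtain ⟨J, hJ⟩ := w.small.exists_minor
    refine ⟨(I, J), ?_⟩
    have h' := aeval_pairMinor (K := ℂ) (I, J) w.entries
    rw [h']
    exact mul_ne_zero hI hJ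
  g_ratMap I K _ _ x h := by
    rw [ratMap_pairMinor I h, aeval_pairMinor]
    rw [aeval_pairMinor] at h
    rw [Sum.elim_comp_inl, Sum.elim_comp_inr, minor_ratMap (left_ne_zero_of_mul h),
      minor_ratMap (right_ne_zero_of_mul h), one_mul]
  compat I J K _ _ x hI hJ := by
    have hI' := hI
    have hJ' := hJ
    rw [aeval_pairMinor] at hI' hJ'
    have h1 := minor_compat (left_ne_zero_of_mul hI') (left_ne_zero_of_mul hJ')
    have h2 := minor_compat (right_ne_zero_of_mul hI') (right_ne_zero_of_mul hJ')
    have h3 : aeval (ratMap (pairMinorNum I) (pairMinor I) x) (pairMinor J) ≠ 0 := by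
      rw [ratMap_pairMinor I hI, aeval_pairMinor, Sum.elim_comp_inl, Sum.elim_comp_inr]
      exact mul_ne_zero h1.1 h2.1
    refine ⟨h3, ?_⟩
    rw [ratMap_pairMinor J h3, ratMap_pairMinor I hI, ratMap_pairMinor J hJ, Sum.elim_comp_inl,
      Sum.elim_comp_inr, h1.2, h2.2]
  eq_of_q w w' h I hI := by
    have h' := fun w : FramePair r s m => aeval_pairMinor (K := ℂ) I w.entries
    have hI' := hI
    rw [h'] at hI'
    have h1 := Frame.eq_of_span_eq w.big w'.big (GrPair.ext_iff'.1 h).1 I.1 (left_ne_zero_of_mul hI')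
    have h2 := Frame.eq_of_span_eq w.small w'.small (GrPair.ext_iff'.1 h).2 I.2
      (right_ne_zero_of_mul hI')
    have h3 : aeval (R := ℂ) (S₁ := ℂ) w'.entries (pairMinor I) ≠ 0 := by
      rw [h']
      exact mul_ne_zero h1.1 h2.1
    refine ⟨h3, ?_⟩
    refine (ratMap_pairMinor (K := ℂ) I h3).trans
      (Eq.trans ?_ (ratMap_pairMinor (K := ℂ) I hI).symm)
    exact congrArg₂ Sum.elim h1.2 h2.2
  q_ratMap w w' I hI h := by
    have h' := h.trans (ratMap_pairMinor (K := ℂ) I hI)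
    rw [GrPair.ext_iff']
    exact ⟨Frame.span_eq_of_entries w.big w'.big I.1 (congrArg (· ∘ Sum.inl) h'),
      Frame.span_eq_of_entries w.small w'.small I.2 (congrArg (· ∘ Sum.inr) h')⟩

/-- The standard atlas of projective space. -/
noncomputable def pSpaceAtlas (m : ℕ) : QuotAtlas (NonzeroVec m) (PSpace m) (Fin m) (Fin m) where
  ent := NonzeroVec.coords
  isInducing_ent := ⟨rfl⟩
  q := PSpace.ofVec
  isQuotientMap_q := ⟨⟨rfl⟩, fun p => by
    induction p using Projectivization.ind with
    | h v hv => exact ⟨⟨v, hv⟩, rfl⟩⟩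
  g i := X i
  P _ a := X a
  exists_ent j x h := by
    have hx : x j ≠ 0 := by
      have := aeval_X (R := ℂ) (S₁ := ℂ) x j
      rwa [this] at h
    exact ⟨⟨x, fun h => hx (congrFun h j)⟩, rfl⟩
  cover w := by
    obtain ⟨j, hj⟩ := Function.ne_iff.1 w.2
    refine ⟨j, ?_⟩
    have := aeval_X (R := ℂ) (S₁ := ℂ) w.coords j
    rw [this]
    exact hj
  g_ratMap j K _ _ x h := by
    rw [aeval_X] at h
    rw [aeval_X, ratMap, aeval_X, div_self h]
  compat i j K _ _ x hi hj := by
    rw [aeval_X] at hi hj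
    constructor
    · rw [aeval_X, ratMap, aeval_X, aeval_X]
      exact div_ne_zero hj hi
    · funext a
      simp only [ratMap, aeval_X]
      field_simp
  eq_of_q w w' h j hj := by
    have hX := fun x : NonzeroVec m => aeval_X (R := ℂ) (S₁ := ℂ) x.coords j
    obtain ⟨c, hc⟩ := (Projectivization.mk_eq_mk_iff ℂ _ _ w.2 w'.2).1 h
    have hc' : ∀ a, w.coords a = (c : ℂ) * w'.coords a := fun a => (congrFun hc a).symm
    rw [hX, hc'] at hj
    refine ⟨by rw [hX]; exact right_ne_zero_of_mul hj, ?_⟩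
    funext a
    have h1 := aeval_X (R := ℂ) (S₁ := ℂ) w.coords
    have h2 := aeval_X (R := ℂ) (S₁ := ℂ) w'.coords
    change aeval (R := ℂ) (S₁ := ℂ) w'.coords _ / aeval (R := ℂ) (S₁ := ℂ) w'.coords _ =
      aeval (R := ℂ) (S₁ := ℂ) w.coords _ / aeval (R := ℂ) (S₁ := ℂ) w.coords _
    rw [h1, h1, h2, h2, hc', hc']
    have := left_ne_zero_of_mul hj
    have := right_ne_zero_of_mul hj
    field_simp
  q_ratMap w w' j hj h := by
    have hX := fun a => aeval_X (R := ℂ) (S₁ := ℂ) w.coords a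
    rw [hX] at hj
    refine (Projectivization.mk_eq_mk_iff ℂ _ _ w'.2 w.2).2 ⟨(Units.mk0 _ hj)⁻¹, ?_⟩
    funext a
    have h1 := congrFun h a
    change w'.coords a = aeval (R := ℂ) (S₁ := ℂ) w.coords _ / aeval (R := ℂ) (S₁ := ℂ) w.coords _
      at h1
    rw [hX, hX, div_eq_inv_mul] at h1
    exact h1.symm

end SubspaceRank

/-! ### Irreducibility and density in products. -/

/-- Only separate continuity is assumed because the Zariski topology of a product is finer than the
product topology. Irreducibility of `A` gives a common first coordinate for two open sets, after
which irreducibility of `B` gives a common second one. -/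
theorem isIrreducible_image2_of_separately_continuous {E F S : Type*} [TopologicalSpace E]
    [TopologicalSpace F] [TopologicalSpace S] {c : E → F → S} (h1 : ∀ b, Continuous fun a => c a b)
    (h2 : ∀ a, Continuous fun b => c a b) {A : Set E} {B : Set F} (hA : IsIrreducible A)
    (hB : IsIrreducible B) : IsIrreducible (Set.image2 c A B) := by
  refine ⟨hA.nonempty.image2 hB.nonempty, ?_⟩
  rintro U V hU hV ⟨_, ⟨a, ha, b, hb, rfl⟩, hab⟩ ⟨_, ⟨a', ha', b', hb', rfl⟩, hab'⟩
  obtain ⟨x, hx, hxU, hxV⟩ := hA.isPreirreducible _ _ (hU.preimage (h1 b)) (hV.preimage (h1 b'))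
    ⟨a, ha, hab⟩ ⟨a', ha', hab'⟩
  obtain ⟨y, hy, hyU, hyV⟩ := hB.isPreirreducible _ _ (hU.preimage (h2 x)) (hV.preimage (h2 x))
    ⟨b, hb, hxU⟩ ⟨b', hb', hxV⟩
  exact ⟨_, ⟨x, hx, y, hy, rfl⟩, hyU, hyV⟩

theorem isIrreducible_image_pi_of_separately_continuous {κ E S : Type*} [Finite κ] [DecidableEq κ]
    [TopologicalSpace E] [TopologicalSpace S] {c : (κ → E) → S}
    (hc : ∀ z i, Continuous fun y => c (Function.update z i y)) {Y : Set E}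
    (hY : IsIrreducible Y) : IsIrreducible (c '' {z | ∀ i, z i ∈ Y}) := by
  cases nonempty_fintype κ
  obtain ⟨y0, hy0⟩ := hY.nonempty
  refine ⟨⟨_, fun _ => y0, fun _ => hy0, rfl⟩, ?_⟩
  rintro U V hU hV ⟨_, ⟨z, hz, rfl⟩, hzU⟩ ⟨_, ⟨z', hz', rfl⟩, hzV⟩
  -- A point over `U` and a point over `V` are made to agree on one more coordinate at a time, each
  -- time by irreducibility of `Y`.
  have key : ∀ t : Finset κ, ∃ x x' : κ → E, (∀ i, x i ∈ Y) ∧ (∀ i, x' i ∈ Y) ∧ c x ∈ U ∧ c x' ∈ V ∧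
      ∀ i ∈ t, x i = x' i := by
    intro t
    induction t using Finset.induction_on with
    | empty => exact ⟨z, z', hz, hz', hzU, hzV, by simp⟩
    | insert i t hi ih =>
      obtain ⟨x, x', hx, hx', hxU, hxV, hxx⟩ := ih
      obtain ⟨y, hy, hyU, hyV⟩ := hY.isPreirreducible _ _ (hU.preimage (hc x i))
        (hV.preimage (hc x' i)) ⟨x i, hx i, by simpa using hxU⟩ ⟨x' i, hx' i, by simpa using hxV⟩
      refine ⟨Function.update x i y, Function.update x' i y, ?_, ?_, hyU, hyV, ?_⟩
      · intro j
        by_cases hj : j = i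
        · subst hj; simpa using hy
        · simpa [hj] using hx j
      · intro j
        by_cases hj : j = i
        · subst hj; simpa using hy
        · simpa [hj] using hx' j
      · intro j hj
        by_cases hji : j = i
        · subst hji; simp
        · simpa [hji] using hxx j (Finset.mem_of_mem_insert_of_ne hj hji)
  obtain ⟨x, x', hx, -, hxU, hxV, hxx⟩ := key Finset.univ
  obtain rfl : x = x' := funext fun i => hxx i (Finset.mem_univ i)
  exact ⟨_, ⟨x, hx, rfl⟩, hxU, hxV⟩

/-- Coordinates are moved from `closure T` into `T` one at a time; the induction is on the set of
coordinates not yet known to lie in `T`. -/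
theorem mem_closure_image_pi_of_separately_continuous {κ E S : Type*} [Finite κ] [DecidableEq κ]
    [TopologicalSpace E] [TopologicalSpace S] {c : (κ → E) → S}
    (hc : ∀ z i, Continuous fun y => c (Function.update z i y)) {T : Set E} {z : κ → E}
    (hz : ∀ i, z i ∈ closure T) : c z ∈ closure (c '' {z | ∀ i, z i ∈ T}) := by
  cases nonempty_fintype κ
  have key : ∀ (t : Finset κ) (z : κ → E), (∀ i, z i ∈ closure T) → (∀ i ∉ t, z i ∈ T) →
      c z ∈ closure (c '' {z | ∀ i, z i ∈ T}) := by
    intro t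
    induction t using Finset.induction_on with
    | empty => exact fun z _ hz => subset_closure ⟨z, fun i => hz i (by simp), rfl⟩
    | insert i t hi ih =>
      intro z hz hzt
      have hmaps : Set.MapsTo (fun y => c (Function.update z i y)) T
          (closure (c '' {z | ∀ i, z i ∈ T})) := by
        intro y hy
        refine ih _ ?_ ?_
        · intro j
          by_cases hj : j = i
          · subst hj; simpa using subset_closure hy
          · simpa [hj] using hz j
        · intro j hj
          by_cases hji : j = i
          · subst hji; simpa using hy
          · simpa [hji] using hzt j (by simp [hji, hj])
      have := hmaps.closure (hc z i) (hz i)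
      simpa using this
  exact key Finset.univ z hz (by simp)

/-! ### Affine cones and affine parts of `X`. -/

namespace SubspaceRank

theorem isIrreducible_univ_affineSp (κ : Type) [Finite κ] :
    IsIrreducible (Set.univ : Set (AffineSp κ)) := by
  have : zeroSet (⊥ : Ideal (MvPolynomial κ ℂ)) = Set.univ := zeroLocus_bot
  rw [← this]
  have : (⊥ : Ideal (MvPolynomial κ ℂ)).IsPrime := Ideal.isPrime_bot
  exact isIrreducible_zeroSet _

theorem aeval_X_point {ι : Type} (y : AffineSp ι) (i : ι) :
    aeval (R := ℂ) (S₁ := ℂ) y (X i) = y i :=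
  aeval_X (R := ℂ) (S₁ := ℂ) y i

theorem aeval_X_point' {ι : Type} (y : AffineSp ι) :
    y = fun i : ι => aeval (R := ℂ) (S₁ := ℂ) y (X i) :=
  funext fun i => (aeval_X_point y i).symm

theorem aeval_X_eq {ι K : Type} [Field K] [Algebra ℂ K] (ξ : ι → K) :
    ξ = fun i => aeval ξ (X (R := ℂ) i) :=
  funext fun i => (aeval_X ξ i).symm

section Cone

variable {m : ℕ}

/-- The nonzero vectors of the affine cone over `X`. -/
def cone (X : Set (PSpace m)) : Set (AffineSp (Fin m)) :=
  {v | ∃ w : NonzeroVec m, w.coords = v ∧ PSpace.ofVec w ∈ X}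

/-- The part of `X` in the affine chart where the coordinate `a` is equal to `1`. -/
def affinePart (X : Set (PSpace m)) (a : Fin m) : Set (AffineSp (Fin m)) :=
  {v | v ∈ cone X ∧ v a = 1}

theorem smul_mem_cone {X : Set (PSpace m)} {v : AffineSp (Fin m)} (hv : v ∈ cone X) {c : ℂ}
    (hc : c ≠ 0) : (fun i => c * v i : AffineSp (Fin m)) ∈ cone X := by
  obtain ⟨w, rfl, hw⟩ := hv
  have h0 : c • w.1 ≠ 0 := smul_ne_zero hc w.2
  refine ⟨⟨c • w.1, h0⟩, rfl, ?_⟩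
  have : PSpace.ofVec ⟨c • w.1, h0⟩ = PSpace.ofVec w :=
    (Projectivization.mk_eq_mk_iff ℂ _ _ h0 w.2).2 ⟨Units.mk0 c hc, rfl⟩
  rwa [this]

theorem pSpace_mem_dom_iff (a : Fin m) (w : NonzeroVec m) :
    PSpace.ofVec w ∈ (pSpaceAtlas m).dom a ↔ w.coords a ≠ 0 := by
  have h := (pSpaceAtlas m).q_mem_dom_iff a w
  have hX := aeval_X (R := ℂ) (S₁ := ℂ) w.coords a
  change _ ↔ aeval (R := ℂ) (S₁ := ℂ) w.coords (X a) ≠ 0 at h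
  rw [hX] at h
  exact h

theorem pSpace_nrmSp (a : Fin m) (x : AffineSp (Fin m)) :
    (pSpaceAtlas m).nrmSp a x = fun i => x i / x a := by
  funext i
  change aeval (R := ℂ) (S₁ := ℂ) x (X i) / aeval (R := ℂ) (S₁ := ℂ) x (X a) = x i / x a
  have hX := aeval_X (R := ℂ) (S₁ := ℂ) x
  rw [hX, hX]

/-- Presents the affine part as the image of `X` under a chart that is a closed embedding, from
which closedness and irreducibility follow. -/
theorem affinePart_eq (X : Set (PSpace m)) (a : Fin m) : affinePart X a =
    ((pSpaceAtlas m).ent ∘ (pSpaceAtlas m).sect a) '' (Subtype.val ⁻¹' X) := by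
  ext v
  constructor
  · rintro ⟨⟨w, rfl, hw⟩, hv⟩
    have hd : PSpace.ofVec w ∈ (pSpaceAtlas m).dom a := by
      rw [pSpace_mem_dom_iff, hv]; exact one_ne_zero
    refine ⟨⟨_, hd⟩, hw, ?_⟩
    refine ((pSpaceAtlas m).ent_sect a ⟨_, hd⟩ (w := w) rfl).trans ?_
    rw [pSpace_nrmSp]
    funext i
    change w.coords i / w.coords a = _
    rw [hv, div_one]
  · rintro ⟨z, hz, rfl⟩
    refine ⟨⟨(pSpaceAtlas m).sect a z, rfl, ?_⟩, ?_⟩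
    · have := (pSpaceAtlas m).q_sect a z
      change (pSpaceAtlas m).q _ ∈ X
      rw [this]
      exact hz
    · obtain ⟨w, hw⟩ := (pSpaceAtlas m).isQuotientMap_q.surjective z
      have h1 := (pSpaceAtlas m).ent_sect a z hw
      rw [pSpace_nrmSp] at h1
      rw [Function.comp_apply, h1]
      refine div_self ?_
      refine (pSpace_mem_dom_iff a w).1 ?_
      change (pSpaceAtlas m).q w ∈ _
      rw [hw]
      exact z.2

theorem isClosed_affinePart {X : Set (PSpace m)} (hX : IsClosed X) (a : Fin m) :
    IsClosed (affinePart X a) := by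
  rw [affinePart_eq]
  exact ((pSpaceAtlas m).isClosedEmbedding_ent_sect a).isClosedMap _
    (hX.preimage continuous_subtype_val)

theorem isIrreducible_affinePart {X : Set (PSpace m)} (hX : IsIrreducible X) {a : Fin m}
    (ha : (X ∩ (pSpaceAtlas m).dom a).Nonempty) : IsIrreducible (affinePart X a) := by
  rw [affinePart_eq]
  refine IsIrreducible.image ⟨?_, ?_⟩ _
    ((pSpaceAtlas m).isClosedEmbedding_ent_sect a).continuous.continuousOn
  · obtain ⟨p, hp, hpa⟩ := ha
    exact ⟨⟨p, hpa⟩, hp⟩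
  · exact hX.isPreirreducible.preimage ((pSpaceAtlas m).isOpen_dom a).isOpenEmbedding_subtypeVal

/-- A nonzero multiple of a nonzero vector. -/
def NonzeroVec.smul (c : ℂˣ) (w : NonzeroVec m) : NonzeroVec m :=
  ⟨c • w.1, (smul_ne_zero_iff_right c.ne_zero).2 w.2⟩

/-- The saturation of an open set is the union of its images under scaling by units, and scaling is
a polynomial map. -/
theorem isOpenMap_ofVec : IsOpenMap (PSpace.ofVec : NonzeroVec m → PSpace m) := by
  intro O hO
  rw [← (pSpaceAtlas m).isQuotientMap_q.isOpen_preimage]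
  have : (pSpaceAtlas m).q ⁻¹' (PSpace.ofVec '' O) =
      ⋃ c : ℂˣ, NonzeroVec.smul c ⁻¹' O := by
    ext w
    rw [Set.mem_iUnion]
    constructor
    · rintro ⟨w', hw', h⟩
      obtain ⟨c, hc⟩ := (Projectivization.mk_eq_mk_iff ℂ _ _ w'.2 w.2).1 h
      refine ⟨c, ?_⟩
      have : w' = NonzeroVec.smul c w := Subtype.ext hc.symm
      rw [Set.mem_preimage, ← this]
      exact hw'
    · rintro ⟨c, hc⟩
      refine ⟨_, hc, ?_⟩
      exact (Projectivization.mk_eq_mk_iff ℂ _ _ (NonzeroVec.smul c w).2 w.2).2 ⟨c, rfl⟩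
  rw [this]
  refine isOpen_iUnion fun c => hO.preimage ?_
  refine ((pSpaceAtlas m).isInducing_ent.continuous_iff).2 ?_
  refine continuous_affineSp_of_polynomial (pSpaceAtlas m).isInducing_ent.continuous
    (fun i => C (c : ℂ) * X i) fun w i => ?_
  have hX := aeval_X (R := ℂ) (S₁ := ℂ) ((pSpaceAtlas m).ent w) i
  have hC := aeval_C (R := ℂ) (S₁ := ℂ) ((pSpaceAtlas m).ent w) c
  rw [map_mul, hX, hC]
  rfl

/-- A neighbourhood of a cone point has open image in projective space. Since `X` is irreducible,
this image and the chart `a` meet at a point of `X`. -/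
theorem cone_subset_closure {X : Set (PSpace m)} (hX : IsIrreducible X) {a : Fin m}
    (ha : (X ∩ (pSpaceAtlas m).dom a).Nonempty) :
    cone X ⊆ closure {v | v ∈ cone X ∧ v a ≠ 0} := by
  rintro _ ⟨w, rfl, hw⟩
  rw [mem_closure_iff]
  intro O hO hwO
  obtain ⟨p, hpX, ⟨w', hw', rfl⟩, hpa⟩ := hX.isPreirreducible _ _
    (isOpenMap_ofVec _ (hO.preimage (pSpaceAtlas m).isInducing_ent.continuous))
    ((pSpaceAtlas m).isOpen_dom a) ⟨_, hw, w, hwO, rfl⟩ ha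
  exact ⟨w'.coords, hw', ⟨w', rfl, hpX⟩, (pSpace_mem_dom_iff a w').1 hpa⟩

theorem div_mem_affinePart {X : Set (PSpace m)} {a : Fin m} {v : AffineSp (Fin m)}
    (hv : v ∈ cone X) (ha : v a ≠ 0) :
    (fun i => (v a)⁻¹ * v i : AffineSp (Fin m)) ∈ affinePart X a :=
  ⟨smul_mem_cone hv (inv_ne_zero ha), inv_mul_cancel₀ ha⟩

/-- A hyperplane containing the affine part contains, by scaling, all cone points with nonzero `a`
coordinate, hence by density the whole cone. Nondegeneracy excludes this. -/
theorem span_affinePart_eq_top {X : Set (PSpace m)} (hX : IsIrreducible X)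
    (hXn : Nondegenerate X) {a : Fin m} (ha : (X ∩ (pSpaceAtlas m).dom a).Nonempty) :
    @Submodule.span ℂ (Fin m → ℂ) _ _ _ (affinePart X a) = ⊤ := by
  by_contra h
  obtain ⟨H, hH, hle⟩ := (eq_top_or_exists_le_coatom _).resolve_left h
  obtain ⟨p, hp, hpH⟩ := hXn H hH
  obtain ⟨w, rfl⟩ := (pSpaceAtlas m).isQuotientMap_q.surjective p
  have hwH : w.1 ∉ H := by
    intro hw
    apply hpH
    change Projectivization.submodule (Projectivization.mk ℂ w.1 w.2) ≤ H
    rw [Projectivization.submodule_mk, Submodule.span_singleton_le_iff_mem]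
    exact hw
  obtain ⟨ℓ, hℓw, hℓH⟩ := Submodule.exists_dual_map_eq_bot_of_notMem hwH inferInstance
  -- The linear form `ℓ` as a polynomial, so that its nonvanishing locus is Zariski open.
  let p : MvPolynomial (Fin m) ℂ := ∑ i, C (ℓ (Pi.single i 1)) * MvPolynomial.X i
  have hpe : ∀ v : AffineSp (Fin m), aeval (R := ℂ) (S₁ := ℂ) v p = ℓ v := by
    intro v
    have hX := aeval_X (R := ℂ) (S₁ := ℂ) v
    have hC := aeval_C (R := ℂ) (S₁ := ℂ) v
    rw [map_sum]
    simp only [map_mul, hX, hC]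
    refine Eq.trans (Finset.sum_congr rfl fun i _ => ?_)
      (LinearMap.pi_apply_eq_sum_univ ℓ (fun i => v i)).symm
    rw [smul_eq_mul, mul_comm]
    refine congrArg (fun u => v i * ℓ u) ?_
    funext j
    simp [Pi.single_apply, eq_comm]
  have hcl := cone_subset_closure hX ha ⟨w, rfl, hp⟩
  obtain ⟨v, hv, hvc, hva⟩ := mem_closure_iff.1 hcl _ (isOpen_setOf_aeval_ne_zero p)
    (by change aeval (R := ℂ) (S₁ := ℂ) w.coords p ≠ 0; rw [hpe]; exact hℓw)
  have hmem : (fun i => (v a)⁻¹ * v i : Fin m → ℂ) ∈ H :=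
    hle (Submodule.subset_span (div_mem_affinePart hvc hva))
  have h0 : ℓ (fun i => (v a)⁻¹ * v i : Fin m → ℂ) = 0 := by
    have : ℓ (fun i => (v a)⁻¹ * v i : Fin m → ℂ) ∈ H.map ℓ := ⟨_, hmem, rfl⟩
    rw [hℓH] at this
    exact this
  have h1 := ℓ.map_smul (v a)⁻¹ v
  replace h0 := h0.symm.trans h1
  rw [smul_eq_mul, eq_comm, mul_eq_zero] at h0
  change aeval (R := ℂ) (S₁ := ℂ) v p ≠ 0 at hv
  rw [hpe] at hv
  rcases h0 with h0 | h0
  · exact inv_ne_zero hva h0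
  · exact hv h0

theorem exists_inter_dom_nonempty {X : Set (PSpace m)} (hX : IsIrreducible X) :
    ∃ a, (X ∩ (pSpaceAtlas m).dom a).Nonempty := by
  obtain ⟨p, hp⟩ := hX.nonempty
  have : p ∈ ⋃ a, (pSpaceAtlas m).dom a := by rw [(pSpaceAtlas m).iUnion_dom]; trivial
  obtain ⟨a, ha⟩ := Set.mem_iUnion.1 this
  exact ⟨a, p, hp, ha⟩

/-- The dimension of `X` is the transcendence degree of the generic point of an affine part. -/
theorem topologicalKrullDim_eq_of_affinePart {X : Set (PSpace m)} (hXc : IsClosed X)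
    (hX : IsIrreducible X) {a : Fin m} (ha : (X ∩ (pSpaceAtlas m).dom a).Nonempty)
    {K : Type} [Field K] [Algebra ℂ K] {ξ : Fin m → K} (hξ : IsGeneric (affinePart X a) ξ) :
    topologicalKrullDim X = ((matroid ℂ K).eRk (Set.range ξ) : WithBot ℕ∞) := by
  -- Hence the generic point of the affine part is already its own normal form.
  have hξa : ξ a = 1 := by
    have h0 : ∀ y ∈ affinePart X a,
        aeval (R := ℂ) (S₁ := ℂ) y (MvPolynomial.X a - MvPolynomial.C 1) = 0 := by
      intro y hy
      rw [map_sub, aeval_X_point, hy.2]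
      have := aeval_C (R := ℂ) (S₁ := ℂ) y 1
      rw [this, map_one, sub_self]
    have h := (hξ (MvPolynomial.X a - MvPolynomial.C 1)).2 h0
    rw [map_sub, aeval_X, aeval_C, map_one, sub_eq_zero] at h
    exact h
  have hcl : closure (X ∩ (pSpaceAtlas m).dom a) = X := by
    apply le_antisymm
    · exact closure_minimal Set.inter_subset_left hXc
    · exact subset_closure_inter_of_isPreirreducible_of_isOpen hX.isPreirreducible
        ((pSpaceAtlas m).isOpen_dom a) ha
  have hξ' := aeval_X_eq ξ
  have hZ : ∀ z, z ∈ X ∩ (pSpaceAtlas m).dom a ↔ ∃ y ∈ affinePart X a, ∃ w,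
      (pSpaceAtlas m).q w = z ∧ (pSpaceAtlas m).ent w =
        fun i : Fin m => aeval (R := ℂ) (S₁ := ℂ) y (MvPolynomial.X i) := by
    intro z
    constructor
    · rintro ⟨hz, hza⟩
      refine ⟨(pSpaceAtlas m).ent ((pSpaceAtlas m).sect a ⟨z, hza⟩), ?_,
        (pSpaceAtlas m).sect a ⟨z, hza⟩, (pSpaceAtlas m).q_sect a ⟨z, hza⟩, aeval_X_point' _⟩
      rw [affinePart_eq]
      exact ⟨⟨z, hza⟩, hz, rfl⟩
    · rintro ⟨y, ⟨⟨w', rfl, hw'⟩, hya⟩, w, rfl, hw⟩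
      have hww : w = w' := Subtype.ext (hw.trans (aeval_X_point' _).symm)
      subst hww
      refine ⟨hw', (pSpace_mem_dom_iff a w).2 ?_⟩
      rw [hya]
      exact one_ne_zero
  have hi : aeval (fun i => aeval ξ (MvPolynomial.X (R := ℂ) i)) ((pSpaceAtlas m).g a) ≠ 0 := by
    rw [← hξ']
    change aeval ξ (MvPolynomial.X a) ≠ 0
    rw [aeval_X, hξa]
    exact one_ne_zero
  have key := (pSpaceAtlas m).topologicalKrullDim_closure (isIrreducible_affinePart hX ha) hξ
    (fun i => MvPolynomial.X i) hZ a hi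
  have hn : (pSpaceAtlas m).nrm a ξ = ξ := by
    funext i
    change aeval ξ (MvPolynomial.X i) / aeval ξ (MvPolynomial.X a) = ξ i
    rw [aeval_X, aeval_X, hξa, div_one]
  rw [hcl, ← hξ', hn] at key
  exact key

end Cone

end SubspaceRank

/-! ### Parametrisation of `σ_{r,s}(X)` and of the bundle. -/

namespace SubspaceRank

variable {r s m : ℕ}

/-- The pairs of an `r`-tuple of points of (an affine part of) `X` and an `s × r` matrix. -/
def locus (r s : ℕ) {m : ℕ} (X : Set (PSpace m)) (a : Fin m) :
    Set (AffineSp (Fin r × Fin m ⊕ Fin s × Fin r)) :=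
  {z | ∀ i, (fun b => z (Sum.inl (i, b)) : AffineSp (Fin m)) ∈ affinePart X a}

/-- The entries of the generic `r × m` matrix. -/
noncomputable def bigPoly (r s m : ℕ) (a : Fin r × Fin m) :
    MvPolynomial (Fin r × Fin m ⊕ Fin s × Fin r) ℂ := X (Sum.inl a)

/-- The entries of the product of the generic `s × r` matrix and the generic `r × m` matrix. -/
noncomputable def smallPoly (r s m : ℕ) (a : Fin s × Fin m) :
    MvPolynomial (Fin r × Fin m ⊕ Fin s × Fin r) ℂ :=
  ∑ i, X (Sum.inr (a.1, i)) * X (Sum.inl (i, a.2))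

theorem aeval_bigPoly {K : Type} [Field K] [Algebra ℂ K]
    (z : Fin r × Fin m ⊕ Fin s × Fin r → K) :
    z ∘ Sum.inl = fun a => aeval z (bigPoly r s m a) :=
  funext fun a => (aeval_X z (Sum.inl a)).symm

theorem toMat_smallPoly {K : Type} [Field K] [Algebra ℂ K]
    (z : Fin r × Fin m ⊕ Fin s × Fin r → K) :
    toMat (fun a => aeval z (smallPoly r s m a)) = toMat (z ∘ Sum.inr) * toMat (z ∘ Sum.inl) := by
  ext a b
  simp [toMat, smallPoly, Matrix.mul_apply]

theorem isClosed_locus {X : Set (PSpace m)} (hX : IsClosed X) (a : Fin m) :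
    IsClosed (locus r s X a) := by
  have : locus r s X a = ⋂ i, {z : AffineSp (Fin r × Fin m ⊕ Fin s × Fin r) |
      (fun b => z (Sum.inl (i, b)) : AffineSp (Fin m)) ∈ affinePart X a} := by
    ext z; simp [locus]
  rw [this]
  refine isClosed_iInter fun i => (isClosed_affinePart hX a).preimage ?_
  exact continuous_affineSp_of_polynomial continuous_id
    (fun b => MvPolynomial.X (Sum.inl (i, b))) fun z b => (aeval_X_point z _).symm

theorem isIrreducible_locus {X : Set (PSpace m)} (hX : IsIrreducible X) {a : Fin m}
    (ha : (X ∩ (pSpaceAtlas m).dom a).Nonempty) : IsIrreducible (locus r s X a) := by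
  have h1 := isIrreducible_image_pi_of_separately_continuous (κ := Fin r)
    (S := AffineSp (Fin r × Fin m))
    (c := fun (z : Fin r → AffineSp (Fin m)) => (fun p => z p.1 p.2 : AffineSp (Fin r × Fin m)))
    (fun z i => continuous_affineSp_of_polynomial continuous_id
      (fun p => if p.1 = i then MvPolynomial.X p.2 else C (z p.1 p.2)) fun y p => by
        dsimp only [id]
        split_ifs with h
        · rw [aeval_X_point, h, Function.update_self]
        · rw [Function.update_of_ne h]
          exact (aeval_C (R := ℂ) (S₁ := ℂ) y _).symm)
    (isIrreducible_affinePart hX ha)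
  have h2 := isIrreducible_image2_of_separately_continuous
    (S := AffineSp (Fin r × Fin m ⊕ Fin s × Fin r))
    (c := fun (x : AffineSp (Fin r × Fin m)) (t : AffineSp (Fin s × Fin r)) =>
      (Sum.elim x t : AffineSp (Fin r × Fin m ⊕ Fin s × Fin r)))
    (fun t => continuous_affineSp_of_polynomial continuous_id
      (Sum.elim (fun p => MvPolynomial.X p) fun p => C (t p)) fun y p => by
        rcases p with p | p
        · exact (aeval_X_point y p).symm
        · exact (aeval_C (R := ℂ) (S₁ := ℂ) y _).symm)
    (fun x => continuous_affineSp_of_polynomial continuous_id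
      (Sum.elim (fun p => C (x p)) fun p => MvPolynomial.X p) fun y p => by
        rcases p with p | p
        · exact (aeval_C (R := ℂ) (S₁ := ℂ) y _).symm
        · exact (aeval_X_point y p).symm)
    h1 (isIrreducible_univ_affineSp (Fin s × Fin r))
  refine (congrArg IsIrreducible (Set.Subset.antisymm ?_ ?_)).mp h2
  rotate_left
  · intro z hz
    refine ⟨z ∘ Sum.inl, ⟨fun i b => z (Sum.inl (i, b)), hz, rfl⟩, z ∘ Sum.inr, trivial, ?_⟩
    exact Sum.elim_comp_inl_inr z
  · rintro _ ⟨_, ⟨z, hz, rfl⟩, t, -, rfl⟩ i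
    exact hz i

/-- The spans of the `r`-tuples of points of an affine part of `X`. -/
def bigSet (r s : ℕ) {m : ℕ} (X : Set (PSpace m)) (a : Fin m) : Set (Gr r m) :=
  {F | ∃ z ∈ locus r s X a, ∃ w : Frame r m, w.span = F ∧
    w.entries = fun p => aeval (R := ℂ) (S₁ := ℂ) z (bigPoly r s m p)}

/-- The `s`-dimensional subspaces spanned by combinations of `r` points of an affine part of `X`. -/
def smallSet (r s : ℕ) {m : ℕ} (X : Set (PSpace m)) (a : Fin m) : Set (Gr s m) :=
  {E | ∃ z ∈ locus r s X a, ∃ w : Frame s m, w.span = E ∧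
    w.entries = fun p => aeval (R := ℂ) (S₁ := ℂ) z (smallPoly r s m p)}

/-- The pairs of the span of an `r`-tuple of points of an affine part of `X` and a subspace. -/
def pairSet (r s : ℕ) {m : ℕ} (X : Set (PSpace m)) (a : Fin m) : Set (GrPair r s m) :=
  {p | ∃ z ∈ locus r s X a, ∃ w : FramePair r s m, w.span = p ∧
    w.entries = fun p => aeval (R := ℂ) (S₁ := ℂ) z (Sum.elim (bigPoly r s m) (smallPoly r s m) p)}

theorem mem_smallSet_iff {X : Set (PSpace m)} {a : Fin m} {E : Gr s m} :
    E ∈ smallSet r s X a ↔ ∃ x : Fin r → Fin m → ℂ, (∀ i, x i ∈ affinePart X a) ∧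
      ∃ (T : Matrix (Fin s) (Fin r) ℂ) (w : Frame s m), w.span = E ∧
        Matrix.of w.1 = T * Matrix.of x := by
  constructor
  · rintro ⟨z, hz, w, hw, hwz⟩
    refine ⟨fun i b => z (Sum.inl (i, b)), hz, toMat (z ∘ Sum.inr), w, hw, ?_⟩
    have h := toMat_smallPoly (K := ℂ) z
    rw [← hwz] at h
    exact h
  · rintro ⟨x, hx, T, w, hw, hwT⟩
    let z : AffineSp (Fin r × Fin m ⊕ Fin s × Fin r) :=
      Sum.elim (fun p => x p.1 p.2) (fun p => T p.1 p.2)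
    refine ⟨z, hx, w, hw, toMat_injective (K := ℂ) ?_⟩
    have h := toMat_smallPoly (K := ℂ) z
    exact hwT.trans h.symm

theorem mem_bigSet_iff {X : Set (PSpace m)} {a : Fin m} {F : Gr r m} :
    F ∈ bigSet r s X a ↔ ∃ w : Frame r m, w.span = F ∧ ∀ i, w.1 i ∈ affinePart X a := by
  constructor
  · rintro ⟨z, hz, w, hw, hwz⟩
    refine ⟨w, hw, fun i => ?_⟩
    have h := aeval_bigPoly (K := ℂ) (s := s) z
    have h1 : w.entries = z ∘ Sum.inl := hwz.trans h.symm
    have h2 : w.1 i = fun b => z (Sum.inl (i, b)) := funext fun b => congrFun h1 (i, b)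
    rw [h2]
    exact hz i
  · rintro ⟨w, hw, h⟩
    let z : AffineSp (Fin r × Fin m ⊕ Fin s × Fin r) := Sum.elim w.entries 0
    exact ⟨z, h, w, hw, aeval_bigPoly (K := ℂ) z⟩

theorem mem_pairSet_iff {X : Set (PSpace m)} {a : Fin m} {p : GrPair r s m} :
    p ∈ pairSet r s X a ↔ ∃ w : Frame r m, w.span = p.big ∧ (∀ i, w.1 i ∈ affinePart X a) ∧
      p.small.plane ≤ p.big.plane := by
  constructor
  · rintro ⟨z, hz, w, rfl, hwz⟩
    have h := aeval_bigPoly (K := ℂ) (s := s) z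
    have h0 : w.big.entries = fun q => aeval (R := ℂ) (S₁ := ℂ) z (bigPoly r s m q) :=
      funext fun q => congrFun hwz (Sum.inl q)
    have h1 : w.big.entries = z ∘ Sum.inl := h0.trans h.symm
    have h2 : ∀ i, w.big.1 i = fun b => z (Sum.inl (i, b)) :=
      fun i => funext fun b => congrFun h1 (i, b)
    refine ⟨w.big, rfl, fun i => ?_, ?_⟩
    · rw [h2]; exact hz i
    · refine (mem_span_iff_exists_mul _ _).2 ⟨toMat (z ∘ Sum.inr), ?_⟩
      have h3 := toMat_smallPoly (K := ℂ) z
      have h4 : w.small.entries = fun q => aeval (R := ℂ) (S₁ := ℂ) z (smallPoly r s m q) :=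
        funext fun q => congrFun hwz (Sum.inr q)
      rw [← h4, ← h1] at h3
      exact h3
  · rintro ⟨w, hw, hx, hle⟩
    obtain ⟨v, hv⟩ := Frame.span_surjective p.small
    rw [← hw, ← hv] at hle
    obtain ⟨T, hT⟩ := (mem_span_iff_exists_mul _ _).1 hle
    let z : AffineSp (Fin r × Fin m ⊕ Fin s × Fin r) :=
      Sum.elim w.entries (fun p => T p.1 p.2)
    refine ⟨z, hx, ⟨w, v⟩, GrPair.ext_iff'.2 ⟨hw, hv⟩, ?_⟩
    funext q
    rcases q with q | q
    · exact congrFun (aeval_bigPoly (K := ℂ) (s := s) z) q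
    · have h3 := toMat_smallPoly (K := ℂ) z
      exact congrFun₂ (hT.trans h3.symm) q.1 q.2

/-- If `r` combinations of `r` vectors are independent, the vectors are independent and have the
same span. -/
theorem bigSet_eq_smallSet {X : Set (PSpace m)} {a : Fin m} :
    bigSet r s X a = smallSet r r X a := by
  ext F
  rw [mem_bigSet_iff, mem_smallSet_iff]
  constructor
  · rintro ⟨w, hw, h⟩
    exact ⟨w.1, h, 1, w, hw, (Matrix.one_mul _).symm⟩
  · rintro ⟨x, hx, T, w, hw, hwT⟩
    obtain ⟨I, hI⟩ := exists_minor_ne_zero (Matrix.of w.1) w.2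
    rw [hwT, mul_submatrix_id, Matrix.det_mul] at hI
    have hli := linearIndependent_of_minor_ne_zero _ (right_ne_zero_of_mul hI)
    let w' : Frame r m := ⟨x, hli⟩
    refine ⟨w', ?_, hx⟩
    rw [← hw, eq_comm]
    exact (Frame.span_eq_iff w w').2 ((mem_span_iff_exists_mul _ _).2 ⟨T, hwT⟩)

theorem line_ofVec (w : NonzeroVec m) : (PSpace.ofVec w).line = Submodule.span ℂ {w.1} :=
  Projectivization.submodule_mk _ _

theorem smallSet_subset_sigmaZero {X : Set (PSpace m)} {a : Fin m} :
    smallSet r s X a ⊆ sigmaZero r s X := by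
  intro E hE
  obtain ⟨x, hx, T, w, rfl, hwT⟩ := mem_smallSet_iff.1 hE
  choose y hy hyX using fun i => (hx i).1
  refine sInf_le (a := (r : ℕ∞)) ⟨r, rfl, fun i => PSpace.ofVec (y i), hyX, ?_⟩
  refine ((mem_span_iff_exists_mul w.1 x).2 ⟨T, hwT⟩).trans (Submodule.span_le.2 ?_)
  rintro _ ⟨i, rfl⟩
  refine (le_iSup (fun i => (PSpace.ofVec (y i)).line) i) ?_
  rw [line_ofVec]
  exact Submodule.mem_span_singleton.2 ⟨1, by rw [one_smul]; exact hy i⟩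

theorem exists_of_mem_sigmaZero {X : Set (PSpace m)} (hX : X.Nonempty) {E : Gr s m}
    (hE : E ∈ sigmaZero r s X) : ∃ x : Fin r → NonzeroVec m, (∀ i, PSpace.ofVec (x i) ∈ X) ∧
      E.plane ≤ Submodule.span ℂ (Set.range fun i => (x i).1) := by
  obtain ⟨p0, hp0⟩ := hX
  let A : Set ℕ∞ := {a : ℕ∞ | ∃ k : ℕ, a = k ∧
    ∃ x : Fin k → PSpace m, (∀ i, x i ∈ X) ∧ E.plane ≤ ⨆ i, (x i).line}
  -- Otherwise the infimum would be `⊤`, which is not at most `r`; so the infimum is attained.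
  have hA : A.Nonempty := by
    by_contra h
    rw [Set.not_nonempty_iff_eq_empty] at h
    have h1 : sInf A ≤ r := hE
    rw [h, sInf_empty] at h1
    exact absurd h1 (by simp)
  obtain ⟨k, hk, x, hx, hle⟩ := csInf_mem hA
  have hkr : k ≤ r := by
    have h1 : sInf A ≤ r := hE
    rw [hk] at h1
    exact_mod_cast h1
  -- The `k ≤ r` points are padded to exactly `r` with a fixed point of `X`.
  let x' : Fin r → PSpace m := fun i => if h : (i : ℕ) < k then x ⟨i, h⟩ else p0
  have hx' : ∀ i, x' i ∈ X := fun i => by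
    dsimp only [x']
    split_ifs with h
    · exact hx _
    · exact hp0
  choose y hy using fun i => (pSpaceAtlas m).isQuotientMap_q.surjective (x' i)
  have hy' : ∀ i, PSpace.ofVec (y i) = x' i := hy
  refine ⟨y, fun i => by rw [hy' i]; exact hx' i, hle.trans (iSup_le fun i => ?_)⟩
  have h1 : x i = x' ⟨i, i.2.trans_le hkr⟩ := by
    dsimp only [x']
    rw [dif_pos i.2]
  rw [h1, ← hy', line_ofVec, Submodule.span_singleton_le_iff_mem]
  exact Submodule.subset_span ⟨_, rfl⟩

/-- Write a frame of `E` as `T` times a tuple of cone points. With `T` fixed, each cone point can be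
approximated by one with nonzero `a` coordinate, and a minor that is nonzero at the original frame
keeps the approximation a frame. -/
theorem sigmaZero_subset_closure {X : Set (PSpace m)} (hX : IsIrreducible X) {a : Fin m}
    (ha : (X ∩ (pSpaceAtlas m).dom a).Nonempty) :
    sigmaZero r s X ⊆ closure (smallSet r s X a) := by
  intro E hE
  obtain ⟨x, hx, hle⟩ := exists_of_mem_sigmaZero hX.nonempty hE
  obtain ⟨v, rfl⟩ := Frame.span_surjective E
  obtain ⟨T, hT⟩ := (mem_span_iff_exists_mul _ _).1 hle
  rw [mem_closure_iff]
  intro O hO hvO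
  have hO1 : IsOpen (Frame.span ⁻¹' O) := (grAtlas s m).isQuotientMap_q.isOpen_preimage.2 hO
  obtain ⟨O', hO', hOO⟩ := (grAtlas s m).isInducing_ent.isOpen_iff.1 hO1
  obtain ⟨I, hI⟩ := Frame.exists_minor v
  let c : (Fin r → AffineSp (Fin m)) → AffineSp (Fin s × Fin m) :=
    fun z p => ∑ i, T p.1 i * z i p.2
  have hc : ∀ z i, Continuous fun y => c (Function.update z i y) := fun z i =>
    continuous_affineSp_of_polynomial continuous_id
      (fun p => ∑ j, C (T p.1 j) * if j = i then MvPolynomial.X p.2 else C (z j p.2)) fun y p => by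
        dsimp only [id, c]
        rw [map_sum]
        refine Finset.sum_congr rfl fun j _ => ?_
        have hC := aeval_C (R := ℂ) (S₁ := ℂ) y
        rw [map_mul, hC]
        split_ifs with h
        · rw [aeval_X_point, h, Function.update_self]; rfl
        · rw [Function.update_of_ne h, hC]; rfl
  have hcx : c (fun i => (x i).coords) = v.entries := by
    refine toMat_injective (K := ℂ) ?_
    rw [toMat_entries, hT]
    ext p q
    simp [c, toMat, Matrix.mul_apply, NonzeroVec.coords]
  have hcl := mem_closure_image_pi_of_separately_continuous hc
    (T := {v | v ∈ cone X ∧ v a ≠ 0}) (z := fun i => (x i).coords)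
    fun i => cone_subset_closure hX ha ⟨x i, rfl, hx i⟩
  rw [hcx] at hcl
  have hvO' : v.entries ∈ O' := by
    have : v ∈ (grAtlas s m).ent ⁻¹' O' := by rw [hOO]; exact hvO
    exact this
  obtain ⟨_, ⟨h1, h2⟩, z, hz, rfl⟩ := mem_closure_iff.1 hcl _
    (hO'.inter (isOpen_setOf_aeval_ne_zero (minor I))) ⟨hvO', hI⟩
  obtain ⟨w, hw⟩ := Frame.exists_entries I _ h2
  refine ⟨w.span, ?_, ?_⟩
  · have : w ∈ Frame.span ⁻¹' O := by
      rw [← hOO]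
      change w.entries ∈ O'
      rw [hw]; exact h1
    exact this
  -- Scaling each point to have `a` coordinate 1 is compensated in the columns of the coefficient
  -- matrix.
  · refine mem_smallSet_iff.2 ⟨fun i b => (z i a)⁻¹ * z i b,
      fun i => div_mem_affinePart (hz i).1 (hz i).2, Matrix.of fun j i => T j i * z i a, w, rfl, ?_⟩
    rw [← toMat_entries, hw]
    ext p q
    refine Eq.trans ?_ Matrix.mul_apply.symm
    change (∑ i, T p i * z i q : ℂ) = ∑ i, T p i * z i a * ((z i a)⁻¹ * z i q)
    refine Finset.sum_congr rfl fun i _ => ?_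
    rw [mul_assoc, mul_inv_cancel_left₀ (hz i).2]

theorem sigma_eq_closure_smallSet {X : Set (PSpace m)} (hX : IsIrreducible X) {a : Fin m}
    (ha : (X ∩ (pSpaceAtlas m).dom a).Nonempty) :
    sigma r s X = closure (smallSet r s X a) :=
  Set.Subset.antisymm (closure_minimal (sigmaZero_subset_closure hX ha) isClosed_closure)
    (closure_mono smallSet_subset_sigmaZero)

theorem sigma_eq_closure_bigSet (s : ℕ) {X : Set (PSpace m)} (hX : IsIrreducible X) {a : Fin m}
    (ha : (X ∩ (pSpaceAtlas m).dom a).Nonempty) :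
    sigma r r X = closure (bigSet r s X a) := by
  rw [bigSet_eq_smallSet, sigma_eq_closure_smallSet hX ha]

theorem FramePair.continuous_big : Continuous (FramePair.big : FramePair r s m → Frame r m) := by
  rw [(grAtlas r m).isInducing_ent.continuous_iff]
  exact continuous_affineSp_of_polynomial (grPairAtlas r s m).isInducing_ent.continuous
    (fun p => X (Sum.inl p)) fun w p => (aeval_X_point w.entries (Sum.inl p)).symm

theorem GrPair.continuous_big : Continuous (GrPair.big : GrPair r s m → Gr r m) := by
  rw [(grPairAtlas r s m).isQuotientMap_q.continuous_iff]
  exact (grAtlas r m).isQuotientMap_q.continuous.comp FramePair.continuous_big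

theorem isOpen_setOf_linearIndependent (k m : ℕ) :
    IsOpen {x : AffineSp (Fin k × Fin m) | LinearIndependent ℂ fun i b => x (i, b)} := by
  have : {x : AffineSp (Fin k × Fin m) | LinearIndependent ℂ fun i b => x (i, b)} =
      ⋃ I : Fin k → Fin m, {x | aeval (R := ℂ) (S₁ := ℂ) x (minor I) ≠ 0} := by
    ext x
    refine Iff.trans ?_ Set.mem_iUnion.symm
    constructor
    · intro h
      exact Frame.exists_minor ⟨_, h⟩
    · rintro ⟨I, hI⟩
      obtain ⟨w, rfl⟩ := Frame.exists_entries I x hI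
      exact w.2
  rw [this]
  exact isOpen_iUnion fun I => isOpen_setOf_aeval_ne_zero _

/-- A row of the small frame lies in the big space exactly when prepending it to the big frame gives
a dependent list; independence is an open condition. -/
theorem isClosed_setOf_small_le_big :
    IsClosed {p : GrPair r s m | p.small.plane ≤ p.big.plane} := by
  rw [← (grPairAtlas r s m).isQuotientMap_q.isClosed_preimage]
  have : (grPairAtlas r s m).q ⁻¹' {p : GrPair r s m | p.small.plane ≤ p.big.plane} =
      ⋂ j : Fin s, ((fun w : FramePair r s m =>
        (fun p => (Fin.cons (w.small.1 j) w.big.1 : Fin (r + 1) → Fin m → ℂ) p.1 p.2 :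
          AffineSp (Fin (r + 1) × Fin m))) ⁻¹'
          {x | LinearIndependent ℂ fun i b => x (i, b)})ᶜ := by
    ext w
    rw [Set.mem_iInter]
    have h1 : w ∈ (grPairAtlas r s m).q ⁻¹' {p : GrPair r s m | p.small.plane ≤ p.big.plane} ↔
      Submodule.span ℂ (Set.range w.small.1) ≤ Submodule.span ℂ (Set.range w.big.1) := Iff.rfl
    rw [h1, Submodule.span_le, Set.range_subset_iff]
    refine forall_congr' fun j => ?_
    have h2 : (w ∈ ((fun w : FramePair r s m =>
        (fun p => (Fin.cons (w.small.1 j) w.big.1 : Fin (r + 1) → Fin m → ℂ) p.1 p.2 :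
          AffineSp (Fin (r + 1) × Fin m))) ⁻¹'
          {x | LinearIndependent ℂ fun i b => x (i, b)})ᶜ) ↔
        ¬ LinearIndependent ℂ (Fin.cons (w.small.1 j) w.big.1 : Fin (r + 1) → Fin m → ℂ) := Iff.rfl
    rw [h2, linearIndependent_finCons, not_and, not_not]
    exact ⟨fun h _ => h, fun h => h w.big.2⟩
  rw [this]
  refine isClosed_iInter fun j => ((isOpen_setOf_linearIndependent _ _).preimage ?_).isClosed_compl
  refine continuous_affineSp_of_polynomial (grPairAtlas r s m).isInducing_ent.continuous
    (fun p => (Fin.cons (fun b => X (Sum.inr (j, b))) (fun i b => X (Sum.inl (i, b))) :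
      Fin (r + 1) → Fin m → MvPolynomial (Fin r × Fin m ⊕ Fin s × Fin m) ℂ) p.1 p.2) ?_
  rintro w ⟨i, b⟩
  refine Fin.cases ?_ (fun i => ?_) i
  · exact (aeval_X_point w.entries (Sum.inr (j, b))).symm
  · exact (aeval_X_point w.entries (Sum.inl (i, b))).symm

theorem isClosed_bundle (X : Set (PSpace m)) : IsClosed (bundle r s X) :=
  (isClosed_closure.preimage GrPair.continuous_big).inter isClosed_setOf_small_le_big

/-- Near a pair `(F, E)`, write `E` as `T` times the normalised frame of `F`. Keeping `T` fixed and
varying the big space gives a continuous local section through `(F, E)`, which carries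
approximations of `F` by spans of points to approximations of the pair. -/
theorem bundle_eq_closure_pairSet {X : Set (PSpace m)} (hX : IsIrreducible X) {a : Fin m}
    (ha : (X ∩ (pSpaceAtlas m).dom a).Nonempty) :
    bundle r s X = closure (pairSet r s X a) := by
  refine Set.Subset.antisymm ?_ (closure_minimal ?_ (isClosed_bundle X))
  · rintro p ⟨hp, hle⟩
    rw [sigma_eq_closure_bigSet s hX ha] at hp
    obtain ⟨I, hI⟩ := Set.mem_iUnion.1 ((grAtlas r m).iUnion_dom.symm.subset (Set.mem_univ p.big))
    obtain ⟨v, hv⟩ := Frame.span_surjective p.small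
    have hF : ((grAtlas r m).sect I ⟨_, hI⟩).span = p.big := (grAtlas r m).q_sect I ⟨_, hI⟩
    rw [← hv, ← hF] at hle
    obtain ⟨T, hT⟩ := (mem_span_iff_exists_mul _ _).1 hle
    -- The rows of `T` are independent, so `T` times any `r`-frame is an `s`-frame.
    have hTli : Function.Injective T.vecMul := by
      have h1 := Matrix.vecMul_injective_iff.2 (show LinearIndependent ℂ (Matrix.of v.1).row from v.2)
      rw [hT] at h1
      intro c c' hcc
      apply h1
      change Matrix.vecMul c (T * _) = Matrix.vecMul c' (T * _)
      rw [← Matrix.vecMul_vecMul, ← Matrix.vecMul_vecMul]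
      exact congrArg (fun u => Matrix.vecMul u _) hcc
    have hli : ∀ w : Frame r m, LinearIndependent ℂ (T * Matrix.of w.1).row := fun w => by
      rw [← Matrix.vecMul_injective_iff]
      have h1 := Matrix.vecMul_injective_iff.2 (show LinearIndependent ℂ (Matrix.of w.1).row from w.2)
      intro c c' hcc
      apply hTli
      apply h1
      change Matrix.vecMul (Matrix.vecMul c T) _ = Matrix.vecMul (Matrix.vecMul c' T) _
      rw [Matrix.vecMul_vecMul, Matrix.vecMul_vecMul]
      exact hcc
    let H : Frame r m → FramePair r s m := fun w => ⟨w, ⟨fun i b => (T * Matrix.of w.1) i b, hli w⟩⟩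
    have hH : Continuous H := by
      rw [(grPairAtlas r s m).isInducing_ent.continuous_iff]
      refine continuous_affineSp_of_polynomial (grAtlas r m).isInducing_ent.continuous
        (Sum.elim (fun p => MvPolynomial.X p)
          fun p => ∑ i, C (T p.1 i) * MvPolynomial.X (i, p.2)) ?_
      rintro w (q | q)
      · exact (aeval_X_point w.entries q).symm
      · have hC := aeval_C (R := ℂ) (S₁ := ℂ) w.entries
        change ∑ i, T q.1 i * w.1 i q.2 = aeval (R := ℂ) (S₁ := ℂ) w.entries (∑ i, _)
        rw [map_sum]
        refine Finset.sum_congr rfl fun i _ => ?_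
        rw [map_mul, hC, aeval_X_point]
        rfl
    let h : (grAtlas r m).dom I → GrPair r s m := fun G => (H ((grAtlas r m).sect I G)).span
    have hh : Continuous h := (grPairAtlas r s m).isQuotientMap_q.continuous.comp
      (hH.comp ((grAtlas r m).continuous_sect I))
    have hhp : h ⟨_, hI⟩ = p := by
      refine GrPair.ext_iff'.2 ⟨hF, ?_⟩
      rw [← hv]
      exact congrArg Frame.span (Subtype.ext hT.symm)
    rw [mem_closure_iff]
    intro O hO hpO
    have hO' : IsOpen (Subtype.val '' (h ⁻¹' O)) :=
      ((grAtlas r m).isOpen_dom I).isOpenMap_subtype_val _ (hO.preimage hh)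
    obtain ⟨_, ⟨G, hG, rfl⟩, hGZ⟩ := mem_closure_iff.1 hp _ hO'
      ⟨⟨_, hI⟩, by rw [Set.mem_preimage, hhp]; exact hpO, rfl⟩
    obtain ⟨w, hw, hwX⟩ := mem_bigSet_iff.1 hGZ
    have hbig : (h G).big = G.1 := (grAtlas r m).q_sect I G
    refine ⟨h G, hG, mem_pairSet_iff.2 ⟨w, hw.trans hbig.symm, hwX, ?_⟩⟩
    exact (mem_span_iff_exists_mul _ _).2 ⟨T, rfl⟩
  · intro p hp
    obtain ⟨w, hw, hx, hle⟩ := mem_pairSet_iff.1 hp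
    refine ⟨?_, hle⟩
    rw [sigma_eq_closure_bigSet s hX ha]
    exact subset_closure (mem_bigSet_iff.2 ⟨w, hw, hx⟩)

end SubspaceRank

/-! ### Derivations and transcendence degree in characteristic zero. -/

section Derivations

variable {k K : Type*} [Field k] [CharZero k] [Field K] [Algebra k K]

open scoped IntermediateField.algebraAdjoinAdjoin in
-- The map factors through the isomorphism onto the subalgebra generated by `t`, its localisation to
-- the generated field, and an algebraic extension that is separable in characteristic zero; each
-- step is formally étale.
theorem formallyEtale_of_isTranscendenceBasis {κ : Type*} {t : κ → K}
    (ht : IsTranscendenceBasis k t) [Algebra (MvPolynomial κ k) K]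
    (h : algebraMap (MvPolynomial κ k) K = (aeval t : MvPolynomial κ k →ₐ[k] K).toRingHom) :
    Algebra.FormallyEtale (MvPolynomial κ k) K := by
  let A := MvPolynomial κ k
  let B := Algebra.adjoin k (Set.range t)
  let F := IntermediateField.adjoin k (Set.range t)
  let e : A ≃ₐ[k] B := ht.1.aevalEquiv
  let : Algebra A B := e.toAlgHom.toRingHom.toAlgebra
  have : IsScalarTower A B K := .of_algebraMap_eq fun x => by
    rw [h]; exact (ht.1.algebraMap_aevalEquiv x).symm
  have : Algebra.FormallyEtale B F := .of_isLocalization (nonZeroDivisors _)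
  have : Algebra.IsAlgebraic F K := ht.isAlgebraic_field
  have : Algebra.FormallyEtale F K := Algebra.FormallyEtale.of_isSeparable _ _
  have : Algebra.FormallyEtale B K := .comp _ F _
  have : Algebra.FormallyEtale A B := by
    let e' : A ≃ₐ[A] B := AlgEquiv.ofRingEquiv (f := e.toRingEquiv) fun x => rfl
    exact Algebra.FormallyEtale.of_equiv e'
  exact .comp _ B _

/-- Derivations of an extension of a field of characteristic zero can be prescribed on a
transcendence basis. -/
theorem exists_derivation_of_isTranscendenceBasis {κ : Type*} {t : κ → K}
    (ht : IsTranscendenceBasis k t) :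
    ∃ L : (κ → K) →ₗ[K] Derivation k K K, ∀ c i, L c (t i) = c i := by
  let : Algebra (MvPolynomial κ k) K := (aeval t : MvPolynomial κ k →ₐ[k] K).toRingHom.toAlgebra
  have hmap : algebraMap (MvPolynomial κ k) K = (aeval t : MvPolynomial κ k →ₐ[k] K).toRingHom := rfl
  have : IsScalarTower k (MvPolynomial κ k) K := .of_algebraMap_eq fun x => by
    rw [hmap]; exact ((aeval t : MvPolynomial κ k →ₐ[k] K).commutes x).symm
  have := formallyEtale_of_isTranscendenceBasis ht hmap
  let b := (KaehlerDifferential.isBaseChange_of_formallyEtale k (MvPolynomial κ k) K).basis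
    (KaehlerDifferential.mvPolynomialBasis k κ)
  have hb : ∀ i, b i = KaehlerDifferential.D k K (t i) := fun i => by
    rw [IsBaseChange.basis_apply, KaehlerDifferential.mvPolynomialBasis_apply,
      KaehlerDifferential.map_D, hmap]
    congr 1
    exact aeval_X t i
  refine ⟨(KaehlerDifferential.linearMapEquivDerivation k K).toLinearMap ∘ₗ
    (b.constr K).toLinearMap, fun c i => ?_⟩
  change (b.constr K c) (KaehlerDifferential.D k K (t i)) = c i
  rw [← hb, Module.Basis.constr_basis]

/-- Take a nonzero annihilating polynomial of least degree. Its derivative has smaller degree and is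
nonzero in characteristic zero. -/
theorem exists_eval₂_derivative_ne_zero {A L : Type*} [CommRing A] [Field L] [CharZero L]
    {φ : A →+* L} (hφ : Function.Injective φ) {x : L}
    (hx : ∃ p : Polynomial A, p ≠ 0 ∧ p.eval₂ φ x = 0) :
    ∃ p : Polynomial A, p.eval₂ φ x = 0 ∧ (Polynomial.derivative p).eval₂ φ x ≠ 0 := by
  have : IsDomain A := hφ.isDomain φ
  have : CharZero A := ⟨fun a b h => by
    have := congrArg φ h
    rw [map_natCast, map_natCast] at this
    exact_mod_cast this⟩
  have hex : ∃ n, ∃ p : Polynomial A, p ≠ 0 ∧ p.eval₂ φ x = 0 ∧ p.natDegree = n := by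
    obtain ⟨p, hp, hpx⟩ := hx
    exact ⟨_, p, hp, hpx, rfl⟩
  classical
  obtain ⟨p, hp, hpx, hn⟩ := Nat.find_spec hex
  refine ⟨p, hpx, fun h0 => ?_⟩
  have hpos : p.natDegree ≠ 0 := by
    intro h0
    obtain ⟨c, rfl⟩ := Polynomial.natDegree_eq_zero.1 h0
    rw [Polynomial.eval₂_C] at hpx
    apply hp
    rw [(map_eq_zero_iff φ hφ).1 hpx, map_zero]
  have hlt := Polynomial.natDegree_derivative_lt hpos
  rw [hn] at hlt
  exact Nat.find_min hex hlt ⟨_, fun h => hpos (Polynomial.derivative_eq_zero.1 h), h0, rfl⟩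

theorem Derivation.map_eval₂ {k A R : Type*} [CommRing k] [CommRing A] [CommRing R] [Algebra k R]
    (D : Derivation k R R) (ρ : A →+* R) (hρ : ∀ a, D (ρ a) = 0) (x : R) (p : Polynomial A) :
    D (p.eval₂ ρ x) = (Polynomial.derivative p).eval₂ ρ x * D x := by
  induction p using Polynomial.induction_on' with
  | add p q hp hq => rw [Polynomial.eval₂_add, map_add, hp, hq, Polynomial.derivative_add,
      Polynomial.eval₂_add, add_mul]
  | monomial n a =>
    rw [Polynomial.eval₂_monomial, D.leibniz, D.leibniz_pow, Polynomial.derivative_monomial,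
      Polynomial.eval₂_monomial, hρ, smul_zero, add_zero, map_mul, _root_.map_natCast, smul_eq_mul,
      nsmul_eq_mul, smul_eq_mul]
    ring

/-- A derivation that vanishes on a set vanishes on all elements that are algebraic over it. -/
theorem Derivation.eq_zero_of_mem_matroid_closure (D : Derivation k K K) {s : Set K}
    (hs : ∀ x ∈ s, D x = 0) {x : K} (hx : x ∈ (matroid k K).closure s) : D x = 0 := by
  rw [AlgebraicIndependent.matroid_closure_eq] at hx
  obtain ⟨p, hp, hpx⟩ : IsAlgebraic (Algebra.adjoin k s) x := hx
  have hA : ∀ y ∈ Algebra.adjoin k s, D y = 0 := fun y hy => by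
    induction hy using Algebra.adjoin_induction with
    | mem x hx => exact hs x hx
    | algebraMap r => exact D.map_algebraMap r
    | add x y _ _ hx hy => rw [map_add, hx, hy, add_zero]
    | mul x y _ _ hx hy => rw [D.leibniz, hx, hy, smul_zero, smul_zero, add_zero]
  have : CharZero K := charZero_of_injective_algebraMap (algebraMap k K).injective
  obtain ⟨q, hq, hq'⟩ := exists_eval₂_derivative_ne_zero
    (φ := algebraMap (Algebra.adjoin k s) K) Subtype.val_injective ⟨p, hp, hpx⟩
  have h := D.map_eval₂ (algebraMap (Algebra.adjoin k s) K) (fun a => hA _ a.2) x q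
  rw [hq, map_zero] at h
  exact (mul_eq_zero.1 h.symm).resolve_left hq'

/-- The transcendence degree grows at most by the dimension of a space of derivations. -/
theorem eRank_le_eRk_add_finrank {W : Type*} [AddCommGroup W] [Module K W] [FiniteDimensional K W]
    (T : Set K) (Φ : Derivation k K K →ₗ[K] W) (U : Submodule K W)
    (hU : ∀ D : Derivation k K K, (∀ x ∈ T, D x = 0) → Φ D ∈ U)
    (hΦ : ∀ D : Derivation k K K, (∀ x ∈ T, D x = 0) → Φ D = 0 → D = 0) :
    (matroid k K).eRank ≤ (matroid k K).eRk T + Module.finrank K U := by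
  obtain ⟨b, hb⟩ := (matroid k K).exists_isBasis T
  obtain ⟨B, hB, hbB⟩ := hb.indep.exists_isBase_superset
  have hBt := AlgebraicIndependent.matroid_isBase_iff.1 hB
  obtain ⟨L, hL⟩ := exists_derivation_of_isTranscendenceBasis hBt
  classical
  -- Extending by zero on `b` gives derivations that kill `T` and take arbitrary values on `B \ b`.
  -- Embedding them into `U` by `Φ` bounds the number of added basis elements, and shows that it is
  -- finite.
  let E : (↥(B \ b) → K) →ₗ[K] (B → K) :=
    { toFun := fun c x => if h : (x : K) ∈ b then 0 else c ⟨x, x.2, h⟩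
      map_add' := fun c c' => by ext x; by_cases h : (x : K) ∈ b <;> simp [h]
      map_smul' := fun a c => by ext x; by_cases h : (x : K) ∈ b <;> simp [h] }
  have hvan : ∀ c, ∀ x ∈ T, L (E c) x = 0 := fun c x hx => by
    refine (L (E c)).eq_zero_of_mem_matroid_closure (s := b) (fun y hy => ?_)
      (hb.subset_closure hx)
    refine (hL (E c) ⟨y, hbB hy⟩).trans ?_
    exact dif_pos hy
  let F : (↥(B \ b) → K) →ₗ[K] U :=
    ((Φ ∘ₗ L ∘ₗ E)).codRestrict U fun c => hU _ (hvan c)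
  have hF : Function.Injective F := by
    rw [injective_iff_map_eq_zero]
    intro c hc
    have h0 : L (E c) = 0 := hΦ _ (hvan c) (congrArg Subtype.val hc)
    funext x
    have h1 := hL (E c) ⟨x, x.2.1⟩
    rw [h0] at h1
    have h2 : E c ⟨x, x.2.1⟩ = c x := dif_neg x.2.2
    rw [← h2, ← h1]
    rfl
  have hfin : FiniteDimensional K (↥(B \ b) → K) := FiniteDimensional.of_injective F hF
  have hfin' : Finite ↥(B \ b) := (Pi.linearIndependent_single_one ↥(B \ b) K).finite
  have : Fintype ↥(B \ b) := Fintype.ofFinite _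
  have hle := LinearMap.finrank_le_finrank_of_injective hF
  rw [Module.finrank_pi, ← Nat.card_eq_fintype_card] at hle
  rw [← hB.encard_eq_eRank, ← Set.union_sdiff_cancel hbB, ← hb.encard_eq_eRk]
  refine (Set.encard_union_le _ _).trans (add_le_add le_rfl ?_)
  rw [← ENat.card_coe_set_eq, ENat.card_eq_coe_natCard]
  exact_mod_cast hle

end Derivations

/-! ### Semicontinuity of kernels and tangent spaces. -/

namespace SubspaceRank

section PolyKer

variable {α κ : Type} {r : ℕ} {L : Type} [Field L] [Algebra ℂ L]

/-- The common kernel of a family of linear forms whose coefficients are polynomials. -/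
noncomputable def polyKer (q : α → Fin r → MvPolynomial κ ℂ) (z : κ → L) : Submodule L (Fin r → L) where
  carrier := {c | ∀ k, ∑ l, aeval z (q k l) * c l = 0}
  zero_mem' := fun k => by simp
  add_mem' := fun {c d} hc hd k => by
    simp only [Pi.add_apply, mul_add, Finset.sum_add_distrib, hc k, hd k, add_zero]
  smul_mem' := fun a c hc k => by
    have := hc k
    simp only [Pi.smul_apply, smul_eq_mul, mul_left_comm _ a, ← Finset.mul_sum, this, mul_zero]

theorem mem_polyKer {q : α → Fin r → MvPolynomial κ ℂ} {z : κ → L} {c : Fin r → L} :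
    c ∈ polyKer q z ↔ ∀ k, ∑ l, aeval z (q k l) * c l = 0 := Iff.rfl

/-- The dimension of the kernel is smallest at the generic point. -/
theorem finrank_polyKer_le (q : α → Fin r → MvPolynomial κ ℂ) {Y : Set (AffineSp κ)} {ξ : κ → L}
    (hξ : IsGeneric Y ξ) {z : AffineSp κ} (hz : z ∈ Y) :
    Module.finrank L (polyKer q ξ) ≤ Module.finrank ℂ (polyKer (L := ℂ) q z) := by
  let row : α → Fin r → ℂ := fun k l => aeval (R := ℂ) (S₁ := ℂ) z (q k l)
  obtain ⟨e, f, hf, hspan, hli⟩ : ∃ (e : ℕ) (f : Fin e → Fin r → ℂ), (∀ i, f i ∈ Set.range row) ∧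
      Submodule.span ℂ (Set.range f) = Submodule.span ℂ (Set.range row) ∧ LinearIndependent ℂ f :=
    ⟨_, Submodule.exists_fun_fin_finrank_span_eq ℂ (Set.range row)⟩
  choose S hS using hf
  let Q : Matrix (Fin e) (Fin r) (MvPolynomial κ ℂ) := Matrix.of fun a l => q (S a) l
  have hrow : (Q.map (aeval (R := ℂ) (S₁ := ℂ) z) : Matrix (Fin e) (Fin r) ℂ) = Matrix.of f := by
    ext a l
    exact congrFun (hS a) l
  have hrank : (Matrix.of f).rank = e := by
    simpa using LinearIndependent.rank_matrix (M := Matrix.of f) hli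
  have hker : LinearMap.ker (Matrix.of f).mulVecLin ≤ polyKer (L := ℂ) q z := by
    intro c hc k
    have h1 : ∀ v ∈ Submodule.span ℂ (Set.range f), v ⬝ᵥ c = 0 := by
      intro v hv
      induction hv using Submodule.span_induction with
      | mem v hv =>
        obtain ⟨a, rfl⟩ := hv
        exact congrFun (LinearMap.mem_ker.1 hc) a
      | zero => exact zero_dotProduct c
      | add v w _ _ hv hw => rw [add_dotProduct, hv, hw, add_zero]
      | smul a v _ hv => rw [smul_dotProduct, hv, smul_zero]
    rw [hspan] at h1
    exact h1 (row k) (Submodule.subset_span ⟨k, rfl⟩)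
  have hle1 := Submodule.finrank_mono hker
  have hdim := (Matrix.of f).mulVecLin.finrank_range_add_finrank_ker
  -- A maximal minor nonzero at the special point is nonzero at the generic point, so the rank there
  -- is at least `e`.
  obtain ⟨I, hI⟩ := exists_minor_ne_zero (Matrix.of f) hli
  have hdet : aeval ξ (Q.submatrix id I).det ≠ 0 := by
    intro h0
    have h1 := (hξ _).1 h0 z hz
    rw [AlgHom.map_det] at h1
    apply hI
    rw [← hrow]
    exact h1
  have hξI : ((Q.map (aeval ξ)).submatrix id I).det ≠ 0 := by
    rw [AlgHom.map_det] at hdet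
    exact hdet
  have hli' := linearIndependent_of_minor_ne_zero _ hξI
  have hrank' : (Q.map (aeval ξ)).rank = e := by simpa using hli'.rank_matrix
  have hker' : polyKer q ξ ≤ LinearMap.ker (Q.map (aeval ξ)).mulVecLin := by
    intro c hc
    rw [LinearMap.mem_ker]
    funext a
    exact hc (S a)
  have hle2 := Submodule.finrank_mono hker'
  have hdim' := (Q.map (aeval ξ)).mulVecLin.finrank_range_add_finrank_ker
  rw [Module.finrank_fin_fun] at hdim hdim'
  change (Matrix.of f).rank + _ = _ at hdim
  change (Q.map (aeval ξ)).rank + _ = _ at hdim'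
  omega

end PolyKer

section Tangent

variable {m : ℕ}

/-- The polynomials that vanish on `Y`. -/
def Vanishing {ι : Type} (Y : Set (AffineSp ι)) : Type :=
  {f : MvPolynomial ι ℂ // ∀ y ∈ Y, aeval (R := ℂ) (S₁ := ℂ) y f = 0}

/-- The equations of the tangent spaces of `Y`. -/
noncomputable def tangentEq (Y : Set (AffineSp (Fin m))) (f : Vanishing Y) (b : Fin m) :
    MvPolynomial (Fin m) ℂ := pderiv b f.1

/-- An equation of minimal degree for `ξ c` over the coordinates in `B`, lifted to a polynomial in
the variables `B` and `c` only. Such equations, one for each `c ∉ B`, have a diagonal Jacobian in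
the variables outside `B`. -/
theorem exists_pderiv_ne_zero {ι K : Type} [Field K] [Algebra ℂ K] {ξ : ι → K} {B : Set ι}
    (hB : AlgebraicIndependent ℂ fun b : B => ξ b) {c : ι} (hc : c ∉ B)
    (hξc : ξ c ∈ (matroid ℂ K).closure (ξ '' B)) :
    ∃ f : MvPolynomial ι ℂ, aeval ξ f = 0 ∧ aeval ξ (pderiv c f) ≠ 0 ∧
      ∀ d ∉ B, d ≠ c → pderiv d f = 0 := by
  rw [AlgebraicIndependent.matroid_closure_eq, Set.image_eq_range] at hξc
  obtain ⟨p₀, hp₀, hp₀c⟩ :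
    IsAlgebraic (Algebra.adjoin ℂ (Set.range fun b : B => ξ b)) (ξ c) := hξc
  let φ : MvPolynomial B ℂ →+* K := (aeval fun b : B => ξ b : MvPolynomial B ℂ →ₐ[ℂ] K).toRingHom
  let e := hB.aevalEquiv
  have he : φ.comp (e.symm : _ →+* MvPolynomial B ℂ) =
      algebraMap (Algebra.adjoin ℂ (Set.range fun b : B => ξ b)) K := by
    ext x
    obtain ⟨y, rfl⟩ := e.surjective x
    have h1 : e.symm (e y) = y := e.symm_apply_apply y
    change φ (e.symm (e y)) = _
    rw [h1]
    exact (hB.algebraMap_aevalEquiv y).symm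
  have : CharZero K := charZero_of_injective_algebraMap (algebraMap ℂ K).injective
  obtain ⟨p, hp, hp'⟩ := exists_eval₂_derivative_ne_zero (φ := φ) hB (x := ξ c)
    ⟨p₀.map (e.symm : _ →+* MvPolynomial B ℂ),
      (Polynomial.map_ne_zero_iff e.symm.injective).2 hp₀, by
        rw [Polynomial.eval₂_map, he]; exact hp₀c⟩
  let ρ : MvPolynomial B ℂ →+* MvPolynomial ι ℂ :=
    (rename Subtype.val : MvPolynomial B ℂ →ₐ[ℂ] MvPolynomial ι ℂ).toRingHom
  have hρ : (aeval ξ : MvPolynomial ι ℂ →ₐ[ℂ] K).toRingHom.comp ρ = φ := by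
    ext x
    · simp [ρ, φ]
    · simp [ρ, φ]
  have hev : ∀ q : Polynomial (MvPolynomial B ℂ), aeval ξ (q.eval₂ ρ (X c)) = q.eval₂ φ (ξ c) := by
    intro q
    have h := Polynomial.hom_eval₂ q ρ (aeval ξ : MvPolynomial ι ℂ →ₐ[ℂ] K).toRingHom (X c)
    rw [hρ] at h
    refine h.trans ?_
    congr 1
    exact aeval_X ξ c
  have hder : ∀ d ∉ B, ∀ a, pderiv d (ρ a) = 0 := by
    intro d hd a
    classical
    refine pderiv_eq_zero_of_notMem_vars fun h => ?_
    obtain ⟨b, -, rfl⟩ := mem_vars_rename _ _ h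
    exact hd b.2
  refine ⟨p.eval₂ ρ (X c), (hev p).trans hp, ?_, fun d hd hdc => ?_⟩
  · rw [Derivation.map_eval₂ _ _ (hder c hc), pderiv_X_self, mul_one, hev]
    exact hp'
  · rw [Derivation.map_eval₂ _ _ (hder d hd), pderiv_X_of_ne (Ne.symm hdc), mul_zero]

theorem exists_coordinate_basis {ι K : Type} [Finite ι] [Field K] [Algebra ℂ K] (ξ : ι → K) :
    ∃ B : Set ι, (AlgebraicIndependent ℂ fun b : B => ξ b) ∧
      (∀ c, ξ c ∈ (matroid ℂ K).closure (ξ '' B)) ∧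
      (matroid ℂ K).eRk (Set.range ξ) = B.encard := by
  obtain ⟨b, hb⟩ := (matroid ℂ K).exists_isBasis (Set.range ξ)
  have hsurj : Set.SurjOn ξ Set.univ b := by
    rw [Set.SurjOn, Set.image_univ]; exact hb.subset
  obtain ⟨B, -, hB⟩ := Set.surjOn_iff_exists_bijOn_subset.1 hsurj
  refine ⟨B, ?_, fun c => ?_, ?_⟩
  · have h1 := AlgebraicIndependent.matroid_indep_iff.1 hb.indep
    exact h1.comp (fun x : B => ⟨ξ x, hB.mapsTo x.2⟩) fun x y h =>
      Subtype.ext (hB.injOn x.2 y.2 (congrArg Subtype.val h))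
  · rw [hB.image_eq]
    exact hb.subset_closure ⟨c, rfl⟩
  · rw [← hb.encard_eq_eRk, ← hB.image_eq, hB.injOn.encard_image]

/-- Some point of `Y` has a tangent space of dimension at most the dimension of `Y`. -/
theorem exists_finrank_tangent_le {K : Type} [Field K] [Algebra ℂ K] {Y : Set (AffineSp (Fin m))}
    {ξ : Fin m → K} (hξ : IsGeneric Y ξ) {n : ℕ}
    (hn : (matroid ℂ K).eRk (Set.range ξ) = n) :
    ∃ y ∈ Y, Module.finrank ℂ (polyKer (L := ℂ) (tangentEq Y) y) ≤ n := by
  obtain ⟨B, hB, hcl, hcard⟩ := exists_coordinate_basis ξ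
  have hex : ∀ c, ∃ f : MvPolynomial (Fin m) ℂ, c ∉ B → aeval ξ f = 0 ∧ aeval ξ (pderiv c f) ≠ 0 ∧
      ∀ d ∉ B, d ≠ c → pderiv d f = 0 := fun c => by
    by_cases hc : c ∈ B
    · exact ⟨0, fun h => absurd hc h⟩
    · obtain ⟨f, hf⟩ := exists_pderiv_ne_zero hB hc (hcl c)
      exact ⟨f, fun _ => hf⟩
  choose f hf using hex
  classical
  -- The product of the diagonal Jacobian entries. Where it is nonzero, the equations determine a
  -- tangent vector from its `B` coordinates, of which there are `n`.
  let g : MvPolynomial (Fin m) ℂ := ∏ c with c ∉ B, pderiv c (f c)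
  have hg : aeval ξ g ≠ 0 := by
    rw [map_prod, Finset.prod_ne_zero_iff]
    intro c hc
    exact (hf c (Finset.mem_filter.1 hc).2).2.1
  rw [Ne, hξ g] at hg
  push Not at hg
  obtain ⟨y, hy, hgy⟩ := hg
  refine ⟨y, hy, ?_⟩
  rw [map_prod, Finset.prod_ne_zero_iff] at hgy
  let R : polyKer (L := ℂ) (tangentEq Y) y →ₗ[ℂ] (B → ℂ) :=
    (LinearMap.funLeft ℂ ℂ Subtype.val) ∘ₗ (polyKer (L := ℂ) (tangentEq Y) y).subtype
  have hR : Function.Injective R := by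
    rw [injective_iff_map_eq_zero]
    rintro ⟨v, hv⟩ h
    have hvB : ∀ b ∈ B, v b = 0 := fun b hb => congrFun h ⟨b, hb⟩
    refine Subtype.ext (funext fun c => ?_)
    change v c = 0
    by_cases hc : c ∈ B
    · exact hvB c hc
    · obtain ⟨h1, h2, h3⟩ := hf c hc
      have h4 := hv ⟨f c, (hξ _).1 h1⟩
      rw [Finset.sum_eq_single c] at h4
      · exact (mul_eq_zero.1 h4).resolve_left (hgy c (by simp [hc]))
      · intro d _ hdc
        by_cases hd : d ∈ B
        · rw [hvB d hd, mul_zero]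
        · change aeval (R := ℂ) (S₁ := ℂ) y (pderiv d (f c)) * _ = 0
          rw [h3 d hd hdc, map_zero, zero_mul]
      · simp
  have hle := LinearMap.finrank_le_finrank_of_injective hR
  rw [Module.finrank_pi, ← Nat.card_eq_fintype_card] at hle
  rw [hn, ← ENat.card_coe_set_eq, ENat.card_eq_coe_natCard] at hcard
  have : n = Nat.card B := by exact_mod_cast hcard
  omega

end Tangent

end SubspaceRank

theorem Derivation.map_aeval_mvPolynomial {k R ι : Type*} [Fintype ι] [CommRing k] [CommRing R]
    [Algebra k R] (D : Derivation k R R) (x : ι → R) (f : MvPolynomial ι k) :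
    D (aeval x f) = ∑ b, aeval x (pderiv b f) * D (x b) := by
  induction f using MvPolynomial.induction_on with
  | C c => simp
  | add p q hp hq => simp only [map_add, hp, hq, add_mul, Finset.sum_add_distrib]
  | mul_X p a hp =>
    classical
    simp only [map_mul, aeval_X, Derivation.leibniz, hp, pderiv_X, map_add, smul_eq_mul, add_mul,
      Finset.sum_add_distrib, Finset.mul_sum]
    congr 1
    · rw [Finset.sum_eq_single a]
      · simp
      · intro b _ hb
        simp [Pi.single_eq_of_ne (Ne.symm hb)]
      · simp
    · exact Finset.sum_congr rfl fun b _ => by ring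

/-- In a spanning set one finds an `r`-tuple, with one prescribed member, that is as independent as
possible modulo a given subspace. -/
theorem exists_finrank_ker_linearCombination_le {k V : Type*} [Field k] [AddCommGroup V]
    [Module k V] [FiniteDimensional k V] {S : Set V} (hS : Submodule.span k S = ⊤)
    {Θ : Submodule k V} {v : V} (hv : v ∈ S) (hvΘ : v ∉ Θ) {r : ℕ} (i : Fin r) :
    ∃ x : Fin r → V, (∀ l, x l ∈ S) ∧ x i = v ∧
      Module.finrank k (LinearMap.ker (Θ.mkQ ∘ₗ Fintype.linearCombination k x)) ≤
        r - (Module.finrank k V - Module.finrank k Θ) := by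
  have hv0 : Θ.mkQ v ≠ 0 := by simpa using hvΘ
  have hspan : Submodule.span k (Θ.mkQ '' S) = ⊤ := by
    rw [Submodule.span_image, hS, Submodule.map_top, Submodule.range_mkQ]
  -- A basis of the quotient by `Θ`, drawn from `S` and containing the class of `v`.
  obtain ⟨b, hbS, hvb, hSb, hli⟩ := exists_linearIndepOn_id_extension
    (K := k) (s := {Θ.mkQ v}) (t := Θ.mkQ '' S) ((linearIndepOn_singleton_iff (R := k)).2 hv0)
    (by rintro _ rfl; exact ⟨v, hv, rfl⟩)
  have hbtop : Submodule.span k b = ⊤ := by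
    rw [eq_top_iff, ← hspan]; exact Submodule.span_le.2 hSb
  have hfin : Finite b := hli.linearIndependent.finite
  have : Fintype b := Fintype.ofFinite _
  let v' : b := ⟨Θ.mkQ v, hvb rfl⟩
  -- For small `r` the classes can be distinct basis elements and the kernel is zero; for large `r`
  -- they can exhaust the basis and the kernel has the expected dimension. A transposition then puts
  -- `v` at index `i`.
  obtain ⟨g, hg, hgi⟩ : ∃ g : Fin r → b, (Function.Injective g ∨ Function.Surjective g) ∧
      g i = v' := by
    classical
    obtain ⟨g, hg⟩ : ∃ g : Fin r → b, Function.Injective g ∨ Function.Surjective g := by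
      rcases le_total r (Fintype.card b) with h | h
      · obtain ⟨g⟩ := Function.Embedding.nonempty_of_card_le
          (show Fintype.card (Fin r) ≤ Fintype.card b by simpa using h)
        exact ⟨g, .inl g.injective⟩
      · obtain ⟨g⟩ := Function.Embedding.nonempty_of_card_le
          (show Fintype.card b ≤ Fintype.card (Fin r) by simpa using h)
        have : Nonempty b := ⟨v'⟩
        exact ⟨Function.invFun g, .inr (Function.invFun_surjective g.injective)⟩
    refine ⟨Equiv.swap (g i) v' ∘ g, ?_, by simp⟩
    exact hg.imp (fun h => (Equiv.injective _).comp h) fun h => (Equiv.surjective _).comp h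
  have hx : ∀ l, ∃ y ∈ S, Θ.mkQ y = g l ∧ (l = i → y = v) := by
    intro l
    by_cases h : l = i
    · exact ⟨v, hv, by rw [h, hgi], fun _ => rfl⟩
    · obtain ⟨y, hy, hyl⟩ := hbS (g l).2
      exact ⟨y, hy, hyl, fun h' => absurd h' h⟩
  choose x hxS hxg hxi using hx
  refine ⟨x, hxS, hxi i rfl, ?_⟩
  have hF : Θ.mkQ ∘ₗ Fintype.linearCombination k x =
      Fintype.linearCombination k fun l => (g l : V ⧸ Θ) := by
    ext l
    simp [Fintype.linearCombination_apply, ← hxg]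
  rw [hF]
  set F := Fintype.linearCombination k fun l => (g l : V ⧸ Θ) with hFdef
  have hdim := F.finrank_range_add_finrank_ker
  rw [Module.finrank_fin_fun] at hdim
  rcases hg with hg | hg
  · have hli' : LinearIndependent k fun l => (g l : V ⧸ Θ) := hli.linearIndependent.comp g hg
    have : LinearMap.ker F = ⊥ := by
      rw [LinearMap.ker_eq_bot]
      exact hli'.fintypeLinearCombination_injective
    rw [this, finrank_bot]
    exact Nat.zero_le _
  · have : LinearMap.range F = ⊤ := by
      rw [Fintype.range_linearCombination, ← hbtop]
      congr 1
      ext w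
      constructor
      · rintro ⟨l, rfl⟩; exact (g l).2
      · intro hw
        obtain ⟨l, hl⟩ := hg ⟨w, hw⟩
        exact ⟨l, congrArg Subtype.val hl⟩
    rw [this, finrank_top] at hdim
    have := Θ.finrank_quotient_add_finrank
    omega

/-! ### Combinations of generic points of `X` that are tangent to `X`. -/

namespace SubspaceRank

variable {r s m : ℕ}

/-- The equations for the linear combinations of the rows of the generic `r × m` matrix that are
tangent to `Y` at the row `i`. -/
noncomputable def combEq (s : ℕ) (Y : Set (AffineSp (Fin m))) (i : Fin r) (f : Vanishing Y)
    (l : Fin r) : MvPolynomial (Fin r × Fin m ⊕ Fin s × Fin r) ℂ :=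
  ∑ b, rename (fun b => Sum.inl (i, b)) (tangentEq Y f b) * X (Sum.inl (l, b))

theorem mem_polyKer_combEq {K : Type} [Field K] [Algebra ℂ K] {Y : Set (AffineSp (Fin m))}
    {i : Fin r} {z : Fin r × Fin m ⊕ Fin s × Fin r → K} {c : Fin r → K} :
    c ∈ polyKer (combEq s Y i) z ↔
      Matrix.vecMul c (toMat (z ∘ Sum.inl)) ∈ polyKer (tangentEq Y) fun b => z (Sum.inl (i, b)) := by
  rw [mem_polyKer, mem_polyKer]
  refine forall_congr' fun f => ?_
  have h1 : ∀ b, aeval z (rename (fun b => Sum.inl (i, b)) (tangentEq Y f b)) =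
      aeval (fun b => z (Sum.inl (i, b))) (tangentEq Y f b) := fun b => by
    rw [aeval_rename]; rfl
  have h2 : ∀ l, aeval z (combEq s Y i f l) =
      ∑ b, aeval (fun b => z (Sum.inl (i, b))) (tangentEq Y f b) * z (Sum.inl (l, b)) := fun l => by
    rw [combEq, map_sum]
    exact Finset.sum_congr rfl fun b _ => by rw [map_mul, h1, aeval_X]
  have h3 : ∀ b, Matrix.vecMul c (toMat (z ∘ Sum.inl)) b = ∑ l, c l * z (Sum.inl (l, b)) :=
    fun b => rfl
  simp only [h2, h3, Finset.sum_mul, Finset.mul_sum]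
  rw [Finset.sum_comm]
  simp only [mul_assoc, mul_comm (c _)]

/-- The dimension of the space of combinations of the rows of the generic matrix of points of `Y`
that are tangent to `Y` at the row `i`. -/
theorem finrank_polyKer_combEq_le {X : Set (PSpace m)} (hX : IsIrreducible X)
    (hXn : Nondegenerate X) {a : Fin m} (ha : (X ∩ (pSpaceAtlas m).dom a).Nonempty)
    {K' : Type} [Field K'] [Algebra ℂ K'] {ξ : Fin m → K'} (hξ : IsGeneric (affinePart X a) ξ)
    {n : ℕ} (hn : (matroid ℂ K').eRk (Set.range ξ) = n)
    {K : Type} [Field K] [Algebra ℂ K] {z : Fin r × Fin m ⊕ Fin s × Fin r → K}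
    (hz : IsGeneric (locus r s X a) z) (i : Fin r) :
    Module.finrank K (polyKer (combEq s (affinePart X a) i) z) ≤ r - (m - n) := by
  obtain ⟨y, hy, hyn⟩ := exists_finrank_tangent_le hξ hn
  -- Since `X a - 1` vanishes on the affine part, tangent vectors have `a` coordinate 0, whereas `y
  -- a = 1`.
  have hya : y ∉ (polyKer (L := ℂ) (tangentEq (affinePart X a)) y : Set (Fin m → ℂ)) := by
    intro h
    have h0 : ∀ y ∈ affinePart X a,
        aeval (R := ℂ) (S₁ := ℂ) y (MvPolynomial.X a - 1) = 0 := by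
      intro y hy
      rw [map_sub, aeval_X_point, hy.2, map_one, sub_self]
    have h1 := h ⟨_, h0⟩
    rw [Finset.sum_eq_single a] at h1
    · simp only [tangentEq, map_sub, pderiv_X_self, Derivation.map_one_eq_zero, sub_zero, map_one, one_mul] at h1
      exact one_ne_zero (hy.2.symm.trans h1)
    · intro b _ hb
      simp only [tangentEq, map_sub, pderiv_X_of_ne (Ne.symm hb), Derivation.map_one_eq_zero, sub_zero, map_zero,
        zero_mul]
    · simp
  obtain ⟨x, hxS, hxi, hx⟩ := exists_finrank_ker_linearCombination_le
    (span_affinePart_eq_top hX hXn ha) (Θ := polyKer (L := ℂ) (tangentEq (affinePart X a)) y)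
    hy hya i
  -- A special tuple with small kernel. By semicontinuity the kernel at the generic point is no
  -- larger.
  let z' : AffineSp (Fin r × Fin m ⊕ Fin s × Fin r) := Sum.elim (fun p => x p.1 p.2) 0
  have hz' : z' ∈ locus r s X a := fun l => hxS l
  refine (finrank_polyKer_le (combEq s (affinePart X a) i) hz hz').trans (le_trans ?_ (hx.trans ?_))
  · refine Submodule.finrank_mono fun c hc => ?_
    have h1 := (mem_polyKer_combEq (K := ℂ)).1 hc
    have h2 : (fun b => z' (Sum.inl (i, b))) = y := hxi
    have h3 : Matrix.vecMul c (toMat (z' ∘ Sum.inl)) = Fintype.linearCombination ℂ x c := by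
      funext b
      rw [Fintype.linearCombination_apply, Finset.sum_apply]
      rfl
    rw [h2, h3] at h1
    rw [LinearMap.mem_ker, LinearMap.comp_apply, Submodule.mkQ_apply,
      Submodule.Quotient.mk_eq_zero]
    exact h1
  · rw [Module.finrank_fin_fun]
    omega

end SubspaceRank

/-! ### Bounds for the transcendence degree of the generic `r`-plane. -/

namespace SubspaceRank

variable {r s m : ℕ}

theorem isGeneric_row {X : Set (PSpace m)} {a : Fin m}
    {K : Type} [Field K] [Algebra ℂ K] {z : Fin r × Fin m ⊕ Fin s × Fin r → K}
    (hz : IsGeneric (locus r s X a) z) (i : Fin r) :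
    IsGeneric (affinePart X a) fun b => z (Sum.inl (i, b)) := by
  intro f
  have h1 : ∀ (L : Type) [Field L] [Algebra ℂ L] (u : Fin r × Fin m ⊕ Fin s × Fin r → L),
      aeval u (rename (fun b => Sum.inl (i, b)) f) = aeval (fun b => u (Sum.inl (i, b))) f := by
    intro L _ _ u
    rw [aeval_rename]; rfl
  rw [← h1, hz]
  constructor
  · intro h y hy
    let u : AffineSp (Fin r × Fin m ⊕ Fin s × Fin r) := Sum.elim (fun p => y p.2) 0
    exact (h1 ℂ u).symm.trans (h u fun _ => hy)
  · intro h y hy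
    exact (h1 ℂ y).trans (h _ (hy i))

theorem eRk_iUnion_le {ι α : Type*} [Fintype ι] (M : Matroid α) (S : ι → Set α) :
    M.eRk (⋃ i, S i) ≤ ∑ i, M.eRk (S i) := by
  classical
  have : ∀ t : Finset ι, M.eRk (⋃ i ∈ t, S i) ≤ ∑ i ∈ t, M.eRk (S i) := by
    intro t
    induction t using Finset.induction_on with
    | empty => simp
    | insert i t hi ih =>
      rw [Finset.set_biUnion_insert, Finset.sum_insert hi]
      exact (M.eRk_union_le_eRk_add_eRk _ _).trans (add_le_add le_rfl ih)
  simpa using this Finset.univ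

theorem eRk_range_inl_le {X : Set (PSpace m)} (hXc : IsClosed X) (hX : IsIrreducible X)
    {a : Fin m} (ha : (X ∩ (pSpaceAtlas m).dom a).Nonempty) {n : ℕ}
    (hn : topologicalKrullDim X = (n : WithBot ℕ∞))
    {K : Type} [Field K] [Algebra ℂ K] {z : Fin r × Fin m ⊕ Fin s × Fin r → K}
    (hz : IsGeneric (locus r s X a) z) :
    (matroid ℂ K).eRk (Set.range (z ∘ Sum.inl)) ≤ (r * n : ℕ) := by
  have h1 : Set.range (z ∘ Sum.inl) = ⋃ i, Set.range fun b => z (Sum.inl (i, b)) := by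
    ext y
    simp
  have h2 : ∀ i, (matroid ℂ K).eRk (Set.range fun b => z (Sum.inl (i, b))) = n := fun i => by
    have := topologicalKrullDim_eq_of_affinePart hXc hX ha (isGeneric_row hz i)
    rw [hn] at this
    exact (WithBot.coe_injective this).symm
  rw [h1]
  refine (eRk_iUnion_le _ _).trans ?_
  simp [h2]

/-- Independence of the `B` coordinates means that the projection of the affine part to them is
dense. Products of dense sets are dense, so a relation among the coordinates of all rows vanishes
identically. -/
theorem algebraicIndependent_rows {X : Set (PSpace m)} {a : Fin m} {K' : Type} [Field K']
    [Algebra ℂ K'] {ξ : Fin m → K'} (hξ : IsGeneric (affinePart X a) ξ) {B : Set (Fin m)}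
    (hB : AlgebraicIndependent ℂ fun b : B => ξ b)
    {K : Type} [Field K] [Algebra ℂ K] {z : Fin r × Fin m ⊕ Fin s × Fin r → K}
    (hz : IsGeneric (locus r s X a) z) :
    AlgebraicIndependent ℂ fun p : Fin r × B => z (Sum.inl (p.1, p.2)) := by
  classical
  rw [algebraicIndependent_iff]
  intro f hf
  let T : Set (AffineSp B) := (fun (y : AffineSp (Fin m)) => fun b : B => y b) '' affinePart X a
  have hT : closure T = Set.univ := by
    rw [Set.eq_univ_iff_forall]
    intro y
    rw [mem_closure_affineSp_iff]
    intro g hg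
    have h1 : aeval ξ (rename Subtype.val g) = 0 := by
      rw [hξ]
      intro y hy
      have h2 := aeval_rename (R := ℂ) (S := ℂ) Subtype.val y g
      exact h2.trans (hg _ ⟨y, hy, rfl⟩)
    rw [aeval_rename] at h1
    have h3 : g = 0 := (algebraicIndependent_iff.1 hB) g h1
    rw [h3, map_zero]
  let c : (Fin r → AffineSp B) → AffineSp (Fin r × B) := fun u p => u p.1 p.2
  have hc : ∀ u i, Continuous fun y => c (Function.update u i y) := fun u i =>
    continuous_affineSp_of_polynomial continuous_id
      (fun p => if p.1 = i then MvPolynomial.X p.2 else C (u p.1 p.2)) fun y p => by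
        dsimp only [id, c]
        split_ifs with h
        · rw [aeval_X_point, h, Function.update_self]
        · rw [Function.update_of_ne h]
          exact (aeval_C (R := ℂ) (S₁ := ℂ) y _).symm
  have hpt : ∀ y ∈ c '' {u | ∀ i, u i ∈ T}, aeval (R := ℂ) (S₁ := ℂ) y f = 0 := by
    rintro _ ⟨u, hu, rfl⟩
    choose x hx hxu using hu
    have h1 : aeval z (rename (fun p : Fin r × B => Sum.inl (p.1, (p.2 : Fin m))) f) = 0 := by
      rw [aeval_rename]; exact hf
    let z' : AffineSp (Fin r × Fin m ⊕ Fin s × Fin r) := Sum.elim (fun p => x p.1 p.2) 0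
    have h2 := (hz _).1 h1 z' hx
    have h3 := aeval_rename (R := ℂ) (S := ℂ)
      (fun p : Fin r × B => Sum.inl (p.1, (p.2 : Fin m))) z' f
    have h4 : c u = z' ∘ (fun p : Fin r × B => Sum.inl (p.1, (p.2 : Fin m))) := by
      funext p
      exact (congrFun (hxu p.1) p.2).symm
    rw [h4]
    exact h3.symm.trans h2
  refine MvPolynomial.funext fun y => ?_
  have h5 := mem_closure_image_pi_of_separately_continuous hc (T := T)
    (z := fun i b => y (i, b)) (fun i => by rw [hT]; trivial)
  have h6 := mem_closure_affineSp_iff.1 h5 f hpt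
  rw [map_zero, ← h6]
  rfl

theorem le_eRank_of_isGeneric_locus {X : Set (PSpace m)} {a : Fin m} {K' : Type} [Field K']
    [Algebra ℂ K'] {ξ : Fin m → K'} (hξ : IsGeneric (affinePart X a) ξ) {n : ℕ}
    (hn : (matroid ℂ K').eRk (Set.range ξ) = n)
    {K : Type} [Field K] [Algebra ℂ K] {z : Fin r × Fin m ⊕ Fin s × Fin r → K}
    (hz : IsGeneric (locus r s X a) z) : (r * n : ℕ) ≤ (matroid ℂ K).eRank := by
  obtain ⟨B, hB, -, hcard⟩ := exists_coordinate_basis ξ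
  have h := algebraicIndependent_rows hξ hB hz
  have h1 : (matroid ℂ K).Indep (Set.range fun p : Fin r × B => z (Sum.inl (p.1, p.2))) :=
    AlgebraicIndependent.matroid_indep_iff.2 (AlgebraicIndependent.coe_range h)
  refine le_trans (le_of_eq ?_) h1.encard_le_eRank
  rw [← Set.image_univ, h.injective.injOn.encard_image, Set.encard_univ, ENat.card_eq_coe_natCard,
    Nat.card_prod, Nat.card_fin]
  rw [hn, ← ENat.card_coe_set_eq, ENat.card_eq_coe_natCard] at hcard
  have : n = Nat.card B := by exact_mod_cast hcard
  rw [this]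

end SubspaceRank

namespace SubspaceRank

variable {r s m : ℕ}

theorem toMat_nrm {K : Type} [Field K] [Algebra ℂ K] (I : Fin r → Fin m) (x : Fin r × Fin m → K) :
    toMat ((grAtlas r m).nrm I x) = matNrm I (toMat x) := toMat_ratMap I x

/-- Some minor of the matrix of the generic point does not vanish. -/
theorem exists_aeval_minor_ne_zero {X : Set (PSpace m)} (hX : IsIrreducible X)
    (hXn : Nondegenerate X) {a : Fin m} (ha : (X ∩ (pSpaceAtlas m).dom a).Nonempty) (hr : r ≤ m)
    {K : Type} [Field K] [Algebra ℂ K] {z : Fin r × Fin m ⊕ Fin s × Fin r → K}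
    (hz : IsGeneric (locus r s X a) z) : ∃ I, aeval (z ∘ Sum.inl) (minor (r := r) (m := m) I) ≠ 0 := by
  obtain ⟨f, hf, -, hli⟩ := Submodule.exists_fun_fin_finrank_span_eq ℂ
    (M := Fin m → ℂ) (affinePart X a)
  have hfr : Module.finrank ℂ (@Submodule.span ℂ (Fin m → ℂ) _ _ _ (affinePart X a)) = m := by
    rw [span_affinePart_eq_top hX hXn ha, finrank_top, Module.finrank_fin_fun]
  let x : Fin r → Fin m → ℂ := fun i => f (Fin.castLE (hr.trans hfr.ge) i)
  have hx : LinearIndependent ℂ x := hli.comp _ (Fin.castLE_injective _)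
  obtain ⟨I, hI⟩ := exists_minor_ne_zero (Matrix.of x) hx
  refine ⟨I, fun h0 => hI ?_⟩
  rw [← aeval_rename (R := ℂ)] at h0
  let z' : AffineSp (Fin r × Fin m ⊕ Fin s × Fin r) := Sum.elim (fun p => x p.1 p.2) 0
  have h1 := (hz _).1 h0 z' fun i => show x i ∈ affinePart X a from hf _
  have h2 := aeval_rename (R := ℂ) (S := ℂ) Sum.inl z' (minor (r := r) (m := m) I)
  have h3 := aeval_minor (K := ℂ) I (z' ∘ Sum.inl)
  exact h3.symm.trans (h2.symm.trans h1)

theorem finrank_pi_le {K ι : Type*} [Fintype ι] [Field K] {V : ι → Type*}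
    [∀ i, AddCommGroup (V i)] [∀ i, Module K (V i)] [∀ i, FiniteDimensional K (V i)]
    (U : ∀ i, Submodule K (V i)) :
    Module.finrank K (Submodule.pi Set.univ U) ≤ ∑ i, Module.finrank K (U i) := by
  rw [← Module.finrank_pi_fintype K]
  let F : Submodule.pi Set.univ U →ₗ[K] ∀ i, U i :=
    LinearMap.pi fun i => ((LinearMap.proj i).domRestrict _).codRestrict (U i) fun v =>
      v.2 i trivial
  refine LinearMap.finrank_le_finrank_of_injective (f := F) fun v w h => ?_
  refine Subtype.ext (funext fun i => ?_)
  exact congrArg Subtype.val (congrFun h i)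

/-- The coefficients of the derivative of a matrix with respect to its rows, for a derivation that
vanishes on the normal form of the matrix. -/
noncomputable def derivCoeff {K : Type} [Field K] [Algebra ℂ K] (I : Fin r → Fin m)
    (M : Matrix (Fin r) (Fin m) K) : Derivation ℂ K K →ₗ[K] (Fin r → Fin r → K) where
  toFun D i := Matrix.vecMul (fun c => D (M i (I c))) (M.submatrix id I)⁻¹
  map_add' D D' := by
    funext i
    exact Matrix.add_vecMul _ _ _
  map_smul' a D := by
    funext i
    exact Matrix.smul_vecMul _ _ _

/-- A matrix is its chosen block times its normal form. If `D` kills the normal form, it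
differentiates only the block, so the derivative of each row is again a combination of the rows. -/
theorem vecMul_derivCoeff {K : Type} [Field K] [Algebra ℂ K] {I : Fin r → Fin m}
    {M : Matrix (Fin r) (Fin m) K} (hI : (M.submatrix id I).det ≠ 0) (D : Derivation ℂ K K)
    (hD : ∀ a b, D (matNrm I M a b) = 0) (i : Fin r) :
    Matrix.vecMul (derivCoeff I M D i) M = fun b => D (M i b) := by
  have h1 : Matrix.vecMul (derivCoeff I M D i) M =
      Matrix.vecMul (fun c => D (M i (I c))) (matNrm I M) :=
    Matrix.vecMul_vecMul (fun c => D (M i (I c))) (M.submatrix id I)⁻¹ M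
  rw [h1]
  funext b
  have h2 : M i b = ∑ c, M i (I c) * matNrm I M c b :=
    (congrFun₂ (mul_matNrm hI) i b).symm.trans Matrix.mul_apply
  rw [h2, map_sum]
  change ∑ c, D (M i (I c)) * matNrm I M c b = _
  refine Finset.sum_congr rfl fun c _ => ?_
  rw [D.leibniz, hD, smul_zero, zero_add, smul_eq_mul, mul_comm]

/-- The transcendence degree of the plane spanned by `r` generic points of `X` is at least
`r * min n (m - r)`. -/
theorem le_eRk_nrm {X : Set (PSpace m)} (hX : IsIrreducible X)
    (hXn : Nondegenerate X) {a : Fin m} (ha : (X ∩ (pSpaceAtlas m).dom a).Nonempty)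
    {K' : Type} [Field K'] [Algebra ℂ K'] {ξ : Fin m → K'} (hξ : IsGeneric (affinePart X a) ξ)
    {n : ℕ} (hn : (matroid ℂ K').eRk (Set.range ξ) = n)
    {K : Type} [Field K] [Algebra ℂ K] {z : Fin r × Fin m ⊕ Fin 0 × Fin r → K}
    (hz : IsGeneric (locus r 0 X a) z) (htop : IntermediateField.adjoin ℂ (Set.range z) = ⊤)
    {I : Fin r → Fin m} (hI : aeval (z ∘ Sum.inl) (minor I) ≠ 0) :
    (r * n : ℕ) ≤ (matroid ℂ K).eRk (Set.range ((grAtlas r m).nrm I (z ∘ Sum.inl))) +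
      (r * (r - (m - n)) : ℕ) := by
  set x : Fin r × Fin m → K := z ∘ Sum.inl with hx
  have hdet : ((toMat x).submatrix id I).det ≠ 0 := by rwa [aeval_minor] at hI
  -- The `i`-th factor consists of the coefficients whose combination of rows is tangent at row `i`.
  -- Differentiating the equations satisfied by that row shows that the coefficients of `D` lie
  -- there.
  set U : Fin r → Submodule K (Fin r → K) := fun i => polyKer (combEq 0 (affinePart X a) i) z
  have hnrm : ∀ D : Derivation ℂ K K, (∀ y ∈ Set.range ((grAtlas r m).nrm I x), D y = 0) →
      ∀ a b, D (matNrm I (toMat x) a b) = 0 := by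
    intro D hD a b
    rw [← toMat_nrm]
    exact hD _ ⟨(a, b), rfl⟩
  have h := eRank_le_eRk_add_finrank (k := ℂ) (K := K)
    (Set.range ((grAtlas r m).nrm I x)) (derivCoeff I (toMat x)) (Submodule.pi Set.univ U) ?_ ?_
  · refine (le_eRank_of_isGeneric_locus hξ hn hz).trans (h.trans (add_le_add le_rfl ?_))
    have h1 : Module.finrank K (Submodule.pi Set.univ U) ≤ r * (r - (m - n)) := by
      refine (finrank_pi_le U).trans ?_
      refine (Finset.sum_le_card_nsmul _ _ (r - (m - n)) fun i _ =>
        finrank_polyKer_combEq_le hX hXn ha hξ hn hz i).trans ?_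
      simp
    exact_mod_cast h1
  · intro D hD i _
    change derivCoeff I (toMat x) D i ∈ polyKer (combEq 0 (affinePart X a) i) z
    rw [mem_polyKer_combEq, vecMul_derivCoeff hdet D (hnrm D hD)]
    intro f
    have h1 : aeval (fun b => z (Sum.inl (i, b))) f.1 = 0 := (isGeneric_row hz i f.1).2 f.2
    have h2 := D.map_aeval_mvPolynomial (fun b => z (Sum.inl (i, b))) f.1
    rw [h1, map_zero] at h2
    exact h2.symm
  · intro D hD h0
    have h1 : ∀ y ∈ Set.range z, D y = 0 := by
      rintro _ ⟨p | p, rfl⟩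
      · have h2 := vecMul_derivCoeff hdet D (hnrm D hD) p.1
        rw [h0] at h2
        have h3 := congrFun h2 p.2
        have h4 : Matrix.vecMul ((0 : Fin r → Fin r → K) p.1) (toMat x) = 0 := Matrix.zero_vecMul _
        rw [h4] at h3
        exact h3.symm
      -- With `s = 0` there are no matrix parameters, so the field is generated by the rows alone
      -- and `D` is determined by its coefficients.
      · exact p.1.elim0
    ext y
    refine D.eq_zero_of_mem_matroid_closure h1 (adjoin_subset_matroid_closure _ ?_)
    rw [htop]
    trivial

/-- The normal form of a matrix has transcendence degree at most the dimension of the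
Grassmannian. -/
theorem eRk_nrm_le_mul {K : Type} [Field K] [Algebra ℂ K] {I : Fin r → Fin m}
    {x : Fin r × Fin m → K} (hI : aeval x (minor I) ≠ 0) :
    (matroid ℂ K).eRk (Set.range ((grAtlas r m).nrm I x)) ≤ (r * (m - r) : ℕ) := by
  have hdet : ((toMat x).submatrix id I).det ≠ 0 := by rwa [aeval_minor] at hI
  have hinj : Function.Injective I := by
    intro c d hcd
    by_contra hne
    refine hdet (Matrix.det_zero_of_column_eq hne fun i => ?_)
    simp [hcd]
  classical
  -- Only the `m - r` columns outside `I` can contribute; the columns in `I` form the identity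
  -- matrix.
  let S : Finset (Fin m) := Finset.univ \ Finset.univ.image I
  have hS : S.card = m - r := by
    rw [Finset.card_univ_sdiff, Finset.card_image_of_injective _ hinj]
    simp
  let y : Fin r × S → K := fun p => (grAtlas r m).nrm I x (p.1, p.2)
  have hsub : Set.range ((grAtlas r m).nrm I x) ⊆ IntermediateField.adjoin ℂ (Set.range y) := by
    rintro _ ⟨⟨i, b⟩, rfl⟩
    by_cases hb : b ∈ S
    · exact IntermediateField.subset_adjoin _ _ ⟨(i, ⟨b, hb⟩), rfl⟩
    · obtain ⟨c, rfl⟩ : ∃ c, I c = b := by simpa [S] using hb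
      have h1 : (grAtlas r m).nrm I x (i, I c) = (1 : Matrix (Fin r) (Fin r) K) i c := by
        rw [← matNrm_submatrix hdet, ← toMat_nrm]
        rfl
      rw [h1, Matrix.one_apply]
      split_ifs
      · exact one_mem _
      · exact zero_mem _
  refine (eRk_le_of_subset_adjoin hsub).trans (((matroid ℂ K).eRk_le_encard _).trans ?_)
  rw [← Set.image_univ]
  refine (Set.encard_image_le _ _).trans ?_
  rw [Set.encard_univ, ENat.card_eq_coe_natCard, Nat.card_prod, Nat.card_fin,
    Nat.card_eq_fintype_card, Fintype.card_coe, hS]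

/-- The dimension of the Grassmannian, as an upper bound. -/
theorem topologicalKrullDim_gr_le (hr : r ≤ m) :
    topologicalKrullDim (Gr r m) ≤ ((r * (m - r) : ℕ) : WithBot ℕ∞) := by
  obtain ⟨K, _, _, ξ, hξ, -⟩ := exists_isGeneric (isIrreducible_univ_affineSp (Fin r × Fin m))
  have hex : ∃ I, aeval ξ (minor (r := r) (m := m) I) ≠ 0 := by
    refine ⟨Fin.castLE hr, fun h0 => ?_⟩
    let y : AffineSp (Fin r × Fin m) := fun p => if Fin.castLE hr p.1 = p.2 then 1 else 0
    have h1 := (hξ _).1 h0 y trivial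
    have h2 := aeval_minor (K := ℂ) (Fin.castLE hr) y
    have h3 : (toMat (K := ℂ) y).submatrix id (Fin.castLE hr) = 1 := by
      ext i j
      simp [toMat, y, Matrix.one_apply, (Fin.castLE_injective hr).eq_iff]
    rw [h3, Matrix.det_one] at h2
    exact one_ne_zero (h2.symm.trans h1)
  obtain ⟨I, hI⟩ := hex
  have hφ : ξ = fun p => aeval ξ (X (R := ℂ) p) := aeval_X_eq ξ
  have hZ : ∀ F : Gr r m, F ∈ (Set.univ : Set (Gr r m)) ↔
      ∃ y ∈ (Set.univ : Set (AffineSp (Fin r × Fin m))), ∃ w, (grAtlas r m).q w = F ∧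
        (grAtlas r m).ent w = fun a => aeval (R := ℂ) (S₁ := ℂ) y (X a) := by
    intro F
    refine ⟨fun _ => ?_, fun _ => trivial⟩
    obtain ⟨w, rfl⟩ := Frame.span_surjective F
    exact ⟨w.entries, trivial, w, rfl, aeval_X_point' w.entries⟩
  have h := (grAtlas r m).topologicalKrullDim_closure
    (isIrreducible_univ_affineSp (Fin r × Fin m)) hξ (fun p => X p) hZ I
    (by rw [← hφ]; exact hI)
  rw [closure_univ, ← hφ] at h
  have h4 : topologicalKrullDim (Gr r m) ≤ topologicalKrullDim (Set.univ : Set (Gr r m)) :=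
    (Homeomorph.Set.univ (Gr r m)).symm.isClosedEmbedding.isInducing.topologicalKrullDim_le
  rw [h] at h4
  refine h4.trans ?_
  exact WithBot.coe_le_coe.2 (eRk_nrm_le_mul hI)

end SubspaceRank

/-! ### The dimension of `σ_{r,r}(X)`. -/

namespace SubspaceRank

variable {r s m : ℕ}

theorem topologicalKrullDim_sigma_self {X : Set (PSpace m)} (hX : IsIrreducible X) {a : Fin m}
    (ha : (X ∩ (pSpaceAtlas m).dom a).Nonempty)
    {K : Type} [Field K] [Algebra ℂ K] {z : Fin r × Fin m ⊕ Fin s × Fin r → K}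
    (hz : IsGeneric (locus r s X a) z) {I : Fin r → Fin m}
    (hI : aeval (z ∘ Sum.inl) (minor I) ≠ 0) :
    topologicalKrullDim (sigma r r X) =
      ((matroid ℂ K).eRk (Set.range ((grAtlas r m).nrm I (z ∘ Sum.inl))) : WithBot ℕ∞) := by
  have h := (grAtlas r m).topologicalKrullDim_closure (isIrreducible_locus hX ha) hz
    (bigPoly r s m) (Z := bigSet r s X a) (fun _ => Iff.rfl) I
    (by rw [← aeval_bigPoly]; exact hI)
  rw [← aeval_bigPoly] at h
  rw [← h, sigma_eq_closure_bigSet s hX ha]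

/-- The subtraction in `h3` is truncated. If `n ≤ m - r` the correction vanishes; if `n = m - r + k`
it is exactly `r * k`, leaving `r * (m - r) ≤ d`. -/
theorem eq_min_of_bounds {r n m d : ℕ} (hr : r ≤ m) (hn : n ≤ m) (h1 : d ≤ r * n)
    (h2 : d ≤ r * (m - r)) (h3 : r * n ≤ d + r * (r - (m - n))) : d = min (r * n) (r * (m - r)) := by
  apply le_antisymm (le_min h1 h2)
  rcases le_total n (m - r) with h | h
  · rw [show r - (m - n) = 0 by omega] at h3
    exact (min_le_left _ _).trans (by simpa using h3)
  · obtain ⟨k, hk⟩ := Nat.exists_eq_add_of_le h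
    rw [show r - (m - n) = k by omega, hk, mul_add] at h3
    exact (min_le_right _ _).trans (by omega)

/-- The dimension of `σ_{r,r}(X)`. -/
theorem topologicalKrullDim_sigma_self_eq {n : ℕ} {X : Set (PSpace m)} (hXc : IsClosed X)
    (hX : IsIrreducible X) (hXn : Nondegenerate X)
    (hn : topologicalKrullDim X = (n : WithBot ℕ∞)) (hr : r ≤ m) :
    topologicalKrullDim (sigma r r X) = ((min (r * n) (r * (m - r)) : ℕ) : WithBot ℕ∞) := by
  obtain ⟨a, ha⟩ := exists_inter_dom_nonempty hX
  obtain ⟨K', _, _, ξ, hξ, -⟩ := exists_isGeneric (isIrreducible_affinePart hX ha)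
  have hξn := topologicalKrullDim_eq_of_affinePart hXc hX ha hξ
  rw [hn] at hξn
  have hξn' : (matroid ℂ K').eRk (Set.range ξ) = n := (WithBot.coe_injective hξn).symm
  have hnm : n ≤ m := by
    have h1 := (matroid ℂ K').eRk_le_encard (Set.range ξ)
    rw [hξn', ← Set.image_univ] at h1
    have h2 := h1.trans (Set.encard_image_le _ _)
    rw [Set.encard_univ, ENat.card_eq_coe_natCard, Nat.card_fin] at h2
    exact_mod_cast h2
  obtain ⟨K, _, _, z, hz, htop⟩ := exists_isGeneric (isIrreducible_locus (r := r) (s := 0) hX ha)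
  obtain ⟨I, hI⟩ := exists_aeval_minor_ne_zero hX hXn ha hr hz
  rw [topologicalKrullDim_sigma_self hX ha hz hI]
  have h1 : (matroid ℂ K).eRk (Set.range ((grAtlas r m).nrm I (z ∘ Sum.inl))) ≤ (r * n : ℕ) := by
    refine (eRk_le_of_subset_adjoin ?_).trans (eRk_range_inl_le hXc hX ha hn hz)
    rintro _ ⟨p, rfl⟩
    exact div_mem (aeval_mem_adjoin _ _) (aeval_mem_adjoin _ _)
  have h2 := eRk_nrm_le_mul hI
  have h3 := le_eRk_nrm hX hXn ha hξ hξn' hz htop hI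
  obtain ⟨d, hd⟩ := ENat.ne_top_iff_exists.1 (ne_top_of_le_ne_top (ENat.natCast_ne_top _) h1)
  rw [← hd] at h1 h2 h3 ⊢
  refine congrArg _ ?_
  exact_mod_cast eq_min_of_bounds hr hnm (by exact_mod_cast h1) (by exact_mod_cast h2)
    (by exact_mod_cast h3)

end SubspaceRank

/-! ### Normal form and transcendence degree of the generic pair. -/

namespace SubspaceRank

variable {r s m : ℕ}

theorem mul_submatrix_comp {K : Type*} [Field K] {I : Fin r → Fin m} (κ : Fin s → Fin r)
    (T : Matrix (Fin s) (Fin r) K) {M : Matrix (Fin r) (Fin m) K} (hM : M.submatrix id I = 1) :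
    (T * M).submatrix id (I ∘ κ) = T.submatrix id κ := by
  have h : (T * M).submatrix id (I ∘ κ) = ((T * M).submatrix id I).submatrix id κ := rfl
  rw [h, mul_submatrix_id, hM, Matrix.mul_one]

/-- When the big matrix has an identity block in columns `I`, the columns `I ∘ κ` of the product are
the columns `κ` of `T`. Normalising the small space in `V` thus amounts to normalising it inside the
big space. -/
theorem matNrm_comp {K : Type*} [Field K] {I : Fin r → Fin m} (κ : Fin s → Fin r)
    (T : Matrix (Fin s) (Fin r) K) {M : Matrix (Fin r) (Fin m) K} (hM : M.submatrix id I = 1) :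
    matNrm (I ∘ κ) (T * M) = matNrm κ T * M := by
  rw [matNrm, mul_submatrix_comp κ T hM, matNrm, Matrix.mul_assoc]

/-- The coordinates of a pair of subspaces parametrised by a point of `locus r s X a`. -/
noncomputable def pairPt {K : Type} [Field K] [Algebra ℂ K]
    (z : Fin r × Fin m ⊕ Fin s × Fin r → K) : Fin r × Fin m ⊕ Fin s × Fin m → K :=
  fun p => aeval z (Sum.elim (bigPoly r s m) (smallPoly r s m) p)

theorem pairPt_inl {K : Type} [Field K] [Algebra ℂ K]
    (z : Fin r × Fin m ⊕ Fin s × Fin r → K) : pairPt z ∘ Sum.inl = z ∘ Sum.inl :=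
  (aeval_bigPoly z).symm

theorem toMat_pairPt_inr {K : Type} [Field K] [Algebra ℂ K]
    (z : Fin r × Fin m ⊕ Fin s × Fin r → K) :
    toMat (pairPt z ∘ Sum.inr) = toMat (z ∘ Sum.inr) * toMat (z ∘ Sum.inl) :=
  toMat_smallPoly z

theorem aeval_pairMinor_pairPt_ne_zero_iff {K : Type} [Field K] [Algebra ℂ K]
    {z : Fin r × Fin m ⊕ Fin s × Fin r → K} {I : Fin r → Fin m} {κ : Fin s → Fin r} :
    aeval (pairPt z) (pairMinor (I, I ∘ κ)) ≠ 0 ↔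
      ((toMat (z ∘ Sum.inl)).submatrix id I).det ≠ 0 ∧
      ((toMat (z ∘ Sum.inr) * (toMat (z ∘ Sum.inl)).submatrix id I).submatrix id κ).det ≠ 0 := by
  rw [aeval_pairMinor, pairPt_inl, aeval_minor, aeval_minor, toMat_pairPt_inr, mul_ne_zero_iff,
    ← mul_submatrix_id]
  rfl

theorem nrm_pairPt {K : Type} [Field K] [Algebra ℂ K]
    {z : Fin r × Fin m ⊕ Fin s × Fin r → K} {I : Fin r → Fin m} {κ : Fin s → Fin r}
    (h : aeval (pairPt z) (pairMinor (I, I ∘ κ)) ≠ 0) :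
    (grPairAtlas r s m).nrm (I, I ∘ κ) (pairPt z) ∘ Sum.inl = (grAtlas r m).nrm I (z ∘ Sum.inl) ∧
    toMat ((grPairAtlas r s m).nrm (I, I ∘ κ) (pairPt z) ∘ Sum.inl) =
      matNrm I (toMat (z ∘ Sum.inl)) ∧
    toMat ((grPairAtlas r s m).nrm (I, I ∘ κ) (pairPt z) ∘ Sum.inr) =
      matNrm κ (toMat (z ∘ Sum.inr) * (toMat (z ∘ Sum.inl)).submatrix id I) *
        matNrm I (toMat (z ∘ Sum.inl)) := by
  have h1 : (grPairAtlas r s m).nrm (I, I ∘ κ) (pairPt z) =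
      Sum.elim (ratMap (minorNum I) (minor I) (pairPt z ∘ Sum.inl))
        (ratMap (minorNum (I ∘ κ)) (minor (I ∘ κ)) (pairPt z ∘ Sum.inr)) := ratMap_pairMinor _ h
  have hI := (aeval_pairMinor_pairPt_ne_zero_iff.1 h).1
  rw [h1, Sum.elim_comp_inl, Sum.elim_comp_inr, toMat_ratMap, toMat_ratMap, pairPt_inl,
    toMat_pairPt_inr]
  refine ⟨rfl, rfl, ?_⟩
  rw [← matNrm_comp κ _ (matNrm_submatrix hI), Matrix.mul_assoc, mul_matNrm hI]

/-- The normal forms of the pairs of subspaces parametrised by `locus r s X a`. -/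
def nrmPairs (r s : ℕ) {m : ℕ} (X : Set (PSpace m)) (a : Fin m)
    (I : (Fin r → Fin m) × (Fin s → Fin m)) : Set (AffineSp (Fin r × Fin m ⊕ Fin s × Fin m)) :=
  {u | ∃ y ∈ locus r s X a, aeval (R := ℂ) (S₁ := ℂ)
    (fun p => aeval (R := ℂ) (S₁ := ℂ) y (Sum.elim (bigPoly r s m) (smallPoly r s m) p))
      ((grPairAtlas r s m).g I) ≠ 0 ∧
    u = (grPairAtlas r s m).nrmSp I
      fun p => aeval (R := ℂ) (S₁ := ℂ) y (Sum.elim (bigPoly r s m) (smallPoly r s m) p)}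

theorem isGeneric_nrm_pairPt {X : Set (PSpace m)} (hX : IsIrreducible X) {a : Fin m}
    (ha : (X ∩ (pSpaceAtlas m).dom a).Nonempty)
    {K : Type} [Field K] [Algebra ℂ K] {z : Fin r × Fin m ⊕ Fin s × Fin r → K}
    (hz : IsGeneric (locus r s X a) z) {I : (Fin r → Fin m) × (Fin s → Fin m)}
    (hI : aeval (pairPt z) (pairMinor I) ≠ 0) :
    IsGeneric (nrmPairs r s X a I) ((grPairAtlas r s m).nrm I (pairPt z)) :=
  (grPairAtlas r s m).isGeneric_nrm (isIrreducible_locus hX ha) hz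
    (Sum.elim (bigPoly r s m) (smallPoly r s m)) hI

/-- Over every large subspace that occurs in `nrmPairs r s X a I`, all small subspaces occur. -/
theorem exists_mem_nrmPairs {X : Set (PSpace m)} {a : Fin m} {I : Fin r → Fin m} {κ : Fin s → Fin r}
    {u : AffineSp (Fin r × Fin m ⊕ Fin s × Fin m)} (hu : u ∈ nrmPairs r s X a (I, I ∘ κ))
    (τ : Matrix (Fin s) (Fin r) ℂ) (hτ : τ.submatrix id κ = 1) :
    ∃ u' ∈ nrmPairs r s X a (I, I ∘ κ), (∀ p, u' (Sum.inl p) = u (Sum.inl p)) ∧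
      ∀ i c, u' (Sum.inr (i, I c)) = τ i c := by
  obtain ⟨y, hy, hyI, rfl⟩ := hu
  have hyI' := (aeval_pairMinor_pairPt_ne_zero_iff (K := ℂ) (z := y)).1 hyI
  set x : Matrix (Fin r) (Fin m) ℂ := toMat (y ∘ Sum.inl) with hx
  have hxI : IsUnit (x.submatrix id I).det := isUnit_iff_ne_zero.2 hyI'.1
  -- The factor inverse to the chosen block makes the coefficients relative to the normalised big
  -- frame equal to `τ`.
  let y' : AffineSp (Fin r × Fin m ⊕ Fin s × Fin r) :=
    Sum.elim (fun p => x p.1 p.2) fun p => (τ * (x.submatrix id I)⁻¹) p.1 p.2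
  have hy' : y' ∈ locus r s X a := hy
  have h1 : toMat (K := ℂ) (y' ∘ Sum.inl) = x := rfl
  have h2 : toMat (K := ℂ) (y' ∘ Sum.inr) = τ * (x.submatrix id I)⁻¹ := rfl
  have h3 : toMat (K := ℂ) (y' ∘ Sum.inr) * (toMat (K := ℂ) (y' ∘ Sum.inl)).submatrix id I = τ := by
    rw [h1, h2, Matrix.mul_assoc, Matrix.nonsing_inv_mul _ hxI, Matrix.mul_one]
  have hI' := (aeval_pairMinor_pairPt_ne_zero_iff (K := ℂ) (z := y') (I := I) (κ := κ)).2
    ⟨hyI'.1, by rw [h3, hτ, Matrix.det_one]; exact one_ne_zero⟩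
  obtain ⟨-, h4, h5⟩ := nrm_pairPt (K := ℂ) hI'
  obtain ⟨-, h6, -⟩ := nrm_pairPt (K := ℂ) (z := y) hyI
  refine ⟨_, ⟨y', hy', hI', rfl⟩, fun p => ?_, fun i c => ?_⟩
  · exact congrFun₂ (h4.trans h6.symm) p.1 p.2
  · rw [h3, h1, matNrm, hτ, inv_one, Matrix.one_mul] at h5
    have h7 := congrArg (fun N => N.submatrix id I) h5
    simp only [mul_submatrix_id] at h7
    rw [matNrm_submatrix hyI'.1, Matrix.mul_one] at h7
    exact congrFun₂ h7 i c

/-- The transcendence degree of the generic pair of subspaces. -/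
theorem eRk_nrm_pairPt {X : Set (PSpace m)} (hX : IsIrreducible X) {a : Fin m}
    (ha : (X ∩ (pSpaceAtlas m).dom a).Nonempty)
    {K : Type} [Field K] [Algebra ℂ K] {z : Fin r × Fin m ⊕ Fin s × Fin r → K}
    (hz : IsGeneric (locus r s X a) z) {I : Fin r → Fin m} {κ : Fin s → Fin r}
    (hI : aeval (pairPt z) (pairMinor (I, I ∘ κ)) ≠ 0) :
    (matroid ℂ K).eRk (Set.range ((grPairAtlas r s m).nrm (I, I ∘ κ) (pairPt z))) =
      (matroid ℂ K).eRk (Set.range ((grAtlas r m).nrm I (z ∘ Sum.inl))) + (s * (r - s) : ℕ) := by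
  obtain ⟨h1, h2, h3⟩ := nrm_pairPt hI
  have hgen := isGeneric_nrm_pairPt hX ha hz hI
  obtain ⟨hd1, hd2⟩ := aeval_pairMinor_pairPt_ne_zero_iff.1 hI
  set w := (grPairAtlas r s m).nrm (I, I ∘ κ) (pairPt z) with hw
  set T := toMat (z ∘ Sum.inr) * (toMat (z ∘ Sum.inl)).submatrix id I with hT
  set M := matNrm I (toMat (z ∘ Sum.inl)) with hM
  rw [← h1]
  have hκ : Function.Injective κ := by
    intro c d hcd
    by_contra hne
    exact hd2 (Matrix.det_zero_of_column_eq hne fun i => by simp [hcd])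
  apply le_antisymm
  -- The pair is rational in the normalised big matrix and in the normal form of `T`, a point of
  -- `G(s, r)` with at most `s * (r - s)` parameters.
  · let t : Fin s × Fin r → K := fun p => T p.1 p.2
    have ht : toMat t = T := rfl
    have htI : aeval t (minor κ) ≠ 0 := by rw [aeval_minor]; exact hd2
    have hsub : Set.range w ⊆ IntermediateField.adjoin ℂ
        (Set.range (w ∘ Sum.inl) ∪ Set.range ((grAtlas s r).nrm κ t)) := by
      rintro _ ⟨p | p, rfl⟩
      · exact IntermediateField.subset_adjoin _ _ (.inl ⟨p, rfl⟩)
      · have h4 : w (Sum.inr p) = ∑ c, matNrm κ T p.1 c * M c p.2 :=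
          (congrFun₂ h3 p.1 p.2).trans Matrix.mul_apply
        rw [h4]
        refine sum_mem fun c _ => mul_mem ?_ ?_
        · refine IntermediateField.subset_adjoin _ _ (.inr ⟨(p.1, c), ?_⟩)
          rw [← ht, ← toMat_nrm]
          rfl
        · refine IntermediateField.subset_adjoin _ _ (.inl ⟨(c, p.2), ?_⟩)
          rw [← h2]
          rfl
    refine (eRk_le_of_subset_adjoin hsub).trans (((matroid ℂ K).eRk_union_le_eRk_add_eRk _ _).trans ?_)
    exact add_le_add le_rfl (eRk_nrm_le_mul htI)
  · obtain ⟨B, hB, -, hcard⟩ := exists_coordinate_basis (w ∘ Sum.inl)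
    let O := {c : Fin r // c ∉ Set.range κ}
    let emb : B ⊕ Fin s × O → Fin r × Fin m ⊕ Fin s × Fin m :=
      Sum.elim (fun p => Sum.inl p) fun p => Sum.inr (p.1, I p.2)
    have hli : AlgebraicIndependent ℂ (w ∘ emb) := by
      rw [algebraicIndependent_iff]
      intro f hf
      rw [← aeval_rename, hgen] at hf
      -- Every constant choice of the free small coordinates occurs over every big space, so
      -- substituting it turns `f` into a relation among the independent big coordinates, which is
      -- zero. Letting `τ` vary forces `f = 0`.
      have key : ∀ τ : Fin s × O → ℂ,
          aeval (R := ℂ) (Sum.elim (MvPolynomial.X : B → MvPolynomial B ℂ) fun p => C (τ p)) f = 0 := by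
        intro τ
        have hcomp : ∀ b : B → ℂ, aeval (R := ℂ) (S₁ := ℂ) b
            (aeval (R := ℂ) (Sum.elim (MvPolynomial.X : B → MvPolynomial B ℂ) fun p => C (τ p)) f) =
              aeval (R := ℂ) (S₁ := ℂ) (Sum.elim b τ) f := by
          intro b
          have : (aeval (R := ℂ) (S₁ := ℂ) b).comp (aeval (R := ℂ)
              (Sum.elim (MvPolynomial.X : B → MvPolynomial B ℂ) fun p => C (τ p))) =
              aeval (R := ℂ) (S₁ := ℂ) (Sum.elim b τ) := by
            ext p
            rcases p with p | p <;> simp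
          exact congrArg (fun F : MvPolynomial (B ⊕ Fin s × O) ℂ →ₐ[ℂ] ℂ => F f) this
        classical
        -- The free entries `τ` completed by the identity in the columns `κ`.
        let τ' : Matrix (Fin s) (Fin r) ℂ := Matrix.of fun i c =>
          if h : c ∈ Set.range κ then (if κ i = c then 1 else 0) else τ (i, ⟨c, h⟩)
        have hτ' : τ'.submatrix id κ = 1 := by
          ext i j
          simp [τ', Matrix.one_apply, hκ.eq_iff]
        apply (algebraicIndependent_iff.1 hB)
        have h4 : aeval w (rename (fun p : B => Sum.inl (p : Fin r × Fin m))
            (aeval (R := ℂ) (Sum.elim (MvPolynomial.X : B → MvPolynomial B ℂ)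
              fun p => C (τ p)) f)) = 0 := by
          rw [hgen]
          intro u hu
          obtain ⟨u', hu', hul, hur⟩ := exists_mem_nrmPairs hu τ' hτ'
          have h5 := hf u' hu'
          have h6 := aeval_rename (R := ℂ) (S := ℂ) emb u' f
          have h7 : u' ∘ emb = Sum.elim (fun p : B => u (Sum.inl (p : Fin r × Fin m))) τ := by
            funext p
            rcases p with p | p
            · exact hul p
            · refine (hur p.1 p.2).trans ?_
              exact dif_neg p.2.2
          have h8 := aeval_rename (R := ℂ) (S := ℂ) (fun p : B => Sum.inl (p : Fin r × Fin m)) u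
            (aeval (R := ℂ) (Sum.elim (MvPolynomial.X : B → MvPolynomial B ℂ) fun p => C (τ p)) f)
          refine h8.trans ((hcomp _).trans ?_)
          rw [h7] at h6
          exact h6.symm.trans h5
        rw [aeval_rename] at h4
        exact h4
      refine MvPolynomial.funext fun y => ?_
      have h9 : (aeval (R := ℂ) (S₁ := ℂ) (y ∘ Sum.inl)).comp (aeval (R := ℂ)
          (Sum.elim (MvPolynomial.X : B → MvPolynomial B ℂ) fun p => C (y (Sum.inr p)))) =
          aeval (R := ℂ) (S₁ := ℂ) y := by
        ext p
        rcases p with p | p <;> simp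
      have h10 := congrArg (fun F : MvPolynomial (B ⊕ Fin s × O) ℂ →ₐ[ℂ] ℂ => F f) h9
      simp only [AlgHom.comp_apply, key, map_zero] at h10
      rw [map_zero]
      exact h10.symm
    have hind : (matroid ℂ K).Indep (Set.range (w ∘ emb)) :=
      AlgebraicIndependent.matroid_indep_iff.2 (AlgebraicIndependent.to_subtype_range hli)
    have hle := (matroid ℂ K).eRk_mono (Set.range_comp_subset_range emb w)
    rw [hind.eRk_eq_encard, ← Set.image_univ, hli.injective.injOn.encard_image,
      Set.encard_univ] at hle
    refine le_trans (le_of_eq ?_) hle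
    have hO : Nat.card O = r - s := by
      classical
      have h11 : Nat.card O = Fintype.card {c : Fin r // ¬ c ∈ Set.range κ} :=
        Nat.card_eq_fintype_card
      rw [h11, Fintype.card_subtype_compl]
      have h12 : Fintype.card {c : Fin r // c ∈ Set.range κ} = s := by
        rw [← Nat.card_eq_fintype_card]
        exact (Nat.card_range_of_injective hκ).trans (by simp)
      rw [h12, Fintype.card_fin]
    rw [hcard, ENat.card_eq_coe_natCard, Nat.card_sum, Nat.card_prod, hO, Nat.card_fin,
      ← ENat.card_coe_set_eq, ENat.card_eq_coe_natCard]
    push_cast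
    rfl

end SubspaceRank

/-! ### Chevalley's theorem and lifting of general points. -/

/-- A constructible set that contains a prime contains a neighbourhood of it in its closure. -/
theorem exists_of_mem_isConstructible {R : Type*} [CommRing R] {T : Set (PrimeSpectrum R)}
    (hT : IsConstructible T) {p : PrimeSpectrum R} (hp : p ∈ T) :
    ∃ H ∉ p.asIdeal, ∀ q : PrimeSpectrum R, p ≤ q → H ∉ q.asIdeal → q ∈ T := by
  obtain ⟨S, rfl⟩ := PrimeSpectrum.exists_constructibleSetData_iff.2 hT
  simp only [PrimeSpectrum.ConstructibleSetData.toSet, Set.mem_iUnion] at hp ⊢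
  obtain ⟨c, hc, hpc⟩ := hp
  refine ⟨c.f, fun h => hpc.2 ?_, fun q hpq hq => ⟨c, hc, ?_, fun h => hq ?_⟩⟩
  · simpa [PrimeSpectrum.mem_zeroLocus] using h
  · exact Set.Subset.trans hpc.1 hpq
  · simpa [PrimeSpectrum.mem_zeroLocus] using h

namespace SubspaceRank

/-- The points of a closed set that lift the general point of the image under a rational map. -/
theorem exists_ratMapSp_eq {η κ : Type} [Finite η] [Finite κ] {Y : Set (AffineSp η)}
    (hY : IsClosed Y) {K : Type} [Field K] [Algebra ℂ K] {z : η → K} (hz : IsGeneric Y z)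
    (P : κ → MvPolynomial η ℂ) (g : MvPolynomial η ℂ) (hg : aeval z g ≠ 0) :
    ∃ H : MvPolynomial κ ℂ, aeval (ratMap P g z) H ≠ 0 ∧ ∀ v : AffineSp κ,
      (∀ p, aeval (ratMap P g z) p = 0 → aeval (R := ℂ) (S₁ := ℂ) v p = 0) →
      aeval (R := ℂ) (S₁ := ℂ) v H ≠ 0 →
      ∃ y ∈ Y, aeval (R := ℂ) (S₁ := ℂ) y g ≠ 0 ∧ ratMapSp P g y = v := by
  -- An extra coordinate for the inverse of `g` makes the rational map polynomial on an affine
  -- variety.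
  let ζ : Option η → K := fun o => o.elim (aeval z g)⁻¹ z
  let J : Ideal (MvPolynomial (Option η) ℂ) := RingHom.ker (aeval (R := ℂ) ζ)
  have hJ : J.IsPrime := RingHom.ker_isPrime _
  let ψ : MvPolynomial κ ℂ →ₐ[ℂ] MvPolynomial (Option η) ℂ :=
    aeval fun j => rename some (P j) * X none
  let f : MvPolynomial κ ℂ →ₐ[ℂ] (MvPolynomial (Option η) ℂ ⧸ J) := (Ideal.Quotient.mkₐ ℂ J).comp ψ
  have hf : f.toRingHom.FinitePresentation := by
    rw [← RingHom.FinitePresentation.of_finiteType]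
    refine RingHom.FiniteType.of_comp_finiteType (f := (C : ℂ →+* MvPolynomial κ ℂ)) ?_
    have h1 : f.toRingHom.comp C = algebraMap ℂ (MvPolynomial (Option η) ℂ ⧸ J) :=
      f.comp_algebraMap
    rw [h1, RingHom.finiteType_algebraMap]
    infer_instance
  have hψ : ∀ p, aeval ζ (ψ p) = aeval (ratMap P g z) p := by
    intro p
    have h1 : (aeval ζ).comp ψ = aeval (ratMap P g z) := by
      ext j
      change aeval ζ (aeval _ (X j)) = _
      rw [aeval_X, aeval_X, map_mul, aeval_rename, aeval_X]
      exact (div_eq_mul_inv _ _).symm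
    exact congrArg (fun F : MvPolynomial κ ℂ →ₐ[ℂ] K => F p) h1
  let p₀ : PrimeSpectrum (MvPolynomial (Option η) ℂ ⧸ J) := ⟨⊥, Ideal.isPrime_bot⟩
  -- By Chevalley the image on spectra is constructible. It contains the image of the generic point,
  -- hence a neighbourhood of it in its closure.
  obtain ⟨H, hH, hHq⟩ := exists_of_mem_isConstructible
    (PrimeSpectrum.isConstructible_range_comap hf) ⟨p₀, rfl⟩
  have hmem : ∀ p, p ∈ (PrimeSpectrum.comap f.toRingHom p₀).asIdeal ↔
      aeval (ratMap P g z) p = 0 := by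
    intro p
    rw [← hψ]
    change f p ∈ (⊥ : Ideal (MvPolynomial (Option η) ℂ ⧸ J)) ↔ _
    rw [Ideal.mem_bot]
    exact Ideal.Quotient.eq_zero_iff_mem.trans Iff.rfl
  refine ⟨H, fun h => hH ((hmem H).2 h), fun v hv hvH => ?_⟩
  obtain ⟨Q, hQ⟩ := hHq (pointToPoint (k := ℂ) (K := ℂ) v)
    (fun p hp => (mem_pointToPoint_iff v p).2 (hv p ((hmem p).1 hp)))
    fun h => hvH ((mem_pointToPoint_iff v H).1 h)
  -- A maximal ideal above `Q` is a complex point by the Nullstellensatz. It still lies over `v`,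
  -- because the ideal of `v` contains all `X j - C (v j)`.
  obtain ⟨M, hM, hQM⟩ := Ideal.exists_le_maximal Q.asIdeal Q.2.ne_top
  have hM' : (M.comap (Ideal.Quotient.mk J)).IsMaximal :=
    Ideal.comap_isMaximal_of_surjective _ Ideal.Quotient.mk_surjective
  obtain ⟨x, hx⟩ := eq_vanishingIdeal_singleton_of_isMaximal (k := ℂ) ℂ hM'
  have hxJ : ∀ p : MvPolynomial (Option η) ℂ, aeval ζ p = 0 →
      aeval (R := ℂ) (S₁ := ℂ) x p = 0 := by
    intro p hp
    rw [← mem_vanishingIdeal_singleton_iff, ← hx, Ideal.mem_comap,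
      Ideal.Quotient.eq_zero_iff_mem.2 hp]
    exact M.zero_mem
  have hxv : ∀ p : MvPolynomial κ ℂ, aeval (R := ℂ) (S₁ := ℂ) v p = 0 →
      aeval (R := ℂ) (S₁ := ℂ) x (ψ p) = 0 := by
    intro p hp
    rw [← mem_vanishingIdeal_singleton_iff, ← hx, Ideal.mem_comap]
    apply hQM
    have h1 : p ∈ (PrimeSpectrum.comap f.toRingHom Q).asIdeal := by
      rw [hQ]
      exact (mem_pointToPoint_iff v p).2 hp
    exact h1
  let y : AffineSp η := fun i => x (some i)
  have hren : ∀ p : MvPolynomial η ℂ,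
      aeval (R := ℂ) (S₁ := ℂ) x (rename some p) = aeval (R := ℂ) (S₁ := ℂ) y p :=
    fun p => aeval_rename (R := ℂ) (S := ℂ) some x p
  have hgx : aeval (R := ℂ) (S₁ := ℂ) y g * x none = 1 := by
    have h1 := hxJ (rename some g * X none - 1) (by
      rw [map_sub, map_mul, aeval_rename, aeval_X, map_one, sub_eq_zero]
      exact mul_inv_cancel₀ hg)
    have h2 := aeval_X (R := ℂ) (S₁ := ℂ) x none
    rw [map_sub, map_mul, hren, h2, map_one, sub_eq_zero] at h1
    exact h1
  have hgy := left_ne_zero_of_mul (hgx.trans_ne one_ne_zero)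
  refine ⟨y, isClosed_affineSp_iff.1 hY y fun p hp => ?_, hgy, ?_⟩
  · rw [← hren]
    refine hxJ _ ?_
    rw [aeval_rename]
    exact (hz p).2 hp
  · funext j
    have hC := aeval_C (R := ℂ) (S₁ := ℂ) v (v j)
    have h1 := hxv (X j - C (v j)) (by
      rw [map_sub, aeval_X_point, hC]
      exact sub_self _)
    have h2 : ψ (X j - C (v j)) = rename some (P j) * X none - C (v j) := by
      rw [map_sub]
      congr 1
      · exact aeval_X _ j
      · exact aeval_C _ _
    have h3 := aeval_X (R := ℂ) (S₁ := ℂ) x none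
    have hC' := aeval_C (R := ℂ) (S₁ := ℂ) x (v j)
    rw [h2, map_sub, map_mul, hren, h3, hC', sub_eq_zero] at h1
    change aeval (R := ℂ) (S₁ := ℂ) y (P j) / aeval (R := ℂ) (S₁ := ℂ) y g = v j
    rw [div_eq_mul_inv, inv_eq_of_mul_eq_one_right hgx]
    exact h1

end SubspaceRank

/-! ### Dimension of the bundle and infinite fibres. -/

namespace SubspaceRank

variable {r s m : ℕ}

/-- It suffices to find one parameter where the minor is nonzero: keep a tuple with nonzero minor
`I` and choose the matrix so that the small space has an identity block in the columns `κ`. -/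
theorem aeval_pairMinor_pairPt_ne_zero {X : Set (PSpace m)} {a : Fin m}
    {K : Type} [Field K] [Algebra ℂ K] {z : Fin r × Fin m ⊕ Fin s × Fin r → K}
    (hz : IsGeneric (locus r s X a) z) {I : Fin r → Fin m}
    (hI : aeval (z ∘ Sum.inl) (minor I) ≠ 0) {κ : Fin s → Fin r} (hκ : Function.Injective κ) :
    aeval (pairPt z) (pairMinor (I, I ∘ κ)) ≠ 0 := by
  intro h0
  rw [← aeval_rename (R := ℂ), Ne, hz] at hI
  push Not at hI
  obtain ⟨y, hy, hyI⟩ := hI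
  have h1 : aeval (pairPt z) (pairMinor (I, I ∘ κ)) =
      aeval z (bind₁ (Sum.elim (bigPoly r s m) (smallPoly r s m)) (pairMinor (I, I ∘ κ))) := by
    rw [aeval_bind₁]; rfl
  have h2 := aeval_rename (R := ℂ) (S := ℂ) Sum.inl y (minor (r := r) (m := m) I)
  have h3 := aeval_minor (K := ℂ) I (y ∘ Sum.inl)
  rw [h2, h3] at hyI
  set x : Matrix (Fin r) (Fin m) ℂ := toMat (y ∘ Sum.inl) with hx
  let τ : Matrix (Fin s) (Fin r) ℂ := Matrix.of fun i c => if κ i = c then 1 else 0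
  let y' : AffineSp (Fin r × Fin m ⊕ Fin s × Fin r) :=
    Sum.elim (fun p => x p.1 p.2) fun p => (τ * (x.submatrix id I)⁻¹) p.1 p.2
  have h4 : toMat (K := ℂ) (y' ∘ Sum.inl) = x := rfl
  have h5 : toMat (K := ℂ) (y' ∘ Sum.inr) = τ * (x.submatrix id I)⁻¹ := rfl
  have hτ : τ.submatrix id κ = 1 := by
    ext i j
    simp [τ, Matrix.one_apply, hκ.eq_iff]
  have h6 := (aeval_pairMinor_pairPt_ne_zero_iff (K := ℂ) (z := y') (I := I) (κ := κ)).2 ⟨hyI, by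
    rw [h4, h5, Matrix.mul_assoc, Matrix.nonsing_inv_mul _ (isUnit_iff_ne_zero.2 hyI),
      Matrix.mul_one, hτ, Matrix.det_one]
    exact one_ne_zero⟩
  rw [h1, hz] at h0
  have h7 := aeval_bind₁_point y' (Sum.elim (bigPoly r s m) (smallPoly r s m))
    (pairMinor (I, I ∘ κ))
  exact h6 (h7.symm.trans (h0 y' hy))

theorem topologicalKrullDim_bundle {X : Set (PSpace m)} (hX : IsIrreducible X) {a : Fin m}
    (ha : (X ∩ (pSpaceAtlas m).dom a).Nonempty)
    {K : Type} [Field K] [Algebra ℂ K] {z : Fin r × Fin m ⊕ Fin s × Fin r → K}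
    (hz : IsGeneric (locus r s X a) z) {I : (Fin r → Fin m) × (Fin s → Fin m)}
    (hI : aeval (pairPt z) (pairMinor I) ≠ 0) :
    topologicalKrullDim (bundle r s X) =
      ((matroid ℂ K).eRk (Set.range ((grPairAtlas r s m).nrm I (pairPt z))) : WithBot ℕ∞) := by
  rw [bundle_eq_closure_pairSet hX ha]
  exact (grPairAtlas r s m).topologicalKrullDim_closure (isIrreducible_locus hX ha) hz
    (Sum.elim (bigPoly r s m) (smallPoly r s m)) (Z := pairSet r s X a) (fun _ => Iff.rfl) I hI

theorem topologicalKrullDim_sigma {X : Set (PSpace m)} (hX : IsIrreducible X) {a : Fin m}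
    (ha : (X ∩ (pSpaceAtlas m).dom a).Nonempty)
    {K : Type} [Field K] [Algebra ℂ K] {z : Fin r × Fin m ⊕ Fin s × Fin r → K}
    (hz : IsGeneric (locus r s X a) z) {I : (Fin r → Fin m) × (Fin s → Fin m)}
    (hI : aeval (pairPt z) (pairMinor I) ≠ 0) :
    topologicalKrullDim (sigma r s X) =
      ((matroid ℂ K).eRk (Set.range ((grPairAtlas r s m).nrm I (pairPt z) ∘ Sum.inr)) :
        WithBot ℕ∞) := by
  rw [sigma_eq_closure_smallSet hX ha]
  have hI' := hI
  rw [aeval_pairMinor] at hI'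
  have h := (grAtlas s m).topologicalKrullDim_closure (isIrreducible_locus hX ha) hz
    (smallPoly r s m) (Z := smallSet r s X a) (fun _ => Iff.rfl) I.2 (right_ne_zero_of_mul hI')
  have h1 : (grPairAtlas r s m).nrm I (pairPt z) =
      Sum.elim (ratMap (minorNum I.1) (minor I.1) (pairPt z ∘ Sum.inl))
        (ratMap (minorNum I.2) (minor I.2) (pairPt z ∘ Sum.inr)) := ratMap_pairMinor _ hI
  rw [h1, Sum.elim_comp_inr]
  exact h

/-- The dimension of the bundle of Grassmannians. -/
theorem topologicalKrullDim_bundle_eq {n : ℕ} {X : Set (PSpace m)} (hXc : IsClosed X)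
    (hX : IsIrreducible X) (hXn : Nondegenerate X)
    (hn : topologicalKrullDim X = (n : WithBot ℕ∞)) (hs : s ≤ r) (hr : r ≤ m) :
    topologicalKrullDim (bundle r s X) =
      ((min (r * n) (r * (m - r)) + s * (r - s) : ℕ) : WithBot ℕ∞) := by
  obtain ⟨a, ha⟩ := exists_inter_dom_nonempty hX
  obtain ⟨K, _, _, z, hz, -⟩ := exists_isGeneric (isIrreducible_locus (r := r) (s := s) hX ha)
  obtain ⟨I, hI⟩ := exists_aeval_minor_ne_zero hX hXn ha hr hz
  have hIp := aeval_pairMinor_pairPt_ne_zero hz hI (Fin.castLE_injective hs)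
  rw [topologicalKrullDim_bundle hX ha hz hIp, eRk_nrm_pairPt hX ha hz hIp]
  have h1 := topologicalKrullDim_sigma_self hX ha hz hI
  rw [topologicalKrullDim_sigma_self_eq hXc hX hXn hn hr] at h1
  have h2 : ((min (r * n) (r * (m - r)) : ℕ) : ℕ∞) = _ := WithBot.coe_injective h1
  rw [← h2]
  exact congrArg _ (by push_cast; rfl)

theorem topologicalKrullDim_sigma_le_bundle {X : Set (PSpace m)}
    (hX : IsIrreducible X) (hXn : Nondegenerate X) (hs : s ≤ r) (hr : r ≤ m) :
    topologicalKrullDim (sigma r s X) ≤ topologicalKrullDim (bundle r s X) := by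
  obtain ⟨a, ha⟩ := exists_inter_dom_nonempty hX
  obtain ⟨K, _, _, z, hz, -⟩ := exists_isGeneric (isIrreducible_locus (r := r) (s := s) hX ha)
  obtain ⟨I, hI⟩ := exists_aeval_minor_ne_zero hX hXn ha hr hz
  have hIp := aeval_pairMinor_pairPt_ne_zero hz hI (Fin.castLE_injective hs)
  rw [topologicalKrullDim_bundle hX ha hz hIp, topologicalKrullDim_sigma hX ha hz hIp]
  exact WithBot.coe_le_coe.2 ((matroid ℂ K).eRk_mono (Set.range_comp_subset_range _ _))

theorem eval_optionEquivLeft {β L : Type} [Field L] [Algebra ℂ L] (θ : L) (ν : β → L)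
    (p : MvPolynomial (Option β) ℂ) :
    aeval (fun o => o.elim θ ν) p =
      ((optionEquivLeft ℂ β p).map (aeval ν : MvPolynomial β ℂ →ₐ[ℂ] L).toRingHom).eval θ := by
  rw [Polynomial.eval_map]
  induction p using MvPolynomial.induction_on with
  | C c => simp [optionEquivLeft_C]
  | add p q hp hq => simp [hp, hq, Polynomial.eval₂_add]
  | mul_X p o hp =>
    rw [map_mul, map_mul, Polynomial.eval₂_mul, ← hp, aeval_X]
    congr 1
    cases o <;> simp [optionEquivLeft_X_none, optionEquivLeft_X_some]

/-- A coordinate that is transcendental over other coordinates takes infinitely many values over the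
general value of the other coordinates. -/
theorem exists_forall_infinite {η β : Type} [Finite η] [Finite β] {Y : Set (AffineSp η)}
    (hY : IsClosed Y) {K : Type} [Field K] [Algebra ℂ K] {z : η → K} (hz : IsGeneric Y z)
    (g : MvPolynomial η ℂ) (hg : aeval z g ≠ 0) (Pθ : MvPolynomial η ℂ)
    (P : β → MvPolynomial η ℂ)
    (hθ : aeval z Pθ / aeval z g ∉ (matroid ℂ K).closure (Set.range (ratMap P g z))) :
    ∃ G : MvPolynomial η ℂ, aeval z G ≠ 0 ∧ ∀ y ∈ Y, aeval (R := ℂ) (S₁ := ℂ) y g ≠ 0 →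
      aeval (R := ℂ) (S₁ := ℂ) y G ≠ 0 →
      {t : ℂ | ∃ y' ∈ Y, aeval (R := ℂ) (S₁ := ℂ) y' g ≠ 0 ∧
        aeval (R := ℂ) (S₁ := ℂ) y' Pθ / aeval (R := ℂ) (S₁ := ℂ) y' g = t ∧
        ratMapSp P g y' = ratMapSp P g y}.Infinite := by
  set θ := aeval z Pθ / aeval z g with hθdef
  set ν := ratMap P g z with hν
  let P' : Option β → MvPolynomial η ℂ := fun o => o.elim Pθ P
  have hP' : ratMap P' g z = fun o : Option β => o.elim θ ν := by
    funext o
    cases o <;> rfl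
  obtain ⟨H, hH, hlift⟩ := exists_ratMapSp_eq hY hz P' g hg
  rw [hP', eval_optionEquivLeft] at hH
  have hHne : (optionEquivLeft ℂ β H).map (aeval ν : MvPolynomial β ℂ →ₐ[ℂ] K).toRingHom ≠ 0 := by
    intro h
    rw [h, Polynomial.eval_zero] at hH
    exact hH rfl
  -- View `H` as a polynomial in the distinguished coordinate. One coefficient is nonzero at the
  -- generic point, and where it stays nonzero only finitely many values `t` are excluded.
  obtain ⟨k, hk⟩ := Polynomial.ext_iff.not.1 hHne |> not_forall.1
  rw [Polynomial.coeff_map, Polynomial.coeff_zero] at hk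
  set c := (optionEquivLeft ℂ β H).coeff k with hc
  obtain ⟨e, G, hG⟩ := exists_clear_denominators P g c
  refine ⟨G, ?_, fun y hy hgy hGy => ?_⟩
  · rw [← hG K z hg]
    exact mul_ne_zero hk (pow_ne_zero _ hg)
  have hcy : aeval (R := ℂ) (S₁ := ℂ) (ratMapSp P g y) c ≠ 0 := by
    intro h
    apply hGy
    rw [← hG ℂ y hgy]
    exact mul_eq_zero_of_left h _
  let q : Polynomial ℂ := (optionEquivLeft ℂ β H).map
    (aeval (R := ℂ) (S₁ := ℂ) (ratMapSp P g y) : MvPolynomial β ℂ →ₐ[ℂ] ℂ).toRingHom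
  have hq : q ≠ 0 := by
    intro h
    have := congrArg (fun p => Polynomial.coeff p k) h
    simp only [q, Polynomial.coeff_map, Polynomial.coeff_zero] at this
    exact hcy this
  have hsub : {t : ℂ | q.eval t = 0}ᶜ ⊆ {t : ℂ | ∃ y' ∈ Y, aeval (R := ℂ) (S₁ := ℂ) y' g ≠ 0 ∧
        aeval (R := ℂ) (S₁ := ℂ) y' Pθ / aeval (R := ℂ) (S₁ := ℂ) y' g = t ∧
        ratMapSp P g y' = ratMapSp P g y} := by
    intro t ht
    -- Transcendence of `θ` over `ν` forces every coefficient of a relation to vanish at `ν`, hence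
    -- at the image of `y`. The relation then holds for every `t`.
    have hv1 : ∀ p, aeval (ratMap P' g z) p = 0 → aeval (R := ℂ) (S₁ := ℂ)
        (fun o : Option β => o.elim t (ratMapSp P g y)) p = 0 := by
      intro p hp
      rw [hP', eval_optionEquivLeft] at hp
      have h1 : (optionEquivLeft ℂ β p).map (aeval ν : MvPolynomial β ℂ →ₐ[ℂ] K).toRingHom = 0 := by
        by_contra hne
        apply hθ
        rw [AlgebraicIndependent.matroid_closure_eq]
        change IsAlgebraic (Algebra.adjoin ℂ (Set.range ν)) θ
        let φ : MvPolynomial β ℂ →ₐ[ℂ] Algebra.adjoin ℂ (Set.range ν) :=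
          aeval fun b => ⟨ν b, Algebra.subset_adjoin ⟨b, rfl⟩⟩
        have hφ : (algebraMap (Algebra.adjoin ℂ (Set.range ν)) K).comp φ.toRingHom =
            (aeval ν : MvPolynomial β ℂ →ₐ[ℂ] K).toRingHom := by
          have : (Subalgebra.val _).comp φ = aeval ν := by
            ext b
            simp [φ]
          exact congrArg AlgHom.toRingHom this
        refine ⟨(optionEquivLeft ℂ β p).map φ.toRingHom, fun h => hne ?_, ?_⟩
        · rw [← hφ, ← Polynomial.map_map, h, Polynomial.map_zero]
        · rw [Polynomial.aeval_def, Polynomial.eval₂_map, hφ, ← Polynomial.eval_map]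
          exact hp
      have h2 : (optionEquivLeft ℂ β p).map
          (aeval (R := ℂ) (S₁ := ℂ) (ratMapSp P g y) : MvPolynomial β ℂ →ₐ[ℂ] ℂ).toRingHom = 0 := by
        ext j
        have h3 := congrArg (fun p => Polynomial.coeff p j) h1
        simp only [Polynomial.coeff_map, Polynomial.coeff_zero] at h3 ⊢
        obtain ⟨e', G', hG'⟩ := exists_clear_denominators P g ((optionEquivLeft ℂ β p).coeff j)
        have h4 : aeval z G' = 0 := by
          rw [← hG' K z hg]
          exact mul_eq_zero_of_left h3 _
        have h5 := (hz G').1 h4 y hy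
        rw [← hG' ℂ y hgy] at h5
        exact (mul_eq_zero.1 h5).resolve_right (pow_ne_zero _ hgy)
      refine (eval_optionEquivLeft (L := ℂ) t (ratMapSp P g y) p).trans ?_
      exact (congrArg (Polynomial.eval t) h2).trans Polynomial.eval_zero
    obtain ⟨y', hy', hgy', hv⟩ := hlift (fun o => o.elim t (ratMapSp P g y)) hv1 fun h =>
      ht ((eval_optionEquivLeft (L := ℂ) t (ratMapSp P g y) H).symm.trans h)
    exact ⟨y', hy', hgy', congrFun hv none, funext fun b => congrFun hv (some b)⟩
  refine Set.Infinite.mono hsub ?_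
  exact (Polynomial.finite_setOfPred_isRoot hq).infinite_compl

end SubspaceRank

/-! ### Consequences of generic finiteness. -/

namespace SubspaceRank

variable {r s m : ℕ}

/-- The pair of matrices with span in `pairSet r s X a` parametrised by a point of the locus. -/
noncomputable def pairPtSp (y : AffineSp (Fin r × Fin m ⊕ Fin s × Fin r)) :
    AffineSp (Fin r × Fin m ⊕ Fin s × Fin m) := pairPt (K := ℂ) y

/-- The second matrix of the pair. -/
noncomputable def smallPtSp (y : AffineSp (Fin r × Fin m ⊕ Fin s × Fin r)) :
    AffineSp (Fin s × Fin m) := fun p => aeval (R := ℂ) (S₁ := ℂ) y (smallPoly r s m p)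

theorem continuous_smallPtSp : Continuous (smallPtSp (r := r) (s := s) (m := m)) :=
  continuous_affineSp_of_polynomial continuous_id (smallPoly r s m) fun _ _ => rfl

theorem Frame.span_eq_of_ratMapSp_eq {w w' : Frame r m} (I : Fin r → Fin m)
    (h : aeval (R := ℂ) (S₁ := ℂ) w.entries (minor I) ≠ 0)
    (hw : ratMapSp (minorNum I) (minor I) w.entries = ratMapSp (minorNum I) (minor I) w'.entries) :
    w.span = w'.span := by
  have h1 : aeval (R := ℂ) (S₁ := ℂ) (ratMapSp (minorNum I) (minor I) w.entries) (minor I) = 1 :=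
    minor_ratMap (K := ℂ) h
  obtain ⟨v, hv⟩ := Frame.exists_entries I (ratMapSp (minorNum I) (minor I) w.entries)
    (h1.trans_ne one_ne_zero)
  exact (Frame.span_eq_of_entries w v I hv).symm.trans
    (Frame.span_eq_of_entries w' v I (hv.trans hw))

/-- The common value of the small subspaces of pairs whose normalised small matrices agree. -/
theorem small_eq_of_ratMapSp_eq {I : (Fin r → Fin m) × (Fin s → Fin m)} {w w' : FramePair r s m}
    (hw : aeval (R := ℂ) (S₁ := ℂ) w.entries (pairMinor I) ≠ 0)
    (hw' : aeval (R := ℂ) (S₁ := ℂ) w'.entries (pairMinor I) ≠ 0)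
    (h : ∀ b, ratMapSp (pairMinorNum I) (pairMinor I) w.entries (Sum.inr b) =
      ratMapSp (pairMinorNum I) (pairMinor I) w'.entries (Sum.inr b)) :
    w.span.small = w'.span.small := by
  have key : ∀ w : FramePair r s m, aeval (R := ℂ) (S₁ := ℂ) w.entries (pairMinor I) ≠ 0 →
      aeval (R := ℂ) (S₁ := ℂ) w.small.entries (minor I.2) ≠ 0 ∧ ∀ b,
      ratMapSp (pairMinorNum I) (pairMinor I) w.entries (Sum.inr b) =
        ratMapSp (minorNum I.2) (minor I.2) w.small.entries b := by
    intro w hw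
    have h1 := aeval_pairMinor (K := ℂ) I w.entries
    have h2 := ratMap_pairMinor (K := ℂ) I hw
    have h3 := hw
    rw [h1] at h3
    refine ⟨right_ne_zero_of_mul h3, fun b => ?_⟩
    rw [ratMapSp, h2, Sum.elim_inr]
    rfl
  refine Frame.span_eq_of_ratMapSp_eq I.2 (key w hw).1 (funext fun b => ?_)
  rw [← (key w hw).2 b, ← (key w' hw').2 b]
  exact h b

/-- A nonempty open subset of `σ_{r,s}(X)` contains a member whose parameters avoid a hypersurface
that does not contain the generic point. -/
theorem exists_mem_locus_small_mem {X : Set (PSpace m)} (hX : IsIrreducible X) {a : Fin m}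
    (ha : (X ∩ (pSpaceAtlas m).dom a).Nonempty)
    {K : Type} [Field K] [Algebra ℂ K] {z : Fin r × Fin m ⊕ Fin s × Fin r → K}
    (hz : IsGeneric (locus r s X a) z) {H : MvPolynomial (Fin r × Fin m ⊕ Fin s × Fin r) ℂ}
    (hH : aeval z H ≠ 0) {U : Set (Gr s m)} (hU : IsOpen U) (hne : (U ∩ sigma r s X).Nonempty) :
    ∃ y ∈ locus r s X a, aeval (R := ℂ) (S₁ := ℂ) y H ≠ 0 ∧
      ∀ w : Frame s m, w.entries = smallPtSp y → w.span ∈ U := by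
  rw [sigma_eq_closure_smallSet hX ha] at hne
  obtain ⟨E, hEσ, hEU⟩ : ∃ E, E ∈ smallSet r s X a ∧ E ∈ U := by
    obtain ⟨E, hEU, hE⟩ := hne
    obtain ⟨E', h1, h2⟩ := mem_closure_iff.1 hE U hU hEU
    exact ⟨E', h2, h1⟩
  obtain ⟨y₁, hy₁, w₁, rfl, hw₁⟩ := hEσ
  obtain ⟨I₁, hI₁⟩ := w₁.exists_minor
  have hUo : IsOpen (Frame.span ⁻¹' U) := hU.preimage (grAtlas s m).isQuotientMap_q.continuous
  obtain ⟨O, hO, hOU⟩ := (grAtlas s m).isInducing_ent.isOpen_iff.1 hUo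
  have hOU' : ∀ w : Frame s m, w.entries ∈ O ↔ w.span ∈ U := fun w => Set.ext_iff.1 hOU w
  obtain ⟨y₀, hy₀, hy₀H⟩ : ∃ y ∈ locus r s X a, aeval (R := ℂ) (S₁ := ℂ) y H ≠ 0 := by
    by_contra hcon
    push Not at hcon
    exact hH ((hz H).2 hcon)
  obtain ⟨y, hy, hyO, hyH⟩ := (isIrreducible_locus hX ha).isPreirreducible _ _
    (hO.preimage continuous_smallPtSp) (isOpen_setOf_aeval_ne_zero H)
    ⟨y₁, hy₁, by
      have h1 : w₁.entries ∈ O := (hOU' w₁).2 hEU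
      rw [hw₁] at h1
      exact h1⟩ ⟨y₀, hy₀, hy₀H⟩
  refine ⟨y, hy, hyH, fun w hw => (hOU' w).1 ?_⟩
  rw [hw]
  exact hyO

/-- If the projection is generically finite then the bundle is not larger than its image. -/
theorem topologicalKrullDim_bundle_le_sigma {X : Set (PSpace m)} (hXc : IsClosed X)
    (hX : IsIrreducible X) (hXn : Nondegenerate X) (hs : s ≤ r) (hr : r ≤ m)
    (hfin : GenericallyFinite r s X) :
    topologicalKrullDim (bundle r s X) ≤ topologicalKrullDim (sigma r s X) := by
  obtain ⟨a, ha⟩ := exists_inter_dom_nonempty hX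
  obtain ⟨K, _, _, z, hz, -⟩ := exists_isGeneric (isIrreducible_locus (r := r) (s := s) hX ha)
  obtain ⟨I₀, hI₀⟩ := exists_aeval_minor_ne_zero hX hXn ha hr hz
  have hI := aeval_pairMinor_pairPt_ne_zero hz hI₀ (Fin.castLE_injective hs)
  set I : (Fin r → Fin m) × (Fin s → Fin m) := (I₀, I₀ ∘ Fin.castLE hs) with hIdef
  rw [topologicalKrullDim_bundle hX ha hz hI, topologicalKrullDim_sigma hX ha hz hI]
  refine WithBot.coe_le_coe.2 ?_
  set u := (grPairAtlas r s m).nrm I (pairPt z) with hu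
  -- It is enough that each big coordinate is algebraic over the small ones.
  suffices hcl : Set.range u ⊆ (matroid ℂ K).closure (Set.range (u ∘ Sum.inr)) from
    ((matroid ℂ K).eRk_mono hcl).trans_eq (Matroid.eRk_closure_eq _ _)
  rintro _ ⟨q | q, rfl⟩
  rotate_left
  · exact (matroid ℂ K).mem_closure_of_mem' ⟨q, rfl⟩ trivial
  by_contra hq
  let φ := Sum.elim (bigPoly r s m) (smallPoly r s m)
  have hbind : ∀ p, aeval z (bind₁ φ p) = aeval (pairPt z) p := fun p => aeval_bind₁ _ _ _
  have hbindSp : ∀ (y : AffineSp (Fin r × Fin m ⊕ Fin s × Fin r)) p,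
      aeval (R := ℂ) (S₁ := ℂ) y (bind₁ φ p) = aeval (R := ℂ) (S₁ := ℂ) (pairPtSp y) p :=
    fun y p => aeval_bind₁_point y φ p
  obtain ⟨G, hG, hinf⟩ := exists_forall_infinite (isClosed_locus hXc a) hz (bind₁ φ (pairMinor I))
    (by rwa [hbind]) (bind₁ φ (pairMinorNum I (Sum.inl q)))
    (fun b => bind₁ φ (pairMinorNum I (Sum.inr b))) (by
      have h1 : ratMap (fun b => bind₁ φ (pairMinorNum I (Sum.inr b))) (bind₁ φ (pairMinor I)) z =
          u ∘ Sum.inr := by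
        funext b
        simp only [ratMap, hbind]
        rfl
      rw [h1, hbind, hbind]
      exact hq)
  obtain ⟨U, hU, hUne, hUfin⟩ := hfin
  obtain ⟨y₀, hy₀, hy₀H, hy₀U⟩ := exists_mem_locus_small_mem hX ha hz
    (H := bind₁ φ (pairMinor I) * G) (by rw [map_mul, hbind]; exact mul_ne_zero hI hG) hU hUne
  rw [map_mul] at hy₀H
  have hy₀g := left_ne_zero_of_mul hy₀H
  have hinf' := hinf y₀ hy₀ hy₀g (right_ne_zero_of_mul hy₀H)
  rw [hbindSp] at hy₀g
  obtain ⟨w₀, hw₀⟩ := (grPairAtlas r s m).exists_ent I (pairPtSp y₀) hy₀g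
  have hw₀' : w₀.entries = pairPtSp y₀ := hw₀
  have hw₀s : w₀.small.entries = smallPtSp y₀ := congrArg (· ∘ Sum.inr) hw₀'
  have hE₀U : w₀.small.span ∈ U := hy₀U w₀.small hw₀s
  have hE₀σ : w₀.small.span ∈ sigma r s X := by
    rw [sigma_eq_closure_smallSet hX ha]
    exact subset_closure ⟨y₀, hy₀, w₀.small, rfl, hw₀s⟩
  classical
  -- A finite fibre gives finitely many values of the big coordinate `q`, contrary to the infinitude
  -- just obtained. The value 0 outside the chart is a dummy, as the pairs used all lie in it.
  refine hinf' (Set.Finite.subset ((hUfin _ ⟨hE₀U, hE₀σ⟩).image fun p =>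
    if h : p ∈ (grPairAtlas r s m).dom I then
      ((grPairAtlas r s m).sect I ⟨p, h⟩).entries (Sum.inl q) else 0) ?_)
  rintro t ⟨y, hy, hyg, hyt, hyν⟩
  rw [hbindSp] at hyg hyt
  rw [hbindSp] at hyt
  obtain ⟨w, hw⟩ := (grPairAtlas r s m).exists_ent I (pairPtSp y) hyg
  have hw' : w.entries = pairPtSp y := hw
  refine ⟨w.span, ⟨?_, ?_⟩, ?_⟩
  · rw [bundle_eq_closure_pairSet hX ha]
    exact subset_closure ⟨y, hy, w, rfl, hw'⟩
  · refine small_eq_of_ratMapSp_eq (I := I) (by rwa [hw']) (by rwa [hw₀']) fun b => ?_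
    have h1 := congrFun hyν b
    have h2 : ∀ y, ratMapSp (fun b => bind₁ φ (pairMinorNum I (Sum.inr b)))
        (bind₁ φ (pairMinor I)) y b = (grPairAtlas r s m).nrmSp I (pairPtSp y) (Sum.inr b) :=
      fun y => congrArg₂ (· / ·) (hbindSp y _) (hbindSp y _)
    rw [h2, h2] at h1
    rw [hw', hw₀']
    exact h1
  · have hdom : w.span ∈ (grPairAtlas r s m).dom I :=
      ((grPairAtlas r s m).q_mem_dom_iff I w).2 (by rw [hw]; exact hyg)
    refine (dif_pos hdom).trans ?_
    have h1 := (grPairAtlas r s m).ent_sect I ⟨w.span, hdom⟩ (w := w) rfl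
    rw [hw] at h1
    exact (congrFun h1 (Sum.inl q)).trans hyt

end SubspaceRank

/-! ### Comparison of minima and conclusion. -/

namespace SubspaceRank

variable {r s m n : ℕ}

/-- The two minima can differ only if `r * (m - r) < r * n`. But `r * (m - r) + s * (r - s)` exceeds
`s * (m - s)` by `(r - s) * (m - r)`, so both minima are then `D`. -/
theorem min_bundle_dim (hs : s ≤ r) (hr : r ≤ m) {D : WithBot ℕ∞}
    (hD : D ≤ ((s * (m - s) : ℕ) : WithBot ℕ∞)) :
    min ((min (r * n) (r * (m - r)) + s * (r - s) : ℕ) : WithBot ℕ∞) D =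
      min ((r * n + s * (r - s) : ℕ) : WithBot ℕ∞) D := by
  have hcast : ∀ {a b : ℕ}, a ≤ b → (a : WithBot ℕ∞) ≤ b := fun h => by exact_mod_cast h
  rcases le_total (r * n) (r * (m - r)) with h | h
  · rw [min_eq_left h]
  · have h1 : s * (m - s) ≤ r * (m - r) + s * (r - s) := by
      obtain ⟨b, rfl⟩ := Nat.exists_eq_add_of_le hs
      obtain ⟨c, rfl⟩ := Nat.exists_eq_add_of_le hr
      rw [Nat.add_sub_cancel_left, Nat.add_sub_cancel_left, Nat.add_assoc s b c,
        Nat.add_sub_cancel_left]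
      nlinarith [Nat.zero_le (b * c)]
    rw [min_eq_right h, min_eq_right (hD.trans (hcast h1)),
      min_eq_right (hD.trans (hcast (h1.trans (Nat.add_le_add_right h _))))]

end SubspaceRank

theorem proposition3p2 (m n : ℕ) (X : Set (PSpace m))
    (hXclosed : IsClosed X) (hXirred : IsIrreducible X)
    (hXdim : topologicalKrullDim X = (n : WithBot ℕ∞))
    (hXnondeg : Nondegenerate X) :
    (∀ r : ℕ, r ≤ m →
      topologicalKrullDim (sigma r r X)
        = min ((r * n : ℕ) : WithBot ℕ∞) (topologicalKrullDim (Gr r m))) ∧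
    (∀ r s : ℕ, s ≤ r → r ≤ m →
      expectedDim r s X
        = min ((r * n + s * (r - s) : ℕ) : WithBot ℕ∞) (topologicalKrullDim (Gr s m)) ∧
      topologicalKrullDim (sigma r s X) ≤ expectedDim r s X ∧
      (GenericallyFinite r s X →
        topologicalKrullDim (sigma r s X) = expectedDim r s X)) := by
  have hcast : ∀ {a b : ℕ}, a ≤ b → (a : WithBot ℕ∞) ≤ b := fun h => by exact_mod_cast h
  refine ⟨fun r hr => ?_, fun r s hs hr => ?_⟩
  · have h1 := topologicalKrullDim_sigma_self_eq hXclosed hXirred hXnondeg hXdim hr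
    have h2 := topologicalKrullDim_subspace_le (Gr r m) (sigma r r X)
    apply le_antisymm
    · exact le_min (h1.le.trans (hcast (min_le_left _ _))) h2
    -- The upper bound `r * (m - r)` for the dimension of the Grassmannian suffices, since
    -- `σ_{r,r}(X)` is contained in it.
    · rw [h1]
      rcases min_cases (r * n) (r * (m - r)) with ⟨h, -⟩ | ⟨h, -⟩
      · rw [h]
        exact min_le_left _ _
      · rw [h]
        exact (min_le_right _ _).trans (topologicalKrullDim_gr_le hr)
  · have hB := topologicalKrullDim_bundle_eq hXclosed hXirred hXnondeg hXdim hs hr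
    have hG := topologicalKrullDim_subspace_le (Gr s m) (sigma r s X)
    have hle := topologicalKrullDim_sigma_le_bundle hXirred hXnondeg hs hr
    refine ⟨?_, le_min hle hG, fun h => ?_⟩
    · rw [expectedDim, hB]
      exact min_bundle_dim hs hr (topologicalKrullDim_gr_le (hs.trans hr))
    · have heq := le_antisymm hle
        (topologicalKrullDim_bundle_le_sigma hXclosed hXirred hXnondeg hs hr h)
      rw [expectedDim, ← heq, min_eq_left hG]
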